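/- **Setting.** Let $\mathcal X$ be a (connected, boundaryless, finite-dimensional, smooth) Riemannian manifold with its Riemannian distance and Borel $\sigma$-algebra, $f:\mathcal X\to\mathcal X$ measurable and $\mu$ an $f$-invariant probability measure. Let $\zeta$ be a repelling periodic point of prime period $p\ge 1$: $f$ is $C^1$ near each point of the orbit of $\zeta$, and all (complex) eigenvalues of $Df^p(\zeta)$ have modulus $>1$. Let $N\ge1$, $0=m_1<\dots<m_N\le p-1$, $m_{a+N}:=m_a+p$ for all $a\ge1$, and $\xi_a:=f^{m_a}(\zeta)$, so that $\xi_{a+N}=\xi_a$. Let $\varphi:\mathcal X\to[-\infty,\infty]$ be a measurable observable whose set of global maximum points is exactly $\{\xi_1,\dots,\xi_N\}$, put $u_F=\varphi(\zeta)$, $X_j=\varphi\circ f^j$, $U(u)=\{X_0>u\}$, and assume (R1) for all real $u<u_F$ sufficiently close to $u_F$, $U(u)=\bigcup_{i=1}^N B_{\varepsilon_i(u)}(\xi_i)$ with $\varepsilon_i(u)>0$, and $u\mapsto\mu(U(u))$ is continuous on a neighbourhood of $u_F$. Let $\tau>0$ and let $u_n$ be real levels with $u_n\to u_F$ and $n\,\mu(X_0>u_n)\to\tau$.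 Put $U_n=U(u_n)$, $U_n(\xi_i)=B_{\varepsilon_i(u_n)}(\xi_i)$ for $1\le i\le N$ and $U_n(\xi_{a+N})=U_n(\xi_a)$. Assume, in the cyclic indexing, (R3) for all $1\le i\le N$ and $j>i$, for all sufficiently large $n$ (depending on $i,j$), either $U_n(\xi_i)\subset f^{-(m_j-m_i)}(U_n(\xi_j))$ or $f^{-(m_j-m_i)}(U_n(\xi_j))\cap\partial U_n(\xi_i)=\emptyset$. Let $q=p$, $U_n^{(0)}=U_n$, $A^{(\kappa)}_{q,n}=U^{(\kappa)}_n\cap\bigcap_{t=1}^{q}f^{-t}\big((U_n^{(\kappa)})^c\big)$ and $U_n^{(\kappa+1)}=U_n^{(\kappa)}\setminus A_{q,n}^{(\kappa)}$. **Indices.** For fixed $n$, let $j_{i,0}=i$ and define inductively, for $k\ge0$: $I_{k+1}$ is the set of $i\in\{1,\dots,N\}$ such that $$\bigcup_{\ell=i+1}^{N+i}f^{-(m_{j_{\ell,k}}-m_i)}\big(U_n(\xi_{j_{\ell,k}})\big)\cap\partial U_n(\xi_i)=\emptyset;$$ for $i\in I_{k+1}$, $j_{i,k+1}$ is an index in $\{j_{\ell,k}:\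 i<\ell\le i+N\}$ such that $$\bigcup_{\ell=i+1}^{N+i}f^{-(m_{j_{\ell,k}}-m_i)}\big(U_n(\xi_{j_{\ell,k}})\big)\cap U_n(\xi_i)=f^{-(m_{j_{i,k+1}}-m_i)}\big(U_n(\xi_{j_{i,k+1}})\big)\cap U_n(\xi_i);$$ $j_{i,k+1}=i$ for $i\in\{1,\dots,N\}\setminus I_{k+1}$; and $j_{i+N,k}=j_{i,k}+N$ always. **Claim 1.** For every $k\ge0$ and all sufficiently large $n$ (depending on $k$), such sets $I_1,\dots,I_{k+1}$ and indices $j_{i,0},\dots,j_{i,k+1}$ exist, and for every admissible choice of them $$\mu\big(A^{(k)}_{q,n}\big)=\sum_{i\in I_{k+1}}\Big[\mu\big(f^{-(m_{j_{i,k}}-m_i)}(U_n(\xi_{j_{i,k}}))\cap U_n(\xi_i)\big)-\mu\big(f^{-(m_{j_{i,k+1}}-m_i)}(U_n(\xi_{j_{i,k+1}}))\cap U_n(\xi_i)\big)\Big].$$ **Claim 2.** Assume moreover that $(f,\mu)$ has summable decay of correlations against $L^1$ for a Banach space $\mathcal C_1$ of measurable functions: there is a summable $(\rho_t)$ with $\left|\int\phi\,(\psi\circ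 f^t)\,d\mu-\int\phi\,d\mu\int\psi\,d\mu\right|\le\rho_t\|\phi\|_{\mathcal C_1}\|\psi\|_{L^1(\mu)}$ for all $\phi\in\mathcal C_1$, $\psi\in L^1(\mu)$, $t\ge0$ (the integrals being well defined), and that for some constant $C$ and all large $n$ one has $\mathbf 1_{A^{(\kappa)}_{q,n}}\in\mathcal C_1$ and $\|\mathbf 1_{A^{(\kappa)}_{q,n}}\|_{\mathcal C_1}\le C$ for all $\kappa\ge0$. If the limits $$\theta=\lim_{n\to\infty}\frac{\mu(A^{(0)}_{q,n})}{\mu(U_n)}>0,\qquad \pi(k)=\lim_{n\to\infty}\frac{\mu(A^{(k-1)}_{q,n})-\mu(A^{(k)}_{q,n})}{\mu(A^{(0)}_{q,n})}\quad(k\ge1)$$ exist, then $\pi$ is a probability distribution on $\{1,2,\dots\}$, and the rare event point processes $N_n(J)=\#\{j\in v_nJ\cap\mathbb N_0:\ X_j>u_n\}$, $v_n=1/\mu(X_0>u_n)$, converge in distribution, in the space of counting measures on $[0,\infty)$ with the vague topology, to the compound Poisson process $\sum_{i\ge1}D_i\,\delta_{T_1+\dots+T_i}$ of intensity $\theta$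 and multiplicity distribution $\pi$ (all $T_i$, $D_i$ independent, $T_i$ exponential with mean $1/\theta$, $D_i$ with law $\pi$). -/

import Mathlib

open MeasureTheory ProbabilityTheory Filter Set
open scoped Topology NNReal ENNReal Manifold ContDiff Bundle CompactlySupported

noncomputable section

namespace RareEvents

/-! ### Point processes on `[0, ∞)` -/

/-- `ν` is a counting measure on `[0, ∞)`: finite on compact sets, with values in `ℕ ∪ {∞}`. -/
def IsCounting (ν : Measure ℝ≥0) : Prop :=
  (∀ K : Set ℝ≥0, IsCompact K → ν K < ⊤) ∧
    ∀ s : Set ℝ≥0, MeasurableSet s → ν s = ⊤ ∨ ∃ c : ℕ, ν s = (c : ℝ≥0∞)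

/-- The space of (locally finite) counting measures on `[0, ∞)`. -/
def CountingMeasure : Type := {ν : Measure ℝ≥0 // IsCounting ν}

/-- The vague topology: the coarsest one for which `ν ↦ ∫ ψ dν` is continuous for every
continuous `ψ : [0, ∞) → ℝ` with compact support. -/
instance : TopologicalSpace CountingMeasure :=
  TopologicalSpace.induced
    (fun (ν : CountingMeasure) (ψ : C_c(ℝ≥0, ℝ)) => ∫ t, ψ t ∂ν.1) inferInstance

instance : MeasurableSpace CountingMeasure := borel CountingMeasure

instance : BorelSpace CountingMeasure := ⟨rfl⟩

theorem isCounting_zero : IsCounting 0 :=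
  ⟨fun _ _ => by simp, fun _ _ => Or.inr ⟨0, by simp⟩⟩

open Classical in
/-- A measure regarded as an element of the space of counting measures. The fallback value `0`
concerns only measures that are not counting measures: for the processes below this happens on a
null event only (or for a level with `μ(X₀ > u) = 0`). -/
def toCounting (ν : Measure ℝ≥0) : CountingMeasure :=
  if h : IsCounting ν then ⟨ν, h⟩ else ⟨0, isCounting_zero⟩

/-- The canonical probability space of a compound Poisson process of intensity `θ` and
multiplicity distribution `P`: the pairs `(T_i, D_i)` are independent, `T_i` is exponential with
mean `1 / θ`, and `D_i` is independent of `T_i` with law `P`. -/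
def cpSpace (θ : ℝ) (_hθ : 0 < θ) (P : PMF ℕ) : Measure (ℕ → ℝ × ℕ) :=
  Measure.infinitePi fun _ => (expMeasure θ).prod P.toMeasure

instance (θ : ℝ) (hθ : 0 < θ) (P : PMF ℕ) : IsProbabilityMeasure (cpSpace θ hθ P) := by
  have := isProbabilityMeasure_expMeasure hθ
  unfold cpSpace
  infer_instance

/-- The compound Poisson process `∑ i, D_i δ_{T_0 + ⋯ + T_i}`. -/
def compoundPoisson (w : ℕ → ℝ × ℕ) : CountingMeasure :=
  toCounting <| Measure.sum fun i : ℕ =>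
    ((w i).2 : ℝ≥0∞) • Measure.dirac (∑ l ∈ Finset.range (i + 1), (w l).1).toNNReal

variable {X : Type*}

/-! ### Exceedances and rare event point processes -/

/-- The exceedance set `U(u) = {φ > u}`. -/
def exceed (φ : X → EReal) (u : ℝ) : Set X := {x | (u : EReal) < φ x}

/-- The points of `V` whose orbit does not visit `V` at the times `1, …, q`. -/
def escape (f : X → X) (q : ℕ) (V : Set X) : Set X :=
  V ∩ ⋂ t ∈ Finset.Icc 1 q, f^[t] ⁻¹' Vᶜ

/-- The nested sets `U^(0) = U`, `U^(κ+1) = U^(κ) \ A_q^(κ)`. -/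
def nestedU (f : X → X) (q : ℕ) (U : Set X) : ℕ → Set X
  | 0 => U
  | κ + 1 => nestedU f q U κ \ escape f q (nestedU f q U κ)

/-- `A_q^(κ)`: the points of `U^(κ)` whose orbit does not visit `U^(κ)` at times `1, …, q`. -/
def setA (f : X → X) (q : ℕ) (U : Set X) (κ : ℕ) : Set X := escape f q (nestedU f q U κ)

open Classical in
/-- The rare event point process of the set `U = {X₀ > u}`: an atom of mass one at `j / v` for
each exceedance time `j`, where `v = 1 / μ(U)`. Thus `N(J) = #{j ∈ v J ∩ ℕ₀ : X_j > u}`. -/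
def repp [MeasurableSpace X] (μ : Measure X) (f : X → X) (U : Set X) (x : X) :
    CountingMeasure :=
  toCounting <| Measure.sum fun j : ℕ =>
    if f^[j] x ∈ U then Measure.dirac ((j : ℝ≥0) / ((μ U).toNNReal)⁻¹) else 0

/-! ### Decay of correlations -/

/-- Summable decay of correlations against `L¹` observables, for the Banach space `B` of
measurable real functions on `X`; `ev` sends an element of `B` to the function that it is. -/
def SummableDecay [MeasurableSpace X] (μ : Measure X) (f : X → X)
    {B : Type*} [NormedAddCommGroup B] [NormedSpace ℝ B] (ev : B →ₗ[ℝ] (X → ℝ)) : Prop :=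
  ∃ ρ : ℕ → ℝ, Summable ρ ∧ ∀ (b : B) (ψ : X → ℝ), Measurable ψ → Integrable ψ μ → ∀ t : ℕ,
    Integrable (fun x => ev b x * ψ (f^[t] x)) μ ∧
    |(∫ x, ev b x * ψ (f^[t] x) ∂μ) - (∫ x, ev b x ∂μ) * ∫ x, ψ x ∂μ| ≤
      ρ t * (‖b‖ * ∫ x, |ψ x| ∂μ)

/-- Summable decay of correlations against `L¹`, together with a uniform bound of the norms in
`B` of the indicators of the sets `A_q^(κ)` of `U n`, for `n` large. -/
def AssumptionA [MeasurableSpace X] (μ : Measure X) (f : X → X) (q : ℕ) (U : ℕ → Set X)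
    {B : Type*} [NormedAddCommGroup B] [NormedSpace ℝ B] (ev : B →ₗ[ℝ] (X → ℝ)) : Prop :=
  (∀ b : B, Measurable (ev b)) ∧ SummableDecay μ f ev ∧
  ∃ C : ℝ, ∀ᶠ n in atTop, ∀ κ : ℕ, ∃ b : B,
    ev b = (setA f q (U n) κ).indicator (fun _ => (1 : ℝ)) ∧ ‖b‖ ≤ C

/-! ### The maxima and the regularity conditions -/

/-- `ζ` is a repelling periodic point of prime period `p`: `f` is `C¹` near each point of the
orbit, and all (complex) eigenvalues of `Df^p(ζ)` have modulus larger than one. -/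
def IsRepellingPeriodic (E : Type*) [NormedAddCommGroup E] [NormedSpace ℝ E]
    [FiniteDimensional ℝ E] [TopologicalSpace X] [ChartedSpace E X] (f : X → X) (p : ℕ)
    (ζ : X) : Prop :=
  0 < p ∧ Function.minimalPeriod f ζ = p ∧
  (∀ t : ℕ, ContMDiffAt 𝓘(ℝ, E) 𝓘(ℝ, E) 1 f (f^[t] ζ)) ∧
  -- both tangent spaces are `E`, and `f^[p] ζ = ζ`
  let D : E →L[ℝ] E := mfderiv 𝓘(ℝ, E) 𝓘(ℝ, E) (f^[p]) ζ
  ∀ z : ℂ, ((D : E →ₗ[ℝ] E).charpoly.map (algebraMap ℝ ℂ)).IsRoot z → 1 < ‖z‖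

/-- For levels `u < φ(ζ)` close to the maximum `φ(ζ)`, the set `U(u)` is the union of the balls
of radii `ε u i` around the `N` points `ξ i`, and `μ(U(u))` is continuous in `u` near `φ(ζ)`. -/
def CondR1 [MetricSpace X] [MeasurableSpace X] (μ : Measure X) (φ : X → EReal) (ζ : X)
    (N : ℕ) (ξ : ℕ → X) (ε : ℝ → ℕ → ℝ) : Prop :=
  ∃ u₀ : EReal, u₀ < φ ζ ∧
    (∀ u : ℝ, u₀ < u → (u : EReal) < φ ζ →
      (∀ i < N, 0 < ε u i) ∧ exceed φ u = ⋃ i ∈ Finset.range N, Metric.ball (ξ i) (ε u i)) ∧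
    ContinuousOn (fun u : ℝ => μ (exceed φ u)) {u : ℝ | u₀ < u}

/-- The ball of `U(u)` around `ξ a`, for every index `a` in the cyclic numbering (indices that
differ by a multiple of `N` give the same ball). -/
def localBall [MetricSpace X] (N : ℕ) (ξ : ℕ → X) (ε : ℝ → ℕ → ℝ) (u : ℝ) (a : ℕ) : Set X :=
  Metric.ball (ξ (a % N)) (ε u (a % N))

/-- `f^{-(m_a - m_i)}(S_a)`; it is only used for `i ≤ a`. -/
def pull (f : X → X) (m : ℕ → ℕ) (S : ℕ → Set X) (i a : ℕ) : Set X :=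
  f^[m a - m i] ⁻¹' S a

/-- For all `i < a` in the cyclic numbering and all large `n` (depending on `i`, `a`): either
`S_i ⊆ f^{-(m_a - m_i)}(S_a)`, or `f^{-(m_a - m_i)}(S_a)` does not meet the boundary of `S_i`. -/
def CondR3 [TopologicalSpace X] (f : X → X) (m : ℕ → ℕ) (N : ℕ) (S : ℕ → ℕ → Set X) : Prop :=
  ∀ i < N, ∀ a, i < a → ∀ᶠ n in atTop,
    S n i ⊆ pull f m (S n) i a ∨ pull f m (S n) i a ∩ frontier (S n i) = ∅

/-- `⋃_{ℓ=i+1}^{i+N} f^{-(m_{j_ℓ} - m_i)}(S_{j_ℓ})`. -/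
def pullUnion (f : X → X) (m : ℕ → ℕ) (N : ℕ) (S : ℕ → Set X) (j : ℕ → ℕ) (i : ℕ) : Set X :=
  ⋃ l ∈ Finset.Ioc i (i + N), pull f m S i (j l)

/-- `I_1, …, I_K` and `j_{i,0}, …, j_{i,K}` (written `j i k`) are obtained by the inductive
construction from the sets `S_a`. Maxima are numbered from `0`, so `I_k ⊆ {0, …, N - 1}`. -/
structure IsIndexSystem [TopologicalSpace X] (f : X → X) (m : ℕ → ℕ) (N : ℕ) (S : ℕ → Set X)
    (K : ℕ) (I : ℕ → Finset ℕ) (j : ℕ → ℕ → ℕ) : Prop where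
  zero : ∀ i, j i 0 = i
  shift : ∀ k ≤ K, ∀ i, j (i + N) k = j i k + N
  mem_I : ∀ k < K, ∀ i, i ∈ I (k + 1) ↔
    i < N ∧ pullUnion f m N S (fun l => j l k) i ∩ frontier (S i) = ∅
  of_mem : ∀ k < K, ∀ i ∈ I (k + 1),
    (∃ l ∈ Finset.Ioc i (i + N), j i (k + 1) = j l k) ∧
    pullUnion f m N S (fun l => j l k) i ∩ S i = pull f m S i (j i (k + 1)) ∩ S i
  of_not_mem : ∀ k < K, ∀ i < N, i ∉ I (k + 1) → j i (k + 1) = i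

end RareEvents

end

noncomputable section

namespace RareEvents

/-! ### The nested sets -/

section Nested

variable {X : Type*} {f : X → X} {q : ℕ} {U : Set X}

/-! Claim 1 is local topology. The determinant of the derivative of f^p at ζ has modulus larger than
one and is the product of the determinants along the orbit, so every iterate is a local
homeomorphism at every orbit point (`IsRepellingPeriodic.orbitGeometry`). The balls S_a shrink to
the maxima, hence a visit to U after t steps from S_i is a visit to the ball S_a with m_a = m_i + t
(`eventually_visit`). Riemannian balls are connected: if the pull-back of S_b to time m_c avoids the
boundary of S_c, then the local inverse image of S_b is a connected set containing ξ_c and lies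
inside S_c (`eventually_chain`). With (R3) this makes the localised preimages inside one ball
totally ordered by inclusion (`pull_total`), so a finite union of them equals one of them and the
indices exist. Since U^(k+1) consists of the points of U that revisit U^(k) within q steps
(`mem_nestedU_succ`), induction identifies U^(k) inside each ball (`nestedU_inter`), and the formula
follows by summing over disjoint balls.

Claim 2 rests on two facts about A^(κ). First, f^p expands volume near each ξ_a, so it cannot map
S_a into itself; (R3) then lets every late visit be moved back period by period, and a point of
A^(0) does not return to U before any prescribed time (`eventually_no_return`). Second, in a time
window with a single cluster that ends early enough, a visit followed by κ further visits is a visit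
to A^(κ) (`mem_setA_visits`). Hence z to the number of visits telescopes to 1 minus the sum of
weights (1 - z) z^κ over the visits to A^(κ) (`pow_visits_eq`). The exceptional windows are
controlled by pairs of visits to A^(0), which are rare by the first fact and decay of correlations.

Decay is available uniformly for the indicators of A^(κ), therefore for the weights. A block of time
of rescaled length s acts on the future as multiplication by e^{-s ℓ(z)} up to order s^2 and a
vanishing error (`eventually_blockDev_small`); subdividing the block removes the s^2
(`eventually_blockDev`). Composing blocks gives the limit of the joint generating functions of
counts in successive intervals (`tendsto_generating`).

For the compound Poisson process the same generating function comes from a renewal argument: a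
function fixed by the one-arrival operator has constant expectation along the arrivals
(`integral_arrivalProd_mul`). Equality of the limits of generating functions gives convergence of
joint cell counts, and approximation of vaguely open sets by finitely many cell counts gives
convergence in distribution (`tendstoInDistribution_of_cellCount`).

That π has total mass one is a counting fact. Two visits to A^(κ+1) are separated by a visit to
A^(κ), so the measures decrease in κ; the sets are disjoint in U, so μ(A^(κ)) is at most μ(U)/(κ+1)
and no mass escapes to infinity (`exists_multiplicity`). -/

theorem mem_escape {V : Set X} {x : X} :
    x ∈ escape f q V ↔ x ∈ V ∧ ∀ t, 1 ≤ t → t ≤ q → f^[t] x ∉ V := by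
  simp only [escape, mem_inter_iff, mem_iInter, Finset.mem_Icc, mem_preimage, mem_compl_iff, and_imp]

theorem nestedU_succ_subset (k : ℕ) : nestedU f q U (k + 1) ⊆ nestedU f q U k :=
  sdiff_subset

theorem nestedU_antitone : Antitone (nestedU f q U) :=
  antitone_nat_of_succ_le nestedU_succ_subset

theorem nestedU_subset (k : ℕ) : nestedU f q U k ⊆ U :=
  nestedU_antitone (Nat.zero_le k)

/-- Only membership in U, not in U^(k), has to be required: a point that revisits U^(k) also
revisits the larger sets before it, so by induction it has survived all earlier removals. -/
theorem mem_nestedU_succ {k : ℕ} {x : X} :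
    x ∈ nestedU f q U (k + 1) ↔ x ∈ U ∧ ∃ t, 1 ≤ t ∧ t ≤ q ∧ f^[t] x ∈ nestedU f q U k := by
  have aux : ∀ k, x ∈ nestedU f q U (k + 1) ↔
      x ∈ nestedU f q U k ∧ ∃ t, 1 ≤ t ∧ t ≤ q ∧ f^[t] x ∈ nestedU f q U k := by
    intro k
    simp only [nestedU, Set.mem_sdiff, mem_escape]
    constructor
    · rintro ⟨h1, h2⟩
      refine ⟨h1, ?_⟩
      by_contra! h3
      exact h2 ⟨h1, h3⟩
    · rintro ⟨h1, t, ht1, htq, ht⟩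
      exact ⟨h1, fun h => h.2 t ht1 htq ht⟩
  induction k with
  | zero => rw [aux]; rfl
  | succ k ih =>
    rw [aux]
    constructor
    · rintro ⟨h1, h2⟩
      exact ⟨nestedU_subset _ h1, h2⟩
    · rintro ⟨h1, t, ht1, htq, ht⟩
      exact ⟨ih.2 ⟨h1, t, ht1, htq, nestedU_succ_subset k ht⟩, t, ht1, htq, ht⟩

theorem setA_eq (k : ℕ) : setA f q U k = nestedU f q U k \ nestedU f q U (k + 1) := by
  ext x
  simp only [setA, nestedU, Set.mem_sdiff, not_and, not_not]
  exact ⟨fun h => ⟨h.1, fun _ => h⟩, fun h => h.2 h.1⟩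

theorem setA_subset (k : ℕ) : setA f q U k ⊆ U := by
  rw [setA_eq]; exact sdiff_subset.trans (nestedU_subset k)

theorem setA_disjoint {k l : ℕ} (h : k ≠ l) : Disjoint (setA f q U k) (setA f q U l) := by
  wlog hkl : k < l generalizing k l
  · exact (this h.symm (by omega)).symm
  rw [setA_eq, setA_eq, Set.disjoint_left]
  exact fun x hx hx' => hx.2 (nestedU_antitone (Nat.succ_le_of_lt hkl) hx'.1)

theorem mem_setA_zero {x : X} :
    x ∈ setA f q U 0 ↔ x ∈ U ∧ ∀ t, 1 ≤ t → t ≤ q → f^[t] x ∉ U :=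
  mem_escape

end Nested

/-! ### Index systems -/

section Index

variable {X : Type*} {f : X → X} {m : ℕ → ℕ} {N p B : ℕ} {S : ℕ → Set X}

theorem shift_time (hmN : ∀ a, m (a + N) = m a + p) (a c : ℕ) : m (a + N * c) = m a + p * c := by
  induction c with
  | zero => simp
  | succ c ih => rw [Nat.mul_succ, ← add_assoc, hmN, ih, Nat.mul_succ, add_assoc]

theorem shift_set (hS : ∀ a, S (a + N) = S a) (a c : ℕ) : S (a + N * c) = S a := by
  induction c with
  | zero => simp
  | succ c ih => rw [Nat.mul_succ, ← add_assoc, hS, ih]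

theorem pull_shift (hmN : ∀ a, m (a + N) = m a + p) (hS : ∀ a, S (a + N) = S a) (i a c : ℕ) :
    pull f m S (i + N * c) (a + N * c) = pull f m S i a := by
  unfold pull
  rw [shift_time hmN, shift_time hmN, shift_set hS, Nat.add_sub_add_right]

theorem pull_self (i : ℕ) : pull f m S i i = S i := by
  simp [pull]

theorem iterate_pull (hm : StrictMono m) {i c b : ℕ} (hic : i ≤ c) (hcb : c ≤ b) (x : X) :
    f^[m b - m c] (f^[m c - m i] x) = f^[m b - m i] x := by
  rw [← Function.iterate_add_apply]
  have := hm.monotone hic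
  have := hm.monotone hcb
  congr 1
  omega

variable [TopologicalSpace X]

/-- What the geometry near the orbit provides for one level, up to the horizon `B`. -/
structure LocalPicture (f : X → X) (m : ℕ → ℕ) (N p B : ℕ) (S : ℕ → Set X) : Prop where
  disj : ∀ i < N, ∀ j < N, i ≠ j → Disjoint (S i) (S j)
  visit : ∀ i < N, ∀ x ∈ S i, ∀ t, 1 ≤ t → t ≤ p → f^[t] x ∈ ⋃ i ∈ Finset.range N, S i →
    ∃ a, i < a ∧ m a = m i + t ∧ f^[t] x ∈ S a
  dichotomy : ∀ i < N, ∀ b, i < b → b ≤ i + B →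
    S i ⊆ pull f m S i b ∨ pull f m S i b ∩ frontier (S i) = ∅
  chain : ∀ i < N, ∀ c b, i ≤ c → c < b → b ≤ i + B → pull f m S c b ∩ frontier (S c) = ∅ →
    ∀ x ∈ S i, f^[m b - m i] x ∈ S b → f^[m c - m i] x ∈ S c

theorem LocalPicture.dichotomy_all (h : LocalPicture f m N p B S) (hN : 0 < N)
    (hmN : ∀ a, m (a + N) = m a + p) (hS : ∀ a, S (a + N) = S a) {i b : ℕ} (hib : i < b)
    (hb : b ≤ i + B) : S i ⊆ pull f m S i b ∨ pull f m S i b ∩ frontier (S i) = ∅ := by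
  have hi : i = i % N + N * (i / N) := (Nat.mod_add_div i N).symm
  have hb' : b = (b - N * (i / N)) + N * (i / N) := by omega
  rw [hi, hb', shift_set hS, pull_shift hmN hS]
  exact h.dichotomy _ (Nat.mod_lt _ hN) _ (by omega) (by omega)

namespace IsIndexSystem

variable {K : ℕ} {I : ℕ → Finset ℕ} {j : ℕ → ℕ → ℕ}

theorem shift_mul (h : IsIndexSystem f m N S K I j) {k : ℕ} (hk : k ≤ K) (i c : ℕ) :
    j (i + N * c) k = j i k + N * c := by
  induction c with
  | zero => simp
  | succ c ih => rw [Nat.mul_succ, ← add_assoc, h.shift k hk, ih, add_assoc]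

/-- Each step of the construction moves the index forward by at most one period N. This is why
finitely many instances of (R3), up to a horizon `B`, suffice for a given k. -/
theorem bounds (h : IsIndexSystem f m N S K I j) (hN : 0 < N) {k : ℕ} (hk : k ≤ K) (i : ℕ) :
    i ≤ j i k ∧ j i k ≤ i + k * N := by
  induction k generalizing i with
  | zero => simp [h.zero]
  | succ k ih =>
    have key : ∀ i < N, i ≤ j i (k + 1) ∧ j i (k + 1) ≤ i + (k + 1) * N := by
      intro i hi
      by_cases hI : i ∈ I (k + 1)
      · obtain ⟨⟨l, hl, hjl⟩, -⟩ := h.of_mem k (by omega) i hI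
        have := ih (by omega) l
        rw [Finset.mem_Ioc] at hl
        rw [Nat.succ_mul]
        omega
      · rw [h.of_not_mem k (by omega) i hi hI]
        omega
    have hi : i = i % N + N * (i / N) := (Nat.mod_add_div i N).symm
    rw [hi, h.shift_mul hk]
    have := key (i % N) (Nat.mod_lt _ hN)
    omega

/-- A localised preimage entering the construction does not stick out of the ball at which the
construction starts. -/
theorem escape_frontier (h : IsIndexSystem f m N S K I j) (hN : 0 < N)
    (hmN : ∀ a, m (a + N) = m a + p) (hS : ∀ a, S (a + N) = S a) {k : ℕ} (hk : k ≤ K) (i : ℕ) :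
    j i k = i ∨ pull f m S i (j i k) ∩ frontier (S i) = ∅ := by
  cases k with
  | zero => exact Or.inl (h.zero i)
  | succ k =>
    have hi : i = i % N + N * (i / N) := (Nat.mod_add_div i N).symm
    have hlt : i % N < N := Nat.mod_lt _ hN
    by_cases hI : i % N ∈ I (k + 1)
    · right
      rw [hi, h.shift_mul hk, pull_shift hmN hS, shift_set hS]
      obtain ⟨⟨l, hl, hjl⟩, -⟩ := h.of_mem k (by omega) _ hI
      have hfr := ((h.mem_I k (by omega) _).1 hI).2
      rw [← subset_empty_iff] at hfr ⊢
      refine (inter_subset_inter_left _ ?_).trans hfr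
      rw [hjl]
      exact subset_biUnion_of_mem (u := fun l => pull f m S (i % N) (j l k)) hl
    · left
      rw [hi, h.shift_mul hk, h.of_not_mem k (by omega) _ hlt hI]

/-- A visit to U^(k) within p steps lands in some S_a with i < a ≤ i + N, where the induction
hypothesis describes U^(k) by the index `j a k`. The times add up, which turns the condition into a
single pull-back to S_i. -/
theorem nestedU_succ_inter (h : IsIndexSystem f m N S K I j) (hm : StrictMono m)
    (hN : 0 < N) (hmN : ∀ a, m (a + N) = m a + p) (hS : ∀ a, S (a + N) = S a)
    (hL : LocalPicture f m N p B S) {k : ℕ} (hk : k ≤ K) (hB : (k + 1) * N ≤ B)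
    (ih : ∀ i < N, nestedU f p (⋃ i ∈ Finset.range N, S i) k ∩ S i =
      pull f m S i (j i k) ∩ S i) {i : ℕ} (hi : i < N) :
    nestedU f p (⋃ i ∈ Finset.range N, S i) (k + 1) ∩ S i =
      pullUnion f m N S (fun l => j l k) i ∩ S i := by
  have ih' : ∀ a, nestedU f p (⋃ i ∈ Finset.range N, S i) k ∩ S a =
      pull f m S a (j a k) ∩ S a := by
    intro a
    have ha : a = a % N + N * (a / N) := (Nat.mod_add_div a N).symm
    rw [ha, h.shift_mul hk, pull_shift hmN hS, shift_set hS]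
    exact ih _ (Nat.mod_lt _ hN)
  ext x
  simp only [mem_inter_iff, and_congr_left_iff]
  intro hx
  rw [mem_nestedU_succ]
  simp only [pullUnion, mem_iUnion, exists_prop, Finset.mem_Ioc]
  constructor
  · rintro ⟨-, t, ht1, htp, ht⟩
    obtain ⟨a, hia, hma, hfa⟩ := hL.visit i hi x hx t ht1 htp (nestedU_subset _ ht)
    refine ⟨a, ⟨hia, ?_⟩, ?_⟩
    · rw [← hm.le_iff_le, hmN, hma]; omega
    · have h1 : f^[t] x ∈ pull f m S a (j a k) ∩ S a := by rw [← ih' a]; exact ⟨ht, hfa⟩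
      have ht' : t = m a - m i := by omega
      have h2 := h1.1
      rw [pull, mem_preimage, ht', iterate_pull hm hia.le (h.bounds hN hk a).1] at h2
      exact h2
  · rintro ⟨a, ⟨hia, haN⟩, hxa⟩
    refine ⟨⟨i, Finset.mem_range.2 hi, hx⟩, m a - m i, ?_, ?_, ?_⟩
    · have := hm hia; omega
    · have := hm.monotone haN; rw [hmN] at this; omega
    · have hb := h.bounds hN hk a
      -- Lying in the pull-back with index `j a k` does not by itself say that the orbit passes
      -- through S_a on the way; when `j a k ≠ a`, the boundary condition and `chain` do.
      have hSa : f^[m a - m i] x ∈ S a := by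
        rcases h.escape_frontier hN hmN hS hk a with he | he
        · rw [he] at hxa; exact hxa
        · rcases hb.1.eq_or_lt with he' | hlt
          · rw [← he'] at hxa; exact hxa
          · refine hL.chain i hi a _ hia.le hlt ?_ he x hx hxa
            rw [Nat.succ_mul] at hB
            omega
      have h2 : f^[m a - m i] x ∈ pull f m S a (j a k) ∩ S a := by
        refine ⟨?_, hSa⟩
        rw [pull, mem_preimage, iterate_pull hm hia.le hb.1]
        exact hxa
      rw [← ih' a] at h2
      exact h2.1

/-- A point of the union on the boundary of S_i excludes the second alternative of (R3) for one of
the indices, so that single pull-back already covers S_i. -/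
theorem pullUnion_of_not_mem (h : IsIndexSystem f m N S K I j)
    (hN : 0 < N) (hL : LocalPicture f m N p B S) {k : ℕ} (hk : k < K)
    (hB : (k + 1) * N ≤ B) {i : ℕ} (hi : i < N) (hI : i ∉ I (k + 1)) :
    pullUnion f m N S (fun l => j l k) i ∩ S i = S i := by
  rw [h.mem_I k hk, not_and] at hI
  have hne := nonempty_iff_ne_empty.2 (hI hi)
  obtain ⟨x, hx, hxf⟩ := hne
  simp only [pullUnion, mem_iUnion, exists_prop] at hx
  obtain ⟨l, hl, hxl⟩ := hx
  have hb := h.bounds hN hk.le l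
  rw [Finset.mem_Ioc] at hl
  rw [Nat.succ_mul] at hB
  rcases hL.dichotomy i hi (j l k) (by omega) (by omega) with hd | hd
  · refine inter_eq_right.2 (hd.trans ?_)
    exact subset_biUnion_of_mem (u := fun l => pull f m S i (j l k)) (Finset.mem_Ioc.2 hl)
  · exact absurd (show x ∈ (∅ : Set X) from hd ▸ ⟨hxl, hxf⟩) (notMem_empty x)

/-- For i outside I_{k+1} the whole ball survives the removal, and the convention j_{i,k+1} = i
encodes this because the pull-back with index i is S_i itself. -/
theorem nestedU_inter (h : IsIndexSystem f m N S K I j) (hm : StrictMono m)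
    (hN : 0 < N) (hmN : ∀ a, m (a + N) = m a + p) (hS : ∀ a, S (a + N) = S a)
    (hL : LocalPicture f m N p B S) {k : ℕ} (hk : k ≤ K) (hB : k * N ≤ B) :
    ∀ i < N, nestedU f p (⋃ i ∈ Finset.range N, S i) k ∩ S i =
      pull f m S i (j i k) ∩ S i := by
  induction k with
  | zero =>
    intro i hi
    rw [h.zero, pull_self, inter_self]
    exact inter_eq_right.2 (subset_biUnion_of_mem (u := S) (Finset.mem_range.2 hi))
  | succ k ih =>
    intro i hi
    have hB' : k * N ≤ B := (Nat.mul_le_mul_right N (Nat.le_succ k)).trans hB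
    rw [h.nestedU_succ_inter hm hN hmN hS hL (by omega) hB (ih (by omega) hB') hi]
    by_cases hI : i ∈ I (k + 1)
    · exact (h.of_mem k hk i hI).2
    · rw [h.pullUnion_of_not_mem hN hL hk hB hi hI, h.of_not_mem k hk i hi hI, pull_self,
        inter_self]

end IsIndexSystem

/-- For c < b, apply the dichotomy at S_c to the pull-back of S_b. If it covers S_c, pulling back
further to S_i gives one inclusion; if it avoids the boundary of S_c, visiting S_b forces visiting
S_c first, which gives the other. -/
theorem LocalPicture.pull_total (hL : LocalPicture f m N p B S) (hm : StrictMono m)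
    (hN : 0 < N) (hmN : ∀ a, m (a + N) = m a + p) (hS : ∀ a, S (a + N) = S a)
    {i b c : ℕ} (hi : i < N) (hib : i ≤ b) (hic : i ≤ c) (hbB : b ≤ i + B) (hcB : c ≤ i + B) :
    pull f m S i b ∩ S i ⊆ pull f m S i c ∩ S i ∨
      pull f m S i c ∩ S i ⊆ pull f m S i b ∩ S i := by
  wlog hcb : c ≤ b generalizing b c
  · exact (this hic hib hcB hbB (by omega)).symm
  rcases hcb.eq_or_lt with rfl | hlt
  · exact Or.inl subset_rfl
  rcases hL.dichotomy_all hN hmN hS hlt (by omega) with hd | hd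
  · right
    refine inter_subset_inter_left _ fun x hx => ?_
    have := hd hx
    rwa [pull, mem_preimage, iterate_pull hm hic hcb] at this
  · left
    exact fun x hx => ⟨hL.chain i hi c b hic hlt hbB hd x hx.2 hx.1, hx.2⟩

theorem exists_isIndexSystem (hm : StrictMono m)
    (hN : 0 < N) (hmN : ∀ a, m (a + N) = m a + p) (hS : ∀ a, S (a + N) = S a)
    (hL : LocalPicture f m N p B S) (K : ℕ) (hB : K * N ≤ B) :
    ∃ I j, IsIndexSystem f m N S K I j := by
  classical
  induction K with
  | zero =>
    exact ⟨fun _ => ∅, fun i _ => i, fun _ => rfl, fun _ _ _ => rfl, by simp, by simp, by simp⟩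
  | succ K ih =>
    have hB' : K * N ≤ B := (Nat.mul_le_mul_right N (Nat.le_succ K)).trans hB
    obtain ⟨I, j, h⟩ := ih hB'
    set I' : Finset ℕ := (Finset.range N).filter
      fun i => pullUnion f m N S (fun l => j l K) i ∩ frontier (S i) = ∅ with hI'
    have hex : ∀ i < N, ∃ b, (∃ l ∈ Finset.Ioc i (i + N), b = j l K) ∧
        pullUnion f m N S (fun l => j l K) i ∩ S i = pull f m S i b ∩ S i := by
      intro i hi
      let g : ℕ → Set X := fun l => pull f m S i (j l K) ∩ S i
      have hne : (Finset.Ioc i (i + N)).Nonempty := ⟨i + N, by simp [hN]⟩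
      -- An inclusion-maximal member of the finite family is its greatest member, since any two
      -- members are comparable.
      obtain ⟨T, hT, hmaxT⟩ := ((Finset.Ioc i (i + N)).image g).exists_maximal (hne.image g)
      obtain ⟨l, hl, rfl⟩ := Finset.mem_image.1 hT
      refine ⟨j l K, ⟨l, hl, rfl⟩, ?_⟩
      refine subset_antisymm ?_ ?_
      · rintro x ⟨hx, hxi⟩
        simp only [pullUnion, mem_iUnion, exists_prop] at hx
        obtain ⟨l', hl', hx⟩ := hx
        have b1 := h.bounds hN le_rfl l
        have b2 := h.bounds hN le_rfl l'
        have hl1 := Finset.mem_Ioc.1 hl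
        have hl2 := Finset.mem_Ioc.1 hl'
        rw [Nat.succ_mul] at hB
        rcases hL.pull_total hm hN hmN hS hi (b := j l' K) (c := j l K) (by omega) (by omega)
          (by omega) (by omega) with hc | hc
        · exact hc ⟨hx, hxi⟩
        · exact hmaxT (Finset.mem_image_of_mem g hl') hc ⟨hx, hxi⟩
      · exact inter_subset_inter_left _
          (subset_biUnion_of_mem (u := fun l => pull f m S i (j l K)) hl)
    choose! b hb1 hb2 using hex
    let new : ℕ → ℕ := fun i => if i ∈ I' then b i else i
    -- Levels up to K are kept; the new level is prescribed on 0, …, N - 1 and extended so as to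
    -- commute with the shift by N.
    refine ⟨fun k => if k ≤ K then I k else I',
      fun i k => if k ≤ K then j i k else new (i % N) + N * (i / N), ?_, ?_, ?_, ?_, ?_⟩
    · intro i; simp [h.zero]
    · intro k hk i
      by_cases hkK : k ≤ K
      · simp only [hkK, if_true]; exact h.shift k hkK i
      · simp only [hkK, if_false]
        rw [Nat.add_mod_right, Nat.add_div_right _ hN, Nat.mul_succ, add_assoc]
    · intro k hk i
      by_cases hkK : k < K
      · simp only [Nat.succ_le_of_lt hkK, hkK.le, if_true]; exact h.mem_I k hkK i
      · obtain rfl : k = K := by omega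
        simp [hI']
    · intro k hk i hi
      by_cases hkK : k < K
      · simp only [Nat.succ_le_of_lt hkK, hkK.le, if_true] at hi ⊢; exact h.of_mem k hkK i hi
      · obtain rfl : k = K := by omega
        simp only [Nat.not_succ_le_self, le_refl, if_true, if_false] at hi ⊢
        have hiN : i < N := by
          rw [hI', Finset.mem_filter, Finset.mem_range] at hi; exact hi.1
        rw [Nat.mod_eq_of_lt hiN, Nat.div_eq_of_lt hiN]
        simp only [new, hi, if_true, mul_zero, add_zero]
        exact ⟨hb1 i hiN, hb2 i hiN⟩
    · intro k hk i hiN hi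
      by_cases hkK : k < K
      · simp only [Nat.succ_le_of_lt hkK, if_true] at hi ⊢
        exact h.of_not_mem k hkK i hiN hi
      · obtain rfl : k = K := by omega
        simp only [Nat.not_succ_le_self, if_false] at hi ⊢
        rw [Nat.mod_eq_of_lt hiN, Nat.div_eq_of_lt hiN]
        simp [new, hi]

end Index

/-! ### The measure of the sets `A_q^(k)` -/

section Measure

variable {X : Type*} [MeasurableSpace X] {f : X → X} {q : ℕ} {U : Set X}

theorem measurableSet_nestedU (hf : Measurable f) (hU : MeasurableSet U) (k : ℕ) :
    MeasurableSet (nestedU f q U k) := by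
  induction k with
  | zero => exact hU
  | succ k ih =>
    refine ih.diff (ih.inter ?_)
    exact Finset.measurableSet_biInter _ fun t _ => (hf.iterate t) ih.compl

theorem measurableSet_setA (hf : Measurable f) (hU : MeasurableSet U) (k : ℕ) :
    MeasurableSet (setA f q U k) := by
  rw [setA_eq]
  exact (measurableSet_nestedU hf hU k).diff (measurableSet_nestedU hf hU _)

theorem measure_setA_eq_sum [TopologicalSpace X] {μ : Measure X} [IsFiniteMeasure μ]
    (hf : Measurable f) {m : ℕ → ℕ} {N p B : ℕ} {S : ℕ → Set X} (hSm : ∀ a, MeasurableSet (S a))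
    (hm : StrictMono m) (hN : 0 < N) (hmN : ∀ a, m (a + N) = m a + p)
    (hS : ∀ a, S (a + N) = S a) (hL : LocalPicture f m N p B S) {k : ℕ}
    (hB : (k + 1) * N ≤ B) {I : ℕ → Finset ℕ} {j : ℕ → ℕ → ℕ}
    (h : IsIndexSystem f m N S (k + 1) I j) :
    μ.real (setA f p (⋃ i ∈ Finset.range N, S i) k) =
      ∑ i ∈ I (k + 1), (μ.real (pull f m S i (j i k) ∩ S i) -
        μ.real (pull f m S i (j i (k + 1)) ∩ S i)) := by
  set U := ⋃ i ∈ Finset.range N, S i with hU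
  have hUm : MeasurableSet U := Finset.measurableSet_biUnion _ fun i _ => hSm i
  have hsplit : ∀ l, μ.real (nestedU f p U l) =
      ∑ i ∈ Finset.range N, μ.real (nestedU f p U l ∩ S i) := by
    intro l
    rw [← measureReal_biUnion_finset]
    · congr 1
      rw [← inter_iUnion₂, ← hU, inter_eq_left.2 (nestedU_subset l)]
    · intro a ha b hb hab
      exact (hL.disj a (by simpa using ha) b (by simpa using hb) hab).mono
        inter_subset_right inter_subset_right
    · exact fun i _ => (measurableSet_nestedU hf hUm l).inter (hSm i)
  have hB' : k * N ≤ B := (Nat.mul_le_mul_right N (Nat.le_succ k)).trans hB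
  have h0 := h.nestedU_inter hm hN hmN hS hL (Nat.le_succ k) hB'
  have h1 := h.nestedU_inter hm hN hmN hS hL le_rfl hB
  rw [setA_eq, measureReal_sdiff (nestedU_succ_subset k) (measurableSet_nestedU hf hUm _),
    hsplit, hsplit, ← Finset.sum_sub_distrib]
  have hIN : I (k + 1) ⊆ Finset.range N := fun i hi =>
    Finset.mem_range.2 ((h.mem_I k (Nat.lt_succ_self k) i).1 hi).1
  rw [← Finset.sum_subset hIN]
  · refine Finset.sum_congr rfl fun i hi => ?_
    rw [h0 i (Finset.mem_range.1 (hIN hi)), h1 i (Finset.mem_range.1 (hIN hi))]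
  · intro i hi hiI
    have hiN := Finset.mem_range.1 hi
    -- Balls with index outside I_{k+1} contribute zero: U^(k+1) fills them, hence so does the
    -- larger U^(k).
    have e1 : nestedU f p U (k + 1) ∩ S i = S i := by
      rw [h1 i hiN, h.of_not_mem k (Nat.lt_succ_self k) i hiN hiI, pull_self, inter_self]
    have e0 : nestedU f p U k ∩ S i = S i :=
      subset_antisymm inter_subset_right
        (e1.symm.subset.trans (inter_subset_inter_left _ (nestedU_succ_subset k)))
    rw [e0, e1, sub_self]

end Measure

/-! ### Local geometry of a map near a point -/

section Geometry

/-- A point of the ball is joined to the centre by a C¹ curve of length less than r, and every point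
of that curve is reached from the centre by a still shorter piece, so the curve stays in the ball.
-/
theorem isPreconnected_ball (E : Type*) [NormedAddCommGroup E] [NormedSpace ℝ E] {X : Type*}
    [MetricSpace X] [ChartedSpace E X] [IsManifold 𝓘(ℝ, E) ∞ X]
    [Bundle.RiemannianBundle (fun x : X => TangentSpace 𝓘(ℝ, E) x)]
    [IsContMDiffRiemannianBundle 𝓘(ℝ, E) ∞ E (fun x : X => TangentSpace 𝓘(ℝ, E) x)]
    [IsRiemannianManifold 𝓘(ℝ, E) X] (x : X) (r : ℝ) : IsPreconnected (Metric.ball x r) := by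
  refine isPreconnected_of_forall x fun y hy => ?_
  have hy' : Manifold.riemannianEDist 𝓘(ℝ, E) x y < ENNReal.ofReal r := by
    rw [← IsRiemannianManifold.out (I := 𝓘(ℝ, E)) x y, edist_comm]
    rwa [edist_lt_ofReal]
  obtain ⟨γ, h0, h1, hγ, hlen⟩ := Manifold.exists_lt_of_riemannianEDist_lt hy'
  refine ⟨γ '' Icc 0 1, ?_, ⟨0, by simp, h0⟩, ⟨1, by simp, h1⟩,
    isPreconnected_Icc.image γ hγ.continuousOn⟩
  rintro _ ⟨t, ht, rfl⟩
  rw [Metric.mem_ball, dist_comm, ← edist_lt_ofReal, IsRiemannianManifold.out (I := 𝓘(ℝ, E))]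
  calc Manifold.riemannianEDist 𝓘(ℝ, E) x (γ t)
      ≤ Manifold.pathELength 𝓘(ℝ, E) γ 0 t :=
        Manifold.riemannianEDist_le_pathELength (hγ.mono (Icc_subset_Icc_right ht.2)) h0 rfl ht.1
    _ ≤ Manifold.pathELength 𝓘(ℝ, E) γ 0 1 := Manifold.pathELength_mono le_rfl ht.2
    _ < _ := hlen

/-- The Riemannian distance here is that of a metric space, hence finite, so two points always lie
in a common ball; connectedness of the manifold is a consequence. -/
theorem preconnectedSpace_of_riemannian (E : Type*) [NormedAddCommGroup E] [NormedSpace ℝ E] {X : Type*}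
    [MetricSpace X] [ChartedSpace E X] [IsManifold 𝓘(ℝ, E) ∞ X]
    [Bundle.RiemannianBundle (fun x : X => TangentSpace 𝓘(ℝ, E) x)]
    [IsContMDiffRiemannianBundle 𝓘(ℝ, E) ∞ E (fun x : X => TangentSpace 𝓘(ℝ, E) x)]
    [IsRiemannianManifold 𝓘(ℝ, E) X] : PreconnectedSpace X :=
  ⟨isPreconnected_of_forall_pair fun x _ y _ =>
    ⟨Metric.ball x (dist y x + 1), subset_univ _, by
      simpa using add_pos_of_nonneg_of_pos dist_nonneg one_pos, by simp,
      isPreconnected_ball E x _⟩⟩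

/-! ### Determinants of derivatives and the inverse function theorem in charts. -/

variable {E : Type*} [NormedAddCommGroup E] [NormedSpace ℝ E]

variable {X : Type*} [TopologicalSpace X] [ChartedSpace E X] {g : X → X} {x : X}

variable (E) in
/-- The determinant of the derivative, all tangent spaces being `E`. -/
def mdet (g : X → X) (x : X) : ℝ :=
  ContinuousLinearMap.det (show E →L[ℝ] E from mfderiv 𝓘(ℝ, E) 𝓘(ℝ, E) g x)

theorem mdet_comp {h : X → X} (hh : MDifferentiableAt 𝓘(ℝ, E) 𝓘(ℝ, E) h (g x))
    (hg : MDifferentiableAt 𝓘(ℝ, E) 𝓘(ℝ, E) g x) :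
    mdet E (h ∘ g) x = mdet E h (g x) * mdet E g x := by
  unfold mdet
  rw [mfderiv_comp x hh hg]
  exact LinearMap.det_comp (M := E) _ _

theorem mdet_id : mdet E (id : X → X) x = 1 := by
  unfold mdet
  rw [mfderiv_id]
  exact LinearMap.det_id (M := E)

theorem contMDiffAt_iterate {f : X → X} {ζ : X}
    (hf : ∀ t : ℕ, ContMDiffAt 𝓘(ℝ, E) 𝓘(ℝ, E) 1 f (f^[t] ζ)) (t r : ℕ) :
    ContMDiffAt 𝓘(ℝ, E) 𝓘(ℝ, E) 1 f^[r] (f^[t] ζ) := by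
  induction r with
  | zero => exact contMDiffAt_id
  | succ r ih =>
    rw [Function.iterate_succ']
    refine ContMDiffAt.comp _ ?_ ih
    rw [← Function.iterate_add_apply]
    exact hf _

theorem mdet_iterate {f : X → X} {ζ : X}
    (hf : ∀ t : ℕ, ContMDiffAt 𝓘(ℝ, E) 𝓘(ℝ, E) 1 f (f^[t] ζ)) (t r : ℕ) :
    mdet E f^[r] (f^[t] ζ) = ∏ s ∈ Finset.range r, mdet E f (f^[t + s] ζ) := by
  induction r with
  | zero => simpa using mdet_id
  | succ r ih =>
    rw [Finset.prod_range_succ, Function.iterate_succ', mdet_comp, ih, mul_comm,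
      ← Function.iterate_add_apply, add_comm r t]
    · rw [← Function.iterate_add_apply]
      exact (hf _).mdifferentiableAt one_ne_zero
    · exact (contMDiffAt_iterate hf t r).mdifferentiableAt one_ne_zero

theorem hasStrictFDerivAt_writtenInExtChartAt (hg : ContMDiffAt 𝓘(ℝ, E) 𝓘(ℝ, E) 1 g x) :
    HasStrictFDerivAt (writtenInExtChartAt 𝓘(ℝ, E) 𝓘(ℝ, E) x g)
      (show E →L[ℝ] E from mfderiv 𝓘(ℝ, E) 𝓘(ℝ, E) g x) (extChartAt 𝓘(ℝ, E) x x) := by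
  have h1 : ContDiffAt ℝ 1 (writtenInExtChartAt 𝓘(ℝ, E) 𝓘(ℝ, E) x g)
      (extChartAt 𝓘(ℝ, E) x x) := by
    have := (contMDiffAt_iff.1 hg).2
    simp only [modelWithCornersSelf_coe, range_id, contDiffWithinAt_univ] at this
    exact this
  have h2 := h1.hasStrictFDerivAt one_ne_zero
  rw [(hg.mdifferentiableAt one_ne_zero).mfderiv]
  simpa using h2

variable [FiniteDimensional ℝ E]

/-- This is the inverse function theorem applied to g written in the charts at x and g x. -/
theorem exists_openPartialHomeomorph_of_mdet_ne_zero
    (hg : ContMDiffAt 𝓘(ℝ, E) 𝓘(ℝ, E) 1 g x) (hdet : mdet E g x ≠ 0) :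
    ∃ e : OpenPartialHomeomorph X X, x ∈ e.source ∧ EqOn e g e.source := by
  set F := writtenInExtChartAt 𝓘(ℝ, E) 𝓘(ℝ, E) x g with hF
  set D : E →L[ℝ] E := mfderiv 𝓘(ℝ, E) 𝓘(ℝ, E) g x with hD
  have hstrict := hasStrictFDerivAt_writtenInExtChartAt hg
  have hu : IsUnit D.det := isUnit_iff_ne_zero.2 hdet
  set D' : E ≃L[ℝ] E := D.toContinuousLinearEquivOfDetNeZero hdet
  have hs' : HasStrictFDerivAt F (D' : E →L[ℝ] E) (extChartAt 𝓘(ℝ, E) x x) := hstrict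
  set e₁ := hs'.toOpenPartialHomeomorph F
  have he₁ : (e₁ : E → E) = F := hs'.toOpenPartialHomeomorph_coe
  set e := (chartAt E x).trans (e₁.trans (chartAt E (g x)).symm)
  have hcont := hg.continuousAt
  -- The map rebuilt from the charts agrees with g only where g takes values in the chart domain at
  -- g x, whence the restriction to O.
  obtain ⟨O, hOsub, hO, hxO⟩ := mem_nhds_iff.1
    (hcont.preimage_mem_nhds (chart_source_mem_nhds E (g x)))
  refine ⟨e.restrOpen O hO, ?_, ?_⟩
  · rw [OpenPartialHomeomorph.restrOpen_source]
    refine ⟨?_, hxO⟩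
    simp only [e, OpenPartialHomeomorph.trans_source, mem_inter_iff, mem_preimage,
      OpenPartialHomeomorph.symm_source]
    refine ⟨mem_chart_source E x, hs'.mem_toOpenPartialHomeomorph_source, ?_⟩
    rw [he₁, hF]
    simp [writtenInExtChartAt, mfld_simps]
  · intro y hy
    rw [OpenPartialHomeomorph.restrOpen_source] at hy
    have hy1 : y ∈ (chartAt E x).source := hy.1.1
    have hy2 : g y ∈ (chartAt E (g x)).source := hOsub hy.2
    change (chartAt E (g x)).symm (e₁ (chartAt E x y)) = g y
    rw [he₁, hF]
    simp [writtenInExtChartAt, mfld_simps, hy1, hy2]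

/-- A map which expands volume at a fixed point maps no small neighbourhood into itself. -/
theorem eventually_not_mapsTo_of_one_lt_mdet (hgx : g x = x)
    (hg : ContMDiffAt 𝓘(ℝ, E) 𝓘(ℝ, E) 1 g x) (hdet : 1 < |mdet E g x|) :
    ∃ O ∈ 𝓝 x, ∀ V ⊆ O, IsOpen V → V.Nonempty → ¬ MapsTo g V V := by
  let : MeasurableSpace E := borel E
  have : BorelSpace E := ⟨rfl⟩
  set vol : Measure E := Measure.addHaar
  set F := writtenInExtChartAt 𝓘(ℝ, E) 𝓘(ℝ, E) x g with hF
  set D : E →L[ℝ] E := mfderiv 𝓘(ℝ, E) 𝓘(ℝ, E) g x with hD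
  have hstrict : HasStrictFDerivAt F D (extChartAt 𝓘(ℝ, E) x x) :=
    hasStrictFDerivAt_writtenInExtChartAt hg
  obtain ⟨c, hc1, hc2⟩ := exists_between hdet
  lift c to ℝ≥0 using (zero_lt_one.trans hc1).le
  have hm : (c : ℝ≥0∞) < ENNReal.ofReal |D.det| := by
    rw [ENNReal.lt_ofReal_iff_toReal_lt (by simp)]; exact hc2
  -- A map sufficiently close to its derivative D multiplies volumes by at least c, where 1 < c <
  -- |det D|.
  obtain ⟨δ, hδ, hδ0⟩ := ((mul_le_addHaar_image_of_lt_det vol D hm).and self_mem_nhdsWithin).exists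
  obtain ⟨s, hs, hlin⟩ := hstrict.approximates_deriv_on_nhds (c := δ) (Or.inr hδ0)
  set ch := chartAt E x
  have hchx : ch x = extChartAt 𝓘(ℝ, E) x x := by simp [ch, mfld_simps]
  -- The unit ball keeps the volume of the chart image of V finite; otherwise c · vol ≤ vol would be
  -- no contradiction.
  have hpre : ch ⁻¹' (s ∩ Metric.ball (ch x) 1) ∈ 𝓝 x :=
    (ch.continuousAt (mem_chart_source E x)).preimage_mem_nhds
      (inter_mem (hchx ▸ hs) (Metric.ball_mem_nhds _ one_pos))
  refine ⟨ch ⁻¹' (s ∩ Metric.ball (ch x) 1) ∩ ch.source,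
    inter_mem hpre (chart_source_mem_nhds E x), fun V hV hVo hVne hmaps => ?_⟩
  have hVs : V ⊆ ch.source := fun y hy => (hV hy).2
  have himg : F '' (ch '' V) ⊆ ch '' V := by
    rintro _ ⟨_, ⟨y, hy, rfl⟩, rfl⟩
    refine ⟨g y, hmaps hy, ?_⟩
    have := hVs hy
    simp only [hF, writtenInExtChartAt, hgx]
    simp [mfld_simps, ch] at this ⊢
    rw [(chartAt E x).left_inv this]
  have hle : (c : ℝ≥0∞) * vol (ch '' V) ≤ vol (ch '' V) :=
    (hδ _ _ (hlin.mono_set (by rintro _ ⟨y, hy, rfl⟩; exact (hV hy).1.1))).trans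
      (measure_mono himg)
  have hpos : vol (ch '' V) ≠ 0 :=
    ((ch.isOpen_image_iff_of_subset_source hVs).2 hVo).measure_ne_zero _ (hVne.image _)
  have hfin : vol (ch '' V) ≠ ⊤ := by
    refine ((measure_mono ?_).trans_lt (measure_ball_lt_top (x := ch x) (r := 1))).ne
    rintro _ ⟨y, hy, rfl⟩; exact (hV hy).1.2
  have : vol (ch '' V) < c * vol (ch '' V) := by
    conv_lhs => rw [← one_mul (vol (ch '' V))]
    exact ENNReal.mul_lt_mul_left hpos hfin (by exact_mod_cast hc1)
  exact absurd hle (not_le.2 this)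

end Geometry

/-- Up to sign the determinant is the constant coefficient of the characteristic polynomial, the
product of its complex roots. Positive dimension guarantees at least one root; an empty product
would only give 1. -/
theorem one_lt_abs_det_of_roots {E : Type*} [NormedAddCommGroup E] [NormedSpace ℝ E]
    [FiniteDimensional ℝ E] [Nontrivial E] (D : E →L[ℝ] E)
    (hD : ∀ z : ℂ, ((D : E →ₗ[ℝ] E).charpoly.map (algebraMap ℝ ℂ)).IsRoot z → 1 < ‖z‖) :
    1 < |D.det| := by
  set P := (D : E →ₗ[ℝ] E).charpoly.map (algebraMap ℝ ℂ) with hP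
  have hmonic : P.Monic := (LinearMap.charpoly_monic _).map _
  have hsplit : P.Splits := IsAlgClosed.splits P
  have hcoeff : ‖P.coeff 0‖ = |D.det| := by
    have h1 := LinearMap.det_eq_sign_charpoly_coeff (D : E →ₗ[ℝ] E)
    rw [ContinuousLinearMap.det, h1, abs_mul, abs_pow, hP, Polynomial.coeff_map]
    simp
  have hprod : ‖P.coeff 0‖ = (P.roots.map (fun z => ‖z‖)).prod := by
    rw [hsplit.coeff_zero_eq_prod_roots_of_monic hmonic, norm_mul, norm_pow, norm_neg, norm_one, one_pow, one_mul]
    exact Multiset.prod_hom P.roots (normHom : ℂ →*₀ ℝ) |>.symm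
  have hcard : P.roots.card ≠ 0 := by
    rw [← hsplit.natDegree_eq_card_roots, hP, Polynomial.natDegree_map, LinearMap.charpoly_natDegree]
    exact Module.finrank_pos.ne'
  rw [← hcoeff, hprod]
  have key : ∀ s : Multiset ℂ, (∀ z ∈ s, 1 < ‖z‖) → 1 ≤ (s.map (fun z => ‖z‖)).prod ∧
      (s.card ≠ 0 → 1 < (s.map (fun z => ‖z‖)).prod) := by
    intro s
    induction s using Multiset.induction with
    | empty => simp
    | cons a s ih =>
      intro h
      have ha := h a (Multiset.mem_cons_self a s)
      have hs := (ih fun z hz => h z (Multiset.mem_cons_of_mem hz)).1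
      rw [Multiset.map_cons, Multiset.prod_cons]
      have : 1 < ‖a‖ * (s.map (fun z => ‖z‖)).prod := by nlinarith
      exact ⟨this.le, fun _ => this⟩
  exact (key P.roots fun z hz => hD z (Polynomial.isRoot_of_mem_roots hz)).2 hcard

/-! ### The sets around the maxima for levels close to the maximum -/

section Shrinking

variable {X : Type*} [TopologicalSpace X]

/-- The topological consequences of `ζ` being a repelling periodic point of prime period `p`. -/
structure OrbitGeometry (f : X → X) (p : ℕ) (ζ : X) : Prop where
  pos : 0 < p
  minimalPeriod : Function.minimalPeriod f ζ = p
  homeo : ∀ t r, ∃ e : OpenPartialHomeomorph X X, f^[t] ζ ∈ e.source ∧ EqOn e f^[r] e.source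
  expand : ∀ t, ∃ O ∈ 𝓝 (f^[t] ζ), ∀ V ⊆ O, IsOpen V → V.Nonempty → ¬ MapsTo f^[p] V V

/-- The sets `S n a` are connected open neighbourhoods of `ξ a` which shrink to `ξ a`. -/
structure Shrinking (S : ℕ → ℕ → Set X) (ξ : ℕ → X) (N : ℕ) : Prop where
  shift : ∀ n a, S n (a + N) = S n a
  isOpen : ∀ n a, IsOpen (S n a)
  preconnected : ∀ n a, IsPreconnected (S n a)
  mem : ∀ a, ∀ᶠ n in atTop, ξ a ∈ S n a
  small : ∀ a, ∀ O ∈ 𝓝 (ξ a), ∀ᶠ n in atTop, S n a ⊆ O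

variable {f : X → X} {m : ℕ → ℕ} {N p : ℕ} {ζ : X} {S : ℕ → ℕ → Set X}

theorem OrbitGeometry.continuousAt (hG : OrbitGeometry f p ζ) (t r : ℕ) :
    ContinuousAt f^[r] (f^[t] ζ) := by
  obtain ⟨e, he, heq⟩ := hG.homeo t r
  exact (e.continuousAt he).congr (eventually_of_mem (e.open_source.mem_nhds he) heq)

theorem time_lt_period (hm : StrictMono m) (hm0 : m 0 = 0) (hmN : ∀ a, m (a + N) = m a + p)
    {i : ℕ} (hi : i < N) : m i < p := by
  have := hm hi
  have := hmN 0
  rw [zero_add] at this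
  omega

/-- If f^t(ξ_i) ≠ ξ_b, disjoint neighbourhoods rule out the visit for small balls. If they coincide,
primality of the period gives m_i + t ≡ m_b mod p, and the number of full periods tells by how many
multiples of N to raise the index b. -/
theorem OrbitGeometry.eventually_visit [T2Space X] (hG : OrbitGeometry f p ζ)
    (hm : StrictMono m) (hm0 : m 0 = 0) (hmN : ∀ a, m (a + N) = m a + p)
    (hS : Shrinking S (fun i => f^[m i] ζ) N) (T : ℕ) :
    ∀ᶠ n in atTop, ∀ i < N, ∀ x ∈ S n i, ∀ t, 1 ≤ t → t ≤ T →
      f^[t] x ∈ ⋃ i ∈ Finset.range N, S n i → ∃ a, i < a ∧ m a = m i + t ∧ f^[t] x ∈ S n a := by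
  have key : ∀ i ∈ Finset.range N, ∀ t ∈ Finset.Icc 1 T, ∀ b ∈ Finset.range N, ∀ᶠ n in atTop,
      ∀ x ∈ S n i, f^[t] x ∈ S n b → ∃ a, i < a ∧ m a = m i + t ∧ f^[t] x ∈ S n a := by
    intro i hi t ht b hb
    rw [Finset.mem_range] at hi hb
    rw [Finset.mem_Icc] at ht
    have hval : f^[t] (f^[m i] ζ) = f^[m i + t] ζ := by
      rw [← Function.iterate_add_apply, add_comm]
    by_cases hη : f^[m i + t] ζ = f^[m b] ζ
    · have hmod : (m i + t) % p = m b := by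
        refine Function.iterate_injOn_Iio_minimalPeriod (f := f) (x := ζ) ?_ ?_ ?_
        · rw [mem_Iio, hG.minimalPeriod]; exact Nat.mod_lt _ hG.pos
        · rw [mem_Iio, hG.minimalPeriod]; exact time_lt_period hm hm0 hmN hb
        · change f^[(m i + t) % p] ζ = f^[m b] ζ
          rw [← hη, ← hG.minimalPeriod, Function.iterate_mod_minimalPeriod_eq]
      have hma : m (b + N * ((m i + t) / p)) = m i + t := by
        rw [shift_time hmN, ← hmod, Nat.mod_add_div]
      refine Eventually.of_forall fun n x _ hx => ⟨b + N * ((m i + t) / p), ?_, hma, ?_⟩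
      · rw [← hm.lt_iff_lt, hma]; omega
      · rwa [shift_set (hS.shift n)]
    · obtain ⟨O₁, O₂, hO₁, hO₂, h₁, h₂, hd⟩ := t2_separation hη
      have hc := hG.continuousAt (m i) t
      have hpre : f^[t] ⁻¹' O₁ ∈ 𝓝 (f^[m i] ζ) := by
        refine hc.preimage_mem_nhds ?_
        rw [hval]; exact hO₁.mem_nhds h₁
      filter_upwards [hS.small i _ hpre, hS.small b _ (hO₂.mem_nhds h₂)] with n h1 h2 x hx hxb
      exact absurd (h2 hxb) (Set.disjoint_left.1 hd (h1 hx))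
  have key' := (Filter.eventually_all_finset _).2 fun i hi => (Filter.eventually_all_finset _).2
    fun t ht => (Filter.eventually_all_finset _).2 fun b hb => key i hi t ht b hb
  filter_upwards [key'] with n hn i hi x hx t ht1 htT hxU
  simp only [mem_iUnion, exists_prop] at hxU
  obtain ⟨b, hb, hxb⟩ := hxU
  exact hn i (Finset.mem_range.2 hi) t (Finset.mem_Icc.2 ⟨ht1, htT⟩) b hb x hx hxb

/-- The local inverse of f^(m_b - m_c) maps the ball S_b onto a connected set through ξ_c. Avoiding
the boundary of S_c it must stay in S_c, and it contains the orbit point in question by injectivity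
of the local homeomorphism. -/
theorem OrbitGeometry.eventually_chain (hG : OrbitGeometry f p ζ) (hm : StrictMono m)
    (hS : Shrinking S (fun i => f^[m i] ζ) N) (i c b : ℕ) (hic : i ≤ c) (hcb : c < b) :
    ∀ᶠ n in atTop, pull f m (S n) c b ∩ frontier (S n c) = ∅ →
      ∀ x ∈ S n i, f^[m b - m i] x ∈ S n b → f^[m c - m i] x ∈ S n c := by
  obtain ⟨e, he, heq⟩ := hG.homeo (m c) (m b - m c)
  have hmcb := hm hcb
  have hmic := hm.monotone hic
  have hecb : e (f^[m c] ζ) = f^[m b] ζ := by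
    rw [heq he, ← Function.iterate_add_apply]; congr 1; omega
  have hic' : f^[m c - m i] (f^[m i] ζ) = f^[m c] ζ := by
    rw [← Function.iterate_add_apply]; congr 1; omega
  have hpre : f^[m c - m i] ⁻¹' e.source ∈ 𝓝 (f^[m i] ζ) := by
    refine (hG.continuousAt _ _).preimage_mem_nhds ?_
    rw [hic']; exact e.open_source.mem_nhds he
  have htgt : e.target ∈ 𝓝 (f^[m b] ζ) := by
    rw [← hecb]; exact e.open_target.mem_nhds (e.map_source he)
  filter_upwards [hS.small i _ hpre, hS.small b _ htgt, hS.mem c, hS.mem b]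
    with n h1 h2 h3 h4 hfr x hx hxb
  set y := f^[m c - m i] x
  have hyb : e y ∈ S n b := by
    rw [heq (h1 hx), iterate_pull hm hic hcb.le]; exact hxb
  have hsub : e.symm '' S n b ⊆ pull f m (S n) c b := by
    rintro _ ⟨w, hw, rfl⟩
    rw [pull, mem_preimage, ← heq (e.map_target (h2 hw)), e.right_inv (h2 hw)]
    exact hw
  have hconn : IsPreconnected (e.symm '' S n b) :=
    (hS.preconnected n b).image _ (e.continuousOn_symm.mono h2)
  have hcover : e.symm '' S n b ⊆ S n c ∪ (closure (S n c))ᶜ := by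
    intro w hw
    by_cases hwc : w ∈ S n c
    · exact Or.inl hwc
    · refine Or.inr fun hcl => ?_
      have hwf : w ∈ frontier (S n c) := by
        rw [(hS.isOpen n c).frontier_eq]; exact ⟨hcl, hwc⟩
      exact absurd (show w ∈ (∅ : Set X) from hfr ▸ ⟨hsub hw, hwf⟩) (notMem_empty w)
  refine hconn.subset_left_of_subset_union (hS.isOpen n c) isClosed_closure.isOpen_compl
    (Set.disjoint_left.2 fun w hw hw' => hw' (subset_closure hw)) hcover
    ⟨f^[m c] ζ, ⟨f^[m b] ζ, h4, ?_⟩, h3⟩ ⟨e y, hyb, e.left_inv (h1 hx)⟩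
  rw [← hecb, e.left_inv he]

theorem OrbitGeometry.eventually_localPicture [T2Space X] (hG : OrbitGeometry f p ζ)
    (hm : StrictMono m) (hm0 : m 0 = 0) (hmN : ∀ a, m (a + N) = m a + p)
    (hS : Shrinking S (fun i => f^[m i] ζ) N) (hR3 : CondR3 f m N S) (B : ℕ) :
    ∀ᶠ n in atTop, LocalPicture f m N p B (S n) := by
  have hdisj : ∀ᶠ n in atTop, ∀ i ∈ Finset.range N, ∀ j ∈ Finset.range N, i ≠ j →
      Disjoint (S n i) (S n j) := by
    refine (Filter.eventually_all_finset _).2 fun i hi =>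
      (Filter.eventually_all_finset _).2 fun j hj => ?_
    rw [Finset.mem_range] at hi hj
    by_cases hij : i = j
    · exact Eventually.of_forall fun n h => absurd hij h
    have hne : f^[m i] ζ ≠ f^[m j] ζ := by
      intro h
      refine hij (hm.injective (Function.iterate_injOn_Iio_minimalPeriod (f := f) (x := ζ) ?_ ?_ h))
        <;> rw [mem_Iio, hG.minimalPeriod] <;> apply time_lt_period hm hm0 hmN <;> assumption
    obtain ⟨O₁, O₂, hO₁, hO₂, h₁, h₂, hd⟩ := t2_separation hne
    filter_upwards [hS.small i _ (hO₁.mem_nhds h₁), hS.small j _ (hO₂.mem_nhds h₂)] with n h1 h2 _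
    exact hd.mono h1 h2
  have hdich : ∀ᶠ n in atTop, ∀ i ∈ Finset.range N, ∀ b ∈ Finset.Ioc i (i + B),
      S n i ⊆ pull f m (S n) i b ∨ pull f m (S n) i b ∩ frontier (S n i) = ∅ :=
    (Filter.eventually_all_finset _).2 fun i hi => (Filter.eventually_all_finset _).2 fun b hb =>
      hR3 i (Finset.mem_range.1 hi) b (Finset.mem_Ioc.1 hb).1
  have hchain : ∀ᶠ n in atTop, ∀ i ∈ Finset.range N, ∀ c ∈ Finset.Icc i (i + B),
      ∀ b ∈ Finset.Ioc c (i + B), pull f m (S n) c b ∩ frontier (S n c) = ∅ →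
      ∀ x ∈ S n i, f^[m b - m i] x ∈ S n b → f^[m c - m i] x ∈ S n c :=
    (Filter.eventually_all_finset _).2 fun i hi => (Filter.eventually_all_finset _).2 fun c hc =>
      (Filter.eventually_all_finset _).2 fun b hb =>
        hG.eventually_chain hm hS i c b (Finset.mem_Icc.1 hc).1 (Finset.mem_Ioc.1 hb).1
  filter_upwards [hdisj, hdich, hchain, hG.eventually_visit hm hm0 hmN hS p] with n h1 h2 h3 h4
  exact ⟨fun i hi j hj => h1 i (Finset.mem_range.2 hi) j (Finset.mem_range.2 hj), h4,
    fun i hi b hib hb => h2 i (Finset.mem_range.2 hi) b (Finset.mem_Ioc.2 ⟨hib, hb⟩),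
    fun i hi c b hic hcb hb => h3 i (Finset.mem_range.2 hi) c
      (Finset.mem_Icc.2 ⟨hic, hcb.le.trans hb⟩) b (Finset.mem_Ioc.2 ⟨hcb, hb⟩)⟩

/-- The return times of the set `A_q^(0)` to itself tend to infinity. -/
theorem OrbitGeometry.eventually_no_return [T2Space X] (hG : OrbitGeometry f p ζ)
    (hm : StrictMono m) (hm0 : m 0 = 0) (hN : 0 < N) (hmN : ∀ a, m (a + N) = m a + p)
    (hS : Shrinking S (fun i => f^[m i] ζ) N) (hR3 : CondR3 f m N S) (T : ℕ) :
    ∀ᶠ n in atTop, ∀ x ∈ setA f p (⋃ i ∈ Finset.range N, S n i) 0, ∀ r, 1 ≤ r → r ≤ T →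
      f^[r] x ∉ ⋃ i ∈ Finset.range N, S n i := by
  have hexp : ∀ᶠ n in atTop, ∀ i ∈ Finset.range N, ¬ MapsTo f^[p] (S n i) (S n i) := by
    refine (Filter.eventually_all_finset _).2 fun i _ => ?_
    obtain ⟨O, hO, hV⟩ := hG.expand (m i)
    filter_upwards [hS.small i O hO, hS.mem i] with n h1 h2
    exact hV _ h1 (hS.isOpen n i) ⟨_, h2⟩
  filter_upwards [hexp, hG.eventually_localPicture hm hm0 hmN hS hR3 (p + T + N),
    hG.eventually_visit hm hm0 hmN hS T] with n h1 hL h2 x hx r hr1 hrT hfr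
  rw [mem_setA_zero] at hx
  obtain ⟨hxU, hesc⟩ := hx
  have hxU' := hxU
  simp only [mem_iUnion, exists_prop, Finset.mem_range] at hxU'
  obtain ⟨i, hi, hxi⟩ := hxU'
  -- Expansion of volume excludes the alternative of (R3) in which f^p maps S_c into itself.
  have hback : ∀ c, pull f m (S n) c (c + N) ∩ frontier (S n c) = ∅ := by
    intro c
    refine (hL.dichotomy_all hN hmN (hS.shift n) (i := c) (b := c + N) (by omega)
      (by omega)).resolve_left fun hsub => ?_
    have hc : c = c % N + N * (c / N) := (Nat.mod_add_div c N).symm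
    refine h1 (c % N) (Finset.mem_range.2 (Nat.mod_lt _ hN)) ?_
    intro y hy
    rw [hc, shift_set (hS.shift n)] at hsub
    have := hsub hy
    rw [← hc, pull, mem_preimage, hmN, Nat.add_sub_cancel_left, hS.shift] at this
    rwa [hc, shift_set (hS.shift n)] at this
  obtain ⟨a, hia, hma, hfa⟩ := h2 i hi x hxi r hr1 hrT hfr
  -- Strict monotonicity gives a ≤ m a, and m a = m i + r is less than p + T.
  have haB : a ≤ i + (p + T + N) := by
    have := hm.le_apply (x := a)
    have := time_lt_period hm hm0 hmN hi
    omega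
  -- Descent by one period: a visit to S_{c+N} forces a visit to S_c. Repeating it brings the visit
  -- within the first p steps, which escape forbids.
  have hclaim : ∀ b, i < b → b ≤ i + (p + T + N) → f^[m b - m i] x ∈ S n b → False := by
    intro b
    induction b using Nat.strong_induction_on with
    | _ b ih =>
      intro hib hb hxb
      by_cases hbN : b ≤ i + N
      · have hmb := hm hib
        have hmb' := hm.monotone hbN
        rw [hmN] at hmb'
        refine hesc (m b - m i) (by omega) (by omega) ?_
        have hbm : b = b % N + N * (b / N) := (Nat.mod_add_div b N).symm
        simp only [mem_iUnion, exists_prop, Finset.mem_range]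
        refine ⟨b % N, Nat.mod_lt _ hN, ?_⟩
        rw [← shift_set (hS.shift n) (b % N) (b / N), ← hbm]
        exact hxb
      · obtain ⟨c, rfl⟩ : ∃ c, b = c + N := ⟨b - N, by omega⟩
        exact ih c (by omega) (by omega) (by omega)
          (hL.chain i hi c (c + N) (by omega) (by omega) hb (hback c) x hxi hxb)
  refine hclaim a hia haB ?_
  rw [hma, Nat.add_sub_cancel_left]
  exact hfa

end Shrinking

/-- The determinant of Df^p(ζ) is the product of the determinants along one period, so none of them
vanishes; at another orbit point the same factors appear cyclically permuted, so expansion holds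
there too. -/
theorem IsRepellingPeriodic.orbitGeometry {E : Type*} [NormedAddCommGroup E] [NormedSpace ℝ E]
    [FiniteDimensional ℝ E] [Nontrivial E] {X : Type*} [TopologicalSpace X] [ChartedSpace E X]
    {f : X → X} {p : ℕ} {ζ : X}
    (h : IsRepellingPeriodic E f p ζ) : OrbitGeometry f p ζ := by
  obtain ⟨hp, hper, hsmooth, hroots⟩ := h
  have hpζ : f^[p] ζ = ζ := by rw [← hper]; exact Function.iterate_minimalPeriod
  have hdetζ : 1 < |mdet E f^[p] ζ| := one_lt_abs_det_of_roots _ hroots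
  have hprod : ∏ s ∈ Finset.range p, mdet E f (f^[s] ζ) = mdet E f^[p] ζ := by
    have := mdet_iterate hsmooth 0 p
    simpa using this.symm
  have hperiod : ∀ s, f^[s + p] ζ = f^[s] ζ := fun s => by
    rw [Function.iterate_add_apply, hpζ]
  have hmod : ∀ s, f^[s % p] ζ = f^[s] ζ := fun s => by
    rw [← hper]; exact Function.iterate_mod_minimalPeriod_eq
  have hne : ∀ s, mdet E f (f^[s] ζ) ≠ 0 := by
    intro s hs
    have h0 : mdet E f^[p] ζ = 0 := by
      rw [← hprod]
      exact Finset.prod_eq_zero (Finset.mem_range.2 (Nat.mod_lt s hp)) (by rw [hmod, hs])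
    rw [h0] at hdetζ
    simp at hdetζ
    linarith
  have hrot : ∀ t, ∏ s ∈ Finset.range p, mdet E f (f^[t + s] ζ) = mdet E f^[p] ζ := by
    intro t
    induction t with
    | zero => simpa using hprod
    | succ t ih =>
      rw [← ih]
      obtain ⟨p', rfl⟩ : ∃ p', p = p' + 1 := ⟨p - 1, by omega⟩
      rw [Finset.prod_range_succ, Finset.prod_range_succ' _ p', add_zero]
      congr 1
      · refine Finset.prod_congr rfl fun s _ => ?_
        rw [add_assoc, add_comm 1 s]
      · rw [add_assoc, add_comm 1 p', hperiod]
  refine ⟨hp, hper, fun t r => ?_, fun t => ?_⟩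
  · refine exists_openPartialHomeomorph_of_mdet_ne_zero (E := E) (contMDiffAt_iterate hsmooth t r) ?_
    rw [mdet_iterate hsmooth]
    exact Finset.prod_ne_zero_iff.2 fun s _ => hne _
  · refine eventually_not_mapsTo_of_one_lt_mdet (E := E) ?_ (contMDiffAt_iterate hsmooth t p) ?_
    · rw [← Function.iterate_add_apply, add_comm, hperiod]
    · rw [mdet_iterate hsmooth, hrot]; exact hdetζ

/-- In a space without isolated points, the balls forming the exceedance sets shrink to the maxima
when the levels tend to the maximum. -/
theorem shrinking_localBall {X : Type*} [MetricSpace X] {φ : X → EReal} {ζ : X} {N : ℕ}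
    (hN : 0 < N) {ξ : ℕ → X} (hξ : ∀ a, ξ (a + N) = ξ a)
    (hmax : ∀ x, φ x ≤ φ ζ) (hargmax : ∀ x, φ x = φ ζ ↔ ∃ i < N, x = ξ i)
    {ε : ℝ → ℕ → ℝ} {u : ℕ → ℝ} (hu : Tendsto (fun n => (u n : EReal)) atTop (𝓝 (φ ζ)))
    (hpos : ∀ᶠ n in atTop, ∀ i < N, 0 < ε (u n) i)
    (hballs : ∀ᶠ n in atTop,
      exceed φ (u n) = ⋃ i ∈ Finset.range N, Metric.ball (ξ i) (ε (u n) i))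
    (hconn : ∀ x r, IsPreconnected (Metric.ball (x : X) r))
    (hiso : ∀ x : X, ¬ IsOpen ({x} : Set X)) :
    Shrinking (fun n a => localBall N ξ ε (u n) a) ξ N := by
  have hξm : ∀ a, ξ (a % N) = ξ a := by
    intro a
    have : a = a % N + N * (a / N) := (Nat.mod_add_div a N).symm
    have h2 : ∀ c b, ξ (b + N * c) = ξ b := by
      intro c b
      induction c with
      | zero => simp
      | succ c ih => rw [Nat.mul_succ, ← add_assoc, hξ, ih]
    conv_rhs => rw [this, h2]
  refine ⟨fun n a => by simp [localBall], fun n a => Metric.isOpen_ball,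
    fun n a => hconn _ _, fun a => ?_, fun a O hO => ?_⟩
  · filter_upwards [hpos] with n hn
    rw [localBall, hξm a]
    exact Metric.mem_ball_self (hn _ (Nat.mod_lt _ hN))
  · obtain ⟨δ, hδ, hδO⟩ := Metric.mem_nhds_iff.1 hO
    by_contra hfreq
    rw [Filter.not_eventually] at hfreq
    -- If the radii stayed at least δ along infinitely many levels, φ would be maximal on this whole
    -- ball. Being a subset of the finite set of maxima, the open ball would make ξ_a isolated.
    have hsub : Metric.ball (ξ a) δ ⊆ {x | φ x = φ ζ} := by
      intro x hx
      refine le_antisymm (hmax x) ?_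
      refine le_of_tendsto_of_frequently hu ?_
      refine (hfreq.and_eventually hballs).mono fun n hn => ?_
      have hlt : δ ≤ ε (u n) (a % N) := by
        by_contra! hlt
        refine hn.1 ((Metric.ball_subset_ball hlt.le).trans ?_)
        rw [hξm a]; exact hδO
      have : x ∈ exceed φ (u n) := by
        rw [hn.2]
        simp only [mem_iUnion, exists_prop, Finset.mem_range]
        exact ⟨a % N, Nat.mod_lt _ hN, Metric.ball_subset_ball hlt (by rwa [hξm a])⟩
      exact le_of_lt this
    have hfin : (Metric.ball (ξ a) δ).Finite := by
      refine ((Set.finite_lt_nat N).image ξ).subset fun x hx => ?_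
      obtain ⟨i, hi, rfl⟩ := (hargmax x).1 (hsub hx)
      exact ⟨i, hi, rfl⟩
    refine hiso (ξ a) ?_
    have h1 : IsOpen (Metric.ball (ξ a) δ \ (Metric.ball (ξ a) δ \ {ξ a})) :=
      Metric.isOpen_ball.sdiff (hfin.subset sdiff_subset).isClosed
    rwa [sdiff_sdiff_right_self,
      inter_eq_right.2 (singleton_subset_iff.2 (Metric.mem_ball_self hδ))] at h1

/-! ### Counting visits along an orbit -/

section Visits

open Classical in
/-- The number of visits to `V` at the times `0, …, L - 1`. -/
def visits {X : Type*} (f : X → X) (V : Set X) (L : ℕ) (x : X) : ℕ :=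
  ((Finset.range L).filter fun j => f^[j] x ∈ V).card

variable {X : Type*} {f : X → X} {q : ℕ} {U V : Set X}

@[simp] theorem visits_zero (x : X) : visits f V 0 x = 0 := by simp [visits]

theorem visits_eq_sum (L : ℕ) (x : X) :
    (visits f V L x : ℝ) = ∑ j ∈ Finset.range L, V.indicator (fun _ => (1 : ℝ)) (f^[j] x) := by
  classical
  rw [visits, Finset.card_filter]
  push_cast
  exact Finset.sum_congr rfl fun j _ => by simp [Set.indicator_apply]

theorem visits_add (L M : ℕ) (x : X) :
    visits f V (L + M) x = visits f V L x + visits f V M (f^[L] x) := by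
  have : (visits f V (L + M) x : ℝ) = visits f V L x + visits f V M (f^[L] x) := by
    simp only [visits_eq_sum, Finset.sum_range_add, ← Function.iterate_add_apply]
    simp only [add_comm]
  exact_mod_cast this

theorem visits_one (x : X) [Decidable (x ∈ V)] : visits f V 1 x = if x ∈ V then 1 else 0 := by
  have h : (visits f V 1 x : ℝ) = ((if x ∈ V then 1 else 0 : ℕ) : ℝ) := by
    rw [visits_eq_sum]
    by_cases hx : x ∈ V <;> simp [hx]
  exact_mod_cast h

theorem visits_succ_of_mem {L : ℕ} {x : X} (h : x ∈ V) :
    visits f V (L + 1) x = visits f V L (f x) + 1 := by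
  classical
  rw [add_comm L 1, visits_add, visits_one, if_pos h, add_comm]; rfl

theorem visits_succ_of_notMem {L : ℕ} {x : X} (h : x ∉ V) :
    visits f V (L + 1) x = visits f V L (f x) := by
  classical
  rw [add_comm L 1, visits_add, visits_one, if_neg h, zero_add]; rfl

theorem visits_mono {L M : ℕ} (h : L ≤ M) (x : X) : visits f V L x ≤ visits f V M x := by
  obtain ⟨d, rfl⟩ := Nat.exists_eq_add_of_le h
  rw [visits_add]; omega

theorem visits_lt_of_mem {i j : ℕ} {x : X} (hij : i < j) (h : f^[i] x ∈ V) :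
    visits f V i x < visits f V j x := by
  refine lt_of_lt_of_le ?_ (visits_mono (Nat.succ_le_of_lt hij) x)
  classical
  rw [Nat.succ_eq_add_one, visits_add, visits_one, if_pos h]; omega

theorem visits_eq_zero {L : ℕ} {x : X} (h : ∀ j < L, f^[j] x ∉ V) : visits f V L x = 0 := by
  simpa [visits] using h

theorem visits_le (L : ℕ) (x : X) : visits f V L x ≤ L := by
  classical
  exact (Finset.card_filter_le _ _).trans (Finset.card_range L).le

/-- If every two visits to `V` are separated by a visit to `W`, then `V` is visited at most once
more than `W`. -/
theorem visits_le_visits_add_one {W : Set X}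
    (h : ∀ y ∈ V, ∀ j, 1 ≤ j → f^[j] y ∈ V → ∃ l < j, f^[l] y ∈ W) (L : ℕ) (x : X) :
    visits f V L x ≤ visits f W L x + 1 := by
  classical
  have hlt : ∀ i j, i < j → f^[i] x ∈ V → f^[j] x ∈ V → visits f W i x < visits f W j x := by
    intro i j hij hi hj
    obtain ⟨l, hl, hlW⟩ := h (f^[i] x) hi (j - i) (by omega) (by
      rw [← Function.iterate_add_apply, Nat.sub_add_cancel hij.le]; exact hj)
    rw [← Function.iterate_add_apply] at hlW
    exact (visits_mono (by omega) x).trans_lt (visits_lt_of_mem (i := l + i) (by omega) hlW)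
  rw [← Finset.card_range (visits f W L x + 1)]
  -- The number of visits to W made so far is injective on the visit times of V and takes at most
  -- one more value than the total number of visits to W.
  refine Finset.card_le_card_of_injOn (fun j => visits f W j x) ?_ ?_
  · intro j hj
    simp only [Finset.coe_filter, Finset.mem_range, mem_ofPred_eq] at hj
    simp only [Finset.coe_range, mem_Iio]
    have := visits_mono (f := f) (V := W) hj.1.le x
    omega
  · intro i hi j hj hij
    simp only [Finset.coe_filter, Finset.mem_range, mem_ofPred_eq] at hi hj
    rcases lt_trichotomy i j with hlt' | rfl | hlt'
    · exact absurd hij (hlt i j hlt' hi.2 hj.2).ne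
    · rfl
    · exact absurd hij (hlt j i hlt' hj.2 hi.2).ne'

/-- The visit to U^(k) promised by membership in U^(k+1) comes at or after the first visit to U. If
later, it is still within q steps of that first visit, which thus lies in U^(k+1) ⊆ U^(k). -/
theorem first_visit_mem {k l : ℕ} {x : X} (hx : x ∈ nestedU f q U (k + 1))
    (hl : 1 ≤ l) (hlU : f^[l] x ∈ U) (hfirst : ∀ l', 1 ≤ l' → l' < l → f^[l'] x ∉ U) :
    l ≤ q ∧ f^[l] x ∈ nestedU f q U k := by
  obtain ⟨-, t, ht1, htq, ht⟩ := mem_nestedU_succ.1 hx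
  have hlt : l ≤ t := by
    by_contra! hlt
    exact hfirst t ht1 hlt (nestedU_subset _ ht)
  refine ⟨hlt.trans htq, ?_⟩
  rcases hlt.eq_or_lt with rfl | hlt'
  · exact ht
  · refine nestedU_succ_subset k (mem_nestedU_succ.2 ⟨hlU, t - l, by omega, by omega, ?_⟩)
    rwa [← Function.iterate_add_apply, Nat.sub_add_cancel hlt]

theorem exists_first_visit {t : ℕ} {x : X} (ht1 : 1 ≤ t) (ht : f^[t] x ∈ U) :
    ∃ l, 1 ≤ l ∧ l ≤ t ∧ f^[l] x ∈ U ∧ ∀ l', 1 ≤ l' → l' < l → f^[l'] x ∉ U := by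
  classical
  have hex : ∃ l, 1 ≤ l ∧ f^[l] x ∈ U := ⟨t, ht1, ht⟩
  refine ⟨Nat.find hex, (Nat.find_spec hex).1, Nat.find_min' hex ⟨ht1, ht⟩,
    (Nat.find_spec hex).2, fun l' h1 h2 h3 => Nat.find_min hex h2 ⟨h1, h3⟩⟩

/-- The first visit after a point of A^(k+1) lies in U^(k) but not in U^(k+1), since otherwise the
point would belong to U^(k+2). It is therefore in A^(k), and it differs from the later visit to
U^(k+1). -/
theorem exists_next_of_mem_setA_succ {k j : ℕ} {x : X} (hx : x ∈ setA f q U (k + 1))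
    (hj : 1 ≤ j) (hjU : f^[j] x ∈ nestedU f q U (k + 1)) :
    ∃ l, 1 ≤ l ∧ l < j ∧ f^[l] x ∈ setA f q U k := by
  rw [setA_eq] at hx
  obtain ⟨l, hl1, hlj, hlU, hfirst⟩ := exists_first_visit hj (nestedU_subset _ hjU)
  obtain ⟨hlq, hlk⟩ := first_visit_mem hx.1 hl1 hlU hfirst
  have hlk' : f^[l] x ∉ nestedU f q U (k + 1) := fun h =>
    hx.2 (mem_nestedU_succ.2 ⟨nestedU_subset _ hx.1, l, hl1, hlq, h⟩)
  refine ⟨l, hl1, lt_of_le_of_ne hlj ?_, ?_⟩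
  · rintro rfl; exact hlk' hjU
  · rw [setA_eq]; exact ⟨hlk, hlk'⟩

theorem exists_setA_zero_between {k j : ℕ} {x : X} (hx : x ∈ setA f q U k)
    (hj : 1 ≤ j) (hjU : f^[j] x ∈ nestedU f q U k) : ∃ l < j, f^[l] x ∈ setA f q U 0 := by
  induction k generalizing x j with
  | zero => exact ⟨0, hj, hx⟩
  | succ k ih =>
    obtain ⟨l, hl1, hlj, hl⟩ := exists_next_of_mem_setA_succ hx hj hjU
    obtain ⟨l', hl', h⟩ := ih (j := j - l) hl (by omega) (by
      rw [← Function.iterate_add_apply, Nat.sub_add_cancel hlj.le]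
      exact nestedU_succ_subset k hjU)
    exact ⟨l' + l, by omega, by rwa [Function.iterate_add_apply]⟩

/-- The bound is independent of k, which later allows averaging over all k with geometric weights.
-/
theorem visits_setA_le_zero (k L : ℕ) (x : X) :
    visits f (setA f q U k) L x ≤ visits f (setA f q U 0) L x + 1 :=
  visits_le_visits_add_one (fun y hy j hj hjy => exists_setA_zero_between hy hj (by
    rw [setA_eq] at hjy; exact hjy.1)) L x

theorem visits_setA_succ_le (k L : ℕ) (x : X) :
    visits f (setA f q U (k + 1)) L x ≤ visits f (setA f q U k) L x + 1 :=
  visits_le_visits_add_one (fun y hy j hj hjy => by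
    rw [setA_eq] at hjy
    obtain ⟨l, -, hlj, hl⟩ := exists_next_of_mem_setA_succ hy hj hjy.1
    exact ⟨l, hlj, hl⟩) L x

/-- If the last `q` times are not visited, then some visit to `A_q^(0)` follows each visit. -/
theorem exists_setA_zero_of_visits {L : ℕ} {x : X}
    (htail : ∀ j < L, L ≤ j + q → f^[j] x ∉ U) (hpos : 0 < visits f U L x) :
    ∃ j < L, f^[j] x ∈ setA f q U 0 := by
  classical
  have hne : ((Finset.range L).filter fun j => f^[j] x ∈ U).Nonempty := by
    rw [← Finset.card_pos]; exact hpos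
  obtain ⟨j, hj, hjmax⟩ := Finset.exists_maximal hne
  rw [Finset.mem_filter, Finset.mem_range] at hj
  have hjq : j + q < L := by
    by_contra! h
    exact htail j hj.1 h hj.2
  refine ⟨j, hj.1, mem_setA_zero.2 ⟨hj.2, fun t ht1 htq ht => ?_⟩⟩
  rw [← Function.iterate_add_apply] at ht
  have := hjmax (y := t + j) (Finset.mem_filter.2 ⟨Finset.mem_range.2 (by omega), ht⟩)
    (by omega)
  omega

/-- In a time window with a single cluster, which ends before the last `q` times, a visit followed
by exactly `κ` further visits is a visit to `A_q^(κ)`. -/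
theorem mem_setA_visits {L : ℕ} {x : X} (htail : ∀ j < L + 1, L + 1 ≤ j + q → f^[j] x ∉ U)
    (hone : visits f (setA f q U 0) (L + 1) x ≤ 1) (hx : x ∈ U) :
    x ∈ setA f q U (visits f U L (f x)) := by
  induction L using Nat.strong_induction_on generalizing x with
  | _ L ih =>
    have hqL : q < L + 1 := by
      by_contra! h
      exact htail 0 (Nat.succ_pos L) (by omega) hx
    by_cases h0 : x ∈ setA f q U 0
    · have hz : visits f U L (f x) = 0 := by
        by_contra hne
        obtain ⟨j, hj, hjA⟩ := exists_setA_zero_of_visits (q := q) (L := L) (x := f x)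
          (fun j hj hjq => htail (j + 1) (by omega) (by omega)) (Nat.pos_of_ne_zero hne)
        rw [visits_succ_of_mem h0] at hone
        have := visits_lt_of_mem (f := f) (V := setA f q U 0) hj hjA
        omega
      rw [hz]; exact h0
    · have hex : ∃ t, 1 ≤ t ∧ t ≤ q ∧ f^[t] x ∈ U := by
        by_contra! h
        exact h0 (mem_setA_zero.2 ⟨hx, h⟩)
      obtain ⟨t, ht1, htq, ht⟩ := hex
      obtain ⟨l, hl1, hlt, hlU, hfirst⟩ := exists_first_visit ht1 ht
      have hlq : l ≤ q := hlt.trans htq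
      obtain ⟨L', hL'⟩ : ∃ L', L = l + L' := ⟨L - l, by omega⟩
      have hzero : visits f U (l - 1) (f x) = 0 := by
        refine visits_eq_zero fun j hj => ?_
        rw [← Function.iterate_succ_apply]
        exact hfirst (j + 1) (by omega) (by omega)
      have hit : f^[l - 1] (f x) = f^[l] x := by
        rw [← Function.iterate_succ_apply, Nat.succ_eq_add_one, Nat.sub_add_cancel hl1]
      have hcount : visits f U L (f x) = visits f U L' (f (f^[l] x)) + 1 := by
        have : L = (l - 1) + (L' + 1) := by omega
        rw [this, visits_add, hzero, zero_add, hit, visits_succ_of_mem hlU]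
      have key := ih L' (by omega) (x := f^[l] x) (fun j hj hjq => by
          rw [← Function.iterate_add_apply]; exact htail (j + l) (by omega) (by omega))
        (by
          have h2 : L + 1 = l + (L' + 1) := by omega
          rw [h2, visits_add] at hone
          omega) hlU
      rw [hcount]
      -- The order of escape drops by one at the next visit: if that visit is in A^(κ), the present
      -- one is in A^(κ+1).
      rw [setA_eq] at key ⊢
      refine ⟨mem_nestedU_succ.2 ⟨hx, l, hl1, hlq, key.1⟩, fun h => key.2 ?_⟩
      exact (first_visit_mem h hl1 hlU hfirst).2

/-- The weight `(1 - z) z^κ` on `A_q^(κ)`. -/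
def weight (f : X → X) (q : ℕ) (U : Set X) (z : ℝ) (x : X) : ℝ :=
  ∑' κ : ℕ, (1 - z) * z ^ κ * (setA f q U κ).indicator (fun _ => (1 : ℝ)) x

theorem weight_of_mem {z : ℝ} {κ : ℕ} {x : X} (hx : x ∈ setA f q U κ) :
    weight f q U z x = (1 - z) * z ^ κ := by
  rw [weight, tsum_eq_single κ]
  · simp [hx]
  · intro l hl
    rw [indicator_of_notMem, mul_zero]
    exact fun h => Set.disjoint_left.1 (setA_disjoint hl) h hx

theorem weight_of_notMem {z : ℝ} {x : X} (hx : x ∉ U) : weight f q U z x = 0 := by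
  rw [weight]
  convert tsum_zero with κ
  rw [indicator_of_notMem (fun h => hx (setA_subset κ h)), mul_zero]

theorem weight_nonneg {z : ℝ} (h0 : 0 ≤ z) (h1 : z < 1) (x : X) : 0 ≤ weight f q U z x :=
  tsum_nonneg fun κ => mul_nonneg (mul_nonneg (by linarith) (pow_nonneg h0 κ))
    (indicator_nonneg (fun _ _ => zero_le_one) _)

theorem weight_le_indicator {z : ℝ} (h0 : 0 ≤ z) (h1 : z < 1) (x : X) :
    weight f q U z x ≤ U.indicator (fun _ => (1 : ℝ)) x := by
  by_cases hx : ∃ κ, x ∈ setA f q U κ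
  · obtain ⟨κ, hκ⟩ := hx
    rw [weight_of_mem hκ, indicator_of_mem (setA_subset κ hκ)]
    have := pow_le_one₀ (n := κ) h0 h1.le
    have := pow_nonneg h0 κ
    nlinarith
  · push Not at hx
    have : weight f q U z x = 0 := by
      rw [weight]
      convert tsum_zero with κ
      rw [indicator_of_notMem (hx κ), mul_zero]
    rw [this]
    exact indicator_nonneg (fun _ _ => zero_le_one) _

/-- Telescoping along the visits: one followed by κ others lowers z^κ to z^(κ+1), a loss of (1 - z)
z^κ, and this is the weight there because the visit lies in A^(κ). -/
theorem pow_visits_eq {z : ℝ} {L : ℕ} {x : X} (htail : ∀ j < L, L ≤ j + q → f^[j] x ∉ U)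
    (hone : visits f (setA f q U 0) L x ≤ 1) :
    z ^ visits f U L x = 1 - ∑ j ∈ Finset.range L, weight f q U z (f^[j] x) := by
  induction L generalizing x with
  | zero => simp
  | succ L ih =>
    have hmono : visits f (setA f q U 0) L (f x) ≤ visits f (setA f q U 0) (L + 1) x := by
      rw [add_comm L 1, visits_add]; exact Nat.le_add_left _ _
    have hih := ih (x := f x) (fun j hj hjq => htail (j + 1) (by omega) (by omega))
      (hmono.trans hone)
    rw [Finset.sum_range_succ']
    simp only [Function.iterate_succ_apply, Function.iterate_zero, id_eq]
    by_cases hx : x ∈ U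
    · rw [visits_succ_of_mem hx, weight_of_mem (mem_setA_visits htail hone hx), pow_succ]
      linarith
    · rw [visits_succ_of_notMem hx, weight_of_notMem hx, add_zero]
      exact hih

theorem hasSum_geometric_weights {z : ℝ} (h0 : 0 ≤ z) (h1 : z < 1) :
    HasSum (fun κ : ℕ => (1 - z) * z ^ κ) 1 := by
  have := (hasSum_geometric_of_lt_one h0 h1).mul_left (1 - z)
  rwa [mul_inv_cancel₀ (by linarith)] at this

theorem hasSum_weight {z : ℝ} (h0 : 0 ≤ z) (h1 : z < 1) (x : X) :
    HasSum (fun κ : ℕ => (1 - z) * z ^ κ * (setA f q U κ).indicator (fun _ => (1 : ℝ)) x)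
      (weight f q U z x) := by
  refine Summable.hasSum (Summable.of_nonneg_of_le (fun κ => ?_) (fun κ => ?_)
    (hasSum_geometric_weights h0 h1).summable)
  · exact mul_nonneg (mul_nonneg (by linarith) (pow_nonneg h0 κ))
      (indicator_nonneg (fun _ _ => zero_le_one) _)
  · refine mul_le_of_le_one_right (mul_nonneg (by linarith) (pow_nonneg h0 κ)) ?_
    exact indicator_le_self' (fun _ _ => zero_le_one) _ |>.trans le_rfl

/-- The geometric weights have total mass one and each A^(κ) is visited at most once more than
A^(0). -/
theorem sum_weight_le {z : ℝ} (h0 : 0 ≤ z) (h1 : z < 1) (L : ℕ) (x : X) :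
    ∑ j ∈ Finset.range L, weight f q U z (f^[j] x) ≤ visits f (setA f q U 0) L x + 1 := by
  have hs := hasSum_sum (s := Finset.range L)
    (fun j _ => hasSum_weight (f := f) (q := q) (U := U) h0 h1 (f^[j] x))
  have hle : ∀ κ : ℕ, ∑ j ∈ Finset.range L,
      (1 - z) * z ^ κ * (setA f q U κ).indicator (fun _ => (1 : ℝ)) (f^[j] x) ≤
      (1 - z) * z ^ κ * (visits f (setA f q U 0) L x + 1) := by
    intro κ
    rw [← Finset.mul_sum, ← visits_eq_sum]
    refine mul_le_mul_of_nonneg_left ?_ (mul_nonneg (by linarith) (pow_nonneg h0 κ))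
    exact_mod_cast visits_setA_le_zero κ L x
  have := hasSum_le hle hs ((hasSum_geometric_weights h0 h1).mul_right _)
  rwa [one_mul] at this

/-- The number of pairs of visits to `V` at times smaller than `L`. -/
def pairs (f : X → X) (V : Set X) (L : ℕ) (x : X) : ℝ :=
  ∑ j ∈ Finset.range L, ∑ i ∈ Finset.range j,
    V.indicator (fun _ => (1 : ℝ)) (f^[i] x) * V.indicator (fun _ => (1 : ℝ)) (f^[j] x)

theorem visits_sq (L : ℕ) (x : X) :
    (visits f V L x : ℝ) ^ 2 = visits f V L x + 2 * pairs f V L x := by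
  rw [visits_eq_sum, pairs]
  induction L with
  | zero => simp
  | succ L ih =>
    rw [Finset.sum_range_succ, Finset.sum_range_succ, ← Finset.sum_mul, add_sq, ih]
    have : V.indicator (fun _ => (1 : ℝ)) (f^[L] x) ^ 2 = V.indicator (fun _ => (1 : ℝ)) (f^[L] x) := by
      by_cases h : f^[L] x ∈ V <;> simp [h]
    rw [this]; ring

theorem pairs_nonneg (L : ℕ) (x : X) : 0 ≤ pairs f V L x :=
  Finset.sum_nonneg fun _ _ => Finset.sum_nonneg fun _ _ =>
    mul_nonneg (indicator_nonneg (fun _ _ => zero_le_one) _)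
      (indicator_nonneg (fun _ _ => zero_le_one) _)

/-- The exact identity fails only if U is visited in the last q times or A^(0) is visited twice. The
first case is charged to the visits at the end, the second to the pairs. -/
theorem abs_pow_visits_sub_le {z : ℝ} (h0 : 0 ≤ z) (h1 : z < 1) (L : ℕ) (x : X) :
    |z ^ visits f U L x - (1 - ∑ j ∈ Finset.range L, weight f q U z (f^[j] x))| ≤
      2 * visits f U q (f^[L - q] x) + 3 * pairs f (setA f q U 0) L x := by
  have hp := pairs_nonneg (f := f) (V := setA f q U 0) L x
  have hv : (0 : ℝ) ≤ visits f U q (f^[L - q] x) := Nat.cast_nonneg _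
  have hz0 := pow_nonneg h0 (visits f U L x)
  have hz1 := pow_le_one₀ (n := visits f U L x) h0 h1.le
  have hw0 : 0 ≤ ∑ j ∈ Finset.range L, weight f q U z (f^[j] x) :=
    Finset.sum_nonneg fun _ _ => weight_nonneg h0 h1 _
  have hw1 := sum_weight_le (f := f) (q := q) (U := U) h0 h1 L x
  have hV0 : (0 : ℝ) ≤ visits f (setA f q U 0) L x := Nat.cast_nonneg _
  by_cases hone : visits f (setA f q U 0) L x ≤ 1
  · by_cases htail : ∀ j < L, L ≤ j + q → f^[j] x ∉ U
    · rw [pow_visits_eq htail hone, sub_self, abs_zero]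
      positivity
    · push Not at htail
      obtain ⟨j, hj, hjq, hjU⟩ := htail
      have hpos : 0 < visits f U q (f^[L - q] x) := by
        refine (Nat.zero_le _).trans_lt (visits_lt_of_mem (i := j - (L - q)) (j := q) ?_ ?_)
        · omega
        · rw [← Function.iterate_add_apply, Nat.sub_add_cancel (by omega)]; exact hjU
      have h2 : (1 : ℝ) ≤ visits f U q (f^[L - q] x) := by exact_mod_cast hpos
      have h3 : (visits f (setA f q U 0) L x : ℝ) ≤ 1 := by exact_mod_cast hone
      rw [abs_le]
      constructor <;> linarith
  -- With V ≥ 2 visits to A^(0) the error is at most V + 1, while there are V(V - 1)/2 pairs; the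
  -- factor 3 is what V = 2 requires.
  · have h2 : (2 : ℝ) ≤ visits f (setA f q U 0) L x := by
      have : 2 ≤ visits f (setA f q U 0) L x := by omega
      exact_mod_cast this
    have hsq := visits_sq (f := f) (V := setA f q U 0) L x
    rw [abs_le]
    constructor <;> nlinarith

end Visits

/-! ### Decoupling of time blocks -/

section Blocks

variable {X : Type*} [MeasurableSpace X] {μ : Measure X} [IsProbabilityMeasure μ] {f : X → X}
  {q : ℕ} {U V : Set X}

theorem measurable_visits (hf : Measurable f) (hV : MeasurableSet V) (L : ℕ) :
    Measurable (visits f V L) := by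
  classical
  induction L with
  | zero =>
    have : visits f V 0 = fun _ => 0 := funext fun x => visits_zero x
    rw [this]; exact measurable_const
  | succ L ih =>
    have : visits f V (L + 1) = fun x => visits f V L x + if f^[L] x ∈ V then 1 else 0 :=
      funext fun x => by rw [visits_add, visits_one]
    rw [this]
    exact ih.add (Measurable.ite ((hf.iterate L) hV) measurable_const measurable_const)

omit [IsProbabilityMeasure μ] in
theorem integrable_of_mem_Icc [IsFiniteMeasure μ] {g : X → ℝ} (hg : Measurable g)
    (h : ∀ x, 0 ≤ g x ∧ g x ≤ 1) : Integrable g μ :=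
  Integrable.of_bound hg.aestronglyMeasurable 1 (Eventually.of_forall fun x => by
    rw [Real.norm_eq_abs, abs_of_nonneg (h x).1]; exact (h x).2)

omit [IsProbabilityMeasure μ] in
theorem integral_comp_iterate (hf : MeasurePreserving f μ μ) {g : X → ℝ} (hg : Measurable g)
    (j : ℕ) : ∫ x, g (f^[j] x) ∂μ = ∫ x, g x ∂μ := by
  have h := (hf.iterate j)
  rw [← integral_map h.measurable.aemeasurable (by rw [h.map_eq]; exact hg.aestronglyMeasurable),
    h.map_eq]

omit [MeasurableSpace X] in
theorem ind_mem (x : X) : 0 ≤ V.indicator (fun _ => (1 : ℝ)) x ∧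
    V.indicator (fun _ => (1 : ℝ)) x ≤ 1 := by
  by_cases h : x ∈ V <;> simp [h]

omit [IsProbabilityMeasure μ] in
theorem integral_ind (hV : MeasurableSet V) :
    ∫ x, V.indicator (fun _ => (1 : ℝ)) x ∂μ = μ.real V := by
  rw [integral_indicator_const _ hV]; simp

theorem integrable_visits (hf : Measurable f) (hV : MeasurableSet V) (L : ℕ) :
    Integrable (fun x => (visits f V L x : ℝ)) μ := by
  refine Integrable.of_bound (C := L)
    (measurable_from_nat.comp (measurable_visits hf hV L)).aestronglyMeasurable
    (Eventually.of_forall fun x => ?_)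
  simp only [Real.norm_natCast]
  exact_mod_cast visits_le L x

theorem integral_visits (hf : MeasurePreserving f μ μ) (hV : MeasurableSet V) (L : ℕ) :
    ∫ x, (visits f V L x : ℝ) ∂μ = L * μ.real V := by
  have hm : Measurable (V.indicator (fun _ => (1 : ℝ))) := measurable_const.indicator hV
  simp only [visits_eq_sum]
  rw [integral_finsetSum]
  · simp [integral_comp_iterate hf hm, integral_ind hV]
  · exact fun j _ => integrable_of_mem_Icc (hm.comp (hf.measurable.iterate j)) fun x => ind_mem _

/-- Decay of correlations between the indicators of the sets `A_q^(κ)` and functions with values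
in `[0, 1]`. -/
def DecayBound (μ : Measure X) (f : X → X) (q : ℕ) (U : Set X) (ρ : ℕ → ℝ) : Prop :=
  ∀ (κ : ℕ) (ψ : X → ℝ), Measurable ψ → (∀ x, 0 ≤ ψ x ∧ ψ x ≤ 1) → ∀ t : ℕ,
    |(∫ x, (setA f q U κ).indicator (fun _ => (1 : ℝ)) x * ψ (f^[t] x) ∂μ) -
      μ.real (setA f q U κ) * ∫ x, ψ x ∂μ| ≤ ρ t * ∫ x, ψ x ∂μ

theorem integral_mem {ψ : X → ℝ} (hψ : Measurable ψ) (h : ∀ x, 0 ≤ ψ x ∧ ψ x ≤ 1) :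
    0 ≤ ∫ x, ψ x ∂μ ∧ ∫ x, ψ x ∂μ ≤ 1 := by
  refine ⟨integral_nonneg fun x => (h x).1, ?_⟩
  have := integral_mono (integrable_of_mem_Icc hψ h) (integrable_const (μ := μ) (1 : ℝ))
    fun x => (h x).2
  simpa using this

theorem measurable_weight (hf : Measurable f) (hU : MeasurableSet U) {z : ℝ} (h0 : 0 ≤ z)
    (h1 : z < 1) : Measurable (weight f q U z) := by
  refine measurable_of_tendsto_metrizable (f := fun n x => ∑ κ ∈ Finset.range n,
    (1 - z) * z ^ κ * (setA f q U κ).indicator (fun _ => (1 : ℝ)) x) (fun n => ?_)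
    (tendsto_pi_nhds.2 fun x => (hasSum_weight h0 h1 x).tendsto_sum_nat)
  exact Finset.measurable_sum _ fun κ _ =>
    (measurable_const.indicator (measurableSet_setA hf hU κ)).const_mul _

omit [MeasurableSpace X] in
theorem weight_mem {z : ℝ} (h0 : 0 ≤ z) (h1 : z < 1) (x : X) :
    0 ≤ weight f q U z x ∧ weight f q U z x ≤ 1 :=
  ⟨weight_nonneg h0 h1 x, (weight_le_indicator h0 h1 x).trans (ind_mem x).2⟩

theorem hasSum_integral_weight_mul (hf : Measurable f) (hU : MeasurableSet U) {z : ℝ}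
    (h0 : 0 ≤ z) (h1 : z < 1) {ψ : X → ℝ} (hψ : Measurable ψ) (h : ∀ x, 0 ≤ ψ x ∧ ψ x ≤ 1) :
    HasSum (fun κ : ℕ => (1 - z) * z ^ κ *
        ∫ x, (setA f q U κ).indicator (fun _ => (1 : ℝ)) x * ψ x ∂μ)
      (∫ x, weight f q U z x * ψ x ∂μ) := by
  have hmem : ∀ κ x, 0 ≤ (setA f q U κ).indicator (fun _ => (1 : ℝ)) x * ψ x ∧
      (setA f q U κ).indicator (fun _ => (1 : ℝ)) x * ψ x ≤ 1 := fun κ x =>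
    ⟨mul_nonneg (ind_mem x).1 (h x).1, mul_le_one₀ (ind_mem x).2 (h x).1 (h x).2⟩
  have hmeas : ∀ κ, Measurable fun x =>
      (setA f q U κ).indicator (fun _ => (1 : ℝ)) x * ψ x := fun κ =>
    (measurable_const.indicator (measurableSet_setA hf hU κ)).mul hψ
  have hc : ∀ κ : ℕ, 0 ≤ (1 - z) * z ^ κ := fun κ => mul_nonneg (by linarith) (pow_nonneg h0 κ)
  have key := hasSum_integral_of_summable_integral_norm (μ := μ)
    (F := fun (κ : ℕ) x => (1 - z) * z ^ κ *
      ((setA f q U κ).indicator (fun _ => (1 : ℝ)) x * ψ x))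
    (fun κ => (integrable_of_mem_Icc (hmeas κ) (hmem κ)).const_mul _) (by
      refine Summable.of_nonneg_of_le (fun κ => integral_nonneg fun x => norm_nonneg _)
        (fun κ => ?_) (hasSum_geometric_weights h0 h1).summable
      have : (fun x => ‖(1 - z) * z ^ κ *
          ((setA f q U κ).indicator (fun _ => (1 : ℝ)) x * ψ x)‖) = fun x =>
          (1 - z) * z ^ κ * ((setA f q U κ).indicator (fun _ => (1 : ℝ)) x * ψ x) := by
        ext x
        rw [Real.norm_of_nonneg (mul_nonneg (hc κ) (hmem κ x).1)]
      rw [this, integral_const_mul]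
      exact mul_le_of_le_one_right (hc κ) (integral_mem (hmeas κ) (hmem κ)).2)
  have e1 : ∀ x, ∑' κ : ℕ, (1 - z) * z ^ κ *
      ((setA f q U κ).indicator (fun _ => (1 : ℝ)) x * ψ x) = weight f q U z x * ψ x := by
    intro x
    unfold weight
    rw [← tsum_mul_right]
    exact tsum_congr fun κ => by ring
  simpa only [integral_const_mul, e1] using key

theorem hasSum_integral_weight (hf : Measurable f) (hU : MeasurableSet U) {z : ℝ}
    (h0 : 0 ≤ z) (h1 : z < 1) :
    HasSum (fun κ : ℕ => (1 - z) * z ^ κ * μ.real (setA f q U κ))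
      (∫ x, weight f q U z x ∂μ) := by
  have := hasSum_integral_weight_mul (μ := μ) (q := q) hf hU h0 h1 (ψ := fun _ => 1)
    measurable_const (fun _ => ⟨zero_le_one, le_rfl⟩)
  simpa only [mul_one, integral_ind (measurableSet_setA hf hU _)] using this

/-- The bound `ρ t` holds for all A^(κ) at once, and the coefficients (1 - z) z^κ form a
probability, so averaging preserves it. -/
theorem weight_decay (hf : Measurable f) (hU : MeasurableSet U) {ρ : ℕ → ℝ} (hρ : ∀ t, 0 ≤ ρ t)
    (hD : DecayBound μ f q U ρ) {z : ℝ} (h0 : 0 ≤ z) (h1 : z < 1) {ψ : X → ℝ}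
    (hψ : Measurable ψ) (h : ∀ x, 0 ≤ ψ x ∧ ψ x ≤ 1) (t : ℕ) :
    |(∫ x, weight f q U z x * ψ (f^[t] x) ∂μ) - (∫ x, weight f q U z x ∂μ) * ∫ x, ψ x ∂μ|
      ≤ ρ t := by
  have s1 := hasSum_integral_weight_mul (μ := μ) (q := q) hf hU h0 h1
    (ψ := fun x => ψ (f^[t] x)) (hψ.comp (hf.iterate t)) (fun x => h _)
  have s2 := (hasSum_integral_weight (μ := μ) (q := q) hf hU h0 h1).mul_right (∫ x, ψ x ∂μ)
  have s := s1.sub s2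
  have g := (hasSum_geometric_weights h0 h1).mul_right (ρ t)
  rw [one_mul] at g
  have hb : ∀ κ : ℕ, |(1 - z) * z ^ κ *
      (∫ x, (setA f q U κ).indicator (fun _ => (1 : ℝ)) x * ψ (f^[t] x) ∂μ) -
      (1 - z) * z ^ κ * μ.real (setA f q U κ) * ∫ x, ψ x ∂μ| ≤ (1 - z) * z ^ κ * ρ t := by
    intro κ
    have hc : 0 ≤ (1 - z) * z ^ κ := mul_nonneg (by linarith) (pow_nonneg h0 κ)
    rw [mul_assoc ((1 - z) * z ^ κ), ← mul_sub, abs_mul, abs_of_nonneg hc]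
    refine mul_le_mul_of_nonneg_left ((hD κ ψ hψ h t).trans ?_) hc
    exact mul_le_of_le_one_right (hρ t) (integral_mem hψ h).2
  exact abs_le.2 ⟨hasSum_le (fun κ => (abs_le.1 (hb κ)).1) g.neg s,
    hasSum_le (fun κ => (abs_le.1 (hb κ)).2) s g⟩

/-- The lags L + T - j, for j < L, run through T + 1, …, L + T, so only the tail of `ρ` beyond T
enters. -/
theorem sum_reflect_le {ρ : ℕ → ℝ} {T : ℕ} {σ : ℝ}
    (hσ : ∀ n, ∑ d ∈ Finset.Ico (T + 1) n, ρ d ≤ σ) (L : ℕ) :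
    ∑ j ∈ Finset.range L, ρ (L + T - j) ≤ σ := by
  refine le_of_eq_of_le ?_ (hσ (L + T + 1))
  rw [← Finset.sum_range_reflect, Finset.sum_Ico_eq_sum_range]
  have : L + T + 1 - (T + 1) = L := by omega
  rw [this]
  refine Finset.sum_congr rfl fun j hj => ?_
  rw [Finset.mem_range] at hj
  congr 1; omega

theorem integrable_pairs (hf : Measurable f) (hV : MeasurableSet V) (L : ℕ) :
    Integrable (pairs f V L) μ := by
  have hm : Measurable (V.indicator (fun _ => (1 : ℝ))) := measurable_const.indicator hV
  unfold pairs
  refine integrable_finsetSum _ fun j _ => integrable_finsetSum _ fun i _ => ?_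
  exact integrable_of_mem_Icc ((hm.comp (hf.iterate i)).mul (hm.comp (hf.iterate j)))
    fun x => ⟨mul_nonneg (ind_mem _).1 (ind_mem _).1, mul_le_one₀ (ind_mem _).2 (ind_mem _).1 (ind_mem _).2⟩

/-- Pairs at distance at most T contribute nothing, by absence of short returns. For the others
decay of correlations gives μ(A)² plus μ(A) times a tail of `ρ`. -/
theorem integral_pairs_le (hf : MeasurePreserving f μ μ) (hU : MeasurableSet U) {ρ : ℕ → ℝ}
    (hρ : ∀ t, 0 ≤ ρ t) (hD : DecayBound μ f q U ρ) {T : ℕ} {σ : ℝ}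
    (hσ : ∀ n, ∑ d ∈ Finset.Ico (T + 1) n, ρ d ≤ σ)
    (hret : ∀ x ∈ setA f q U 0, ∀ r, 1 ≤ r → r ≤ T → f^[r] x ∉ U) (L : ℕ) :
    ∫ x, pairs f (setA f q U 0) L x ∂μ ≤
      L * (L * μ.real (setA f q U 0) ^ 2 + μ.real (setA f q U 0) * σ) := by
  set A := setA f q U 0 with hA
  have hAm : MeasurableSet A := measurableSet_setA hf.measurable hU 0
  have hm : Measurable (A.indicator (fun _ => (1 : ℝ))) := measurable_const.indicator hAm
  have ha0 : 0 ≤ μ.real A := measureReal_nonneg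
  have hint : ∀ i j, Integrable (fun x => A.indicator (fun _ => (1 : ℝ)) (f^[i] x) *
      A.indicator (fun _ => (1 : ℝ)) (f^[j] x)) μ := fun i j =>
    integrable_of_mem_Icc ((hm.comp (hf.measurable.iterate i)).mul
      (hm.comp (hf.measurable.iterate j))) fun x => ⟨mul_nonneg (ind_mem _).1 (ind_mem _).1,
        mul_le_one₀ (ind_mem _).2 (ind_mem _).1 (ind_mem _).2⟩
  have hpair : ∀ i j, i < j → ∫ x, A.indicator (fun _ => (1 : ℝ)) (f^[i] x) *
      A.indicator (fun _ => (1 : ℝ)) (f^[j] x) ∂μ ≤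
      μ.real A ^ 2 + μ.real A * (if T < j - i then ρ (j - i) else 0) := by
    intro i j hij
    have hshift : ∫ x, A.indicator (fun _ => (1 : ℝ)) (f^[i] x) *
        A.indicator (fun _ => (1 : ℝ)) (f^[j] x) ∂μ = ∫ x, A.indicator (fun _ => (1 : ℝ)) x *
        A.indicator (fun _ => (1 : ℝ)) (f^[j - i] x) ∂μ := by
      rw [← integral_comp_iterate hf (g := fun x => A.indicator (fun _ => (1 : ℝ)) x *
        A.indicator (fun _ => (1 : ℝ)) (f^[j - i] x))
        (hm.mul (hm.comp (hf.measurable.iterate _))) i]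
      simp only [← Function.iterate_add_apply, Nat.sub_add_cancel hij.le]
    rw [hshift]
    split_ifs with hT
    · have := (abs_le.1 (hD 0 _ hm (fun x => ind_mem x) (j - i))).2
      rw [integral_ind hAm] at this
      nlinarith
    · have hz : ∀ x, A.indicator (fun _ => (1 : ℝ)) x *
          A.indicator (fun _ => (1 : ℝ)) (f^[j - i] x) = 0 := by
        intro x
        by_cases hx : x ∈ A
        · have : f^[j - i] x ∉ A := fun h =>
            hret x hx (j - i) (by omega) (by omega) (setA_subset 0 h)
          simp [this]
        · simp [hx]
      simp only [hz, integral_zero]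
      positivity
  have hrow : ∀ j ∈ Finset.range L, ∫ x, ∑ i ∈ Finset.range j, A.indicator (fun _ => (1 : ℝ)) (f^[i] x) *
      A.indicator (fun _ => (1 : ℝ)) (f^[j] x) ∂μ ≤ L * μ.real A ^ 2 + μ.real A * σ := by
    intro j hj
    rw [integral_finsetSum _ fun i _ => hint i j]
    calc _ ≤ ∑ i ∈ Finset.range j,
          (μ.real A ^ 2 + μ.real A * (if T < j - i then ρ (j - i) else 0)) :=
          Finset.sum_le_sum fun i hi => hpair i j (Finset.mem_range.1 hi)
      _ = j * μ.real A ^ 2 +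
          μ.real A * ∑ i ∈ Finset.range j, (if T < j - i then ρ (j - i) else 0) := by
          rw [Finset.sum_add_distrib, Finset.mul_sum]; simp
      _ ≤ L * μ.real A ^ 2 + μ.real A * σ := by
          have h1 : (j : ℝ) ≤ L := by exact_mod_cast (Finset.mem_range.1 hj).le
          have h2 : ∑ i ∈ Finset.range j, (if T < j - i then ρ (j - i) else 0) ≤ σ := by
            have h3 : ∀ d, 0 ≤ (if T < d then ρ d else 0) := fun d => by
              split_ifs; exacts [hρ d, le_rfl]
            by_cases hjT : j ≤ T
            · rw [Finset.sum_eq_zero]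
              · simpa using hσ 0
              · intro i hi; rw [if_neg (by omega)]
            · obtain ⟨L', hL'⟩ : ∃ L', j = L' + T := ⟨j - T, by omega⟩
              refine le_trans (le_of_eq ?_) (sum_reflect_le hσ L')
              rw [hL', Finset.sum_range_add]
              rw [Finset.sum_congr rfl (g := fun i => ρ (L' + T - i)), Finset.sum_eq_zero (s := Finset.range T),
                add_zero]
              · intro i hi; rw [if_neg (by omega)]
              · intro i hi; rw [Finset.mem_range] at hi; rw [if_pos (by omega)]
          gcongr
  unfold pairs
  rw [integral_finsetSum _ fun j _ => integrable_finsetSum _ fun i _ => hint i j]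
  refine (Finset.sum_le_sum hrow).trans (le_of_eq ?_)
  simp [mul_add]

/-- `H`, a function of the first `L` steps of the orbit, acts on the future by multiplication
with `lam`, up to the error `e`. -/
def BlockDev (μ : Measure X) (f : X → X) (H : X → ℝ) (L : ℕ) (lam e : ℝ) : Prop :=
  ∀ G : X → ℝ, Measurable G → (∀ x, 0 ≤ G x ∧ G x ≤ 1) →
    |(∫ x, H x * G (f^[L] x) ∂μ) - lam * ∫ x, G x ∂μ| ≤ e

omit [IsProbabilityMeasure μ] in
theorem BlockDev.mono {H : X → ℝ} {L : ℕ} {lam e e' : ℝ} (h : BlockDev μ f H L lam e)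
    (he : e ≤ e') : BlockDev μ f H L lam e' :=
  fun G hG hG1 => (h G hG hG1).trans he

theorem BlockDev.change {H : X → ℝ} {L : ℕ} {lam lam' e : ℝ} (h : BlockDev μ f H L lam e) :
    BlockDev μ f H L lam' (e + |lam - lam'|) := by
  intro G hG hG1
  have h1 := h G hG hG1
  have h2 := integral_mem (μ := μ) hG hG1
  have h3 : |lam * (∫ x, G x ∂μ) - lam' * ∫ x, G x ∂μ| ≤ |lam - lam'| := by
    rw [← sub_mul, abs_mul, abs_of_nonneg h2.1]
    exact mul_le_of_le_one_right (abs_nonneg _) h2.2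
  exact (abs_sub_le _ _ _).trans (add_le_add h1 h3)

omit [IsProbabilityMeasure μ] in
-- The second factor times the future is again a test function with values in [0, 1], so the first
-- estimate applies to it; since |l₁| ≤ 1 the second error is not amplified.
theorem BlockDev.comp (hf : Measurable f) {H₁ H₂ : X → ℝ} {L₁ L₂ : ℕ} {l₁ l₂ e₁ e₂ : ℝ}
    (h₁ : BlockDev μ f H₁ L₁ l₁ e₁) (h₂ : BlockDev μ f H₂ L₂ l₂ e₂) (hl : |l₁| ≤ 1)
    (hH : Measurable H₂) (hH2 : ∀ x, 0 ≤ H₂ x ∧ H₂ x ≤ 1) :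
    BlockDev μ f (fun x => H₁ x * H₂ (f^[L₁] x)) (L₁ + L₂) (l₁ * l₂) (e₁ + e₂) := by
  intro G hG hG1
  have k1 := h₁ (fun x => H₂ x * G (f^[L₂] x)) (hH.mul (hG.comp (hf.iterate _)))
    fun x => ⟨mul_nonneg (hH2 _).1 (hG1 _).1, mul_le_one₀ (hH2 _).2 (hG1 _).1 (hG1 _).2⟩
  have k2 := h₂ G hG hG1
  have k3 : |l₁ * (∫ x, H₂ x * G (f^[L₂] x) ∂μ) - l₁ * l₂ * ∫ x, G x ∂μ| ≤ e₂ := by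
    rw [mul_assoc, ← mul_sub, abs_mul]
    exact (mul_le_of_le_one_left (abs_nonneg _) hl).trans k2
  have : (∫ x, H₁ x * H₂ (f^[L₁] x) * G (f^[L₁ + L₂] x) ∂μ) =
      ∫ x, H₁ x * (H₂ (f^[L₁] x) * G (f^[L₂] (f^[L₁] x))) ∂μ := by
    congr 1; ext x
    rw [← Function.iterate_add_apply, add_comm L₂, mul_assoc]
  rw [this]
  exact (abs_sub_le _ _ _).trans (add_le_add k1 k3)

omit [MeasurableSpace X] in
theorem pow_visits_mem {z : ℝ} (h0 : 0 ≤ z) (h1 : z ≤ 1) (L : ℕ) (x : X) :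
    0 ≤ z ^ visits f U L x ∧ z ^ visits f U L x ≤ 1 :=
  ⟨pow_nonneg h0 _, pow_le_one₀ h0 h1⟩

omit [IsProbabilityMeasure μ] in
theorem measurable_pow_visits (hf : Measurable f) (hU : MeasurableSet U) (z : ℝ) (L : ℕ) :
    Measurable fun x => z ^ visits f U L x :=
  (measurable_from_nat (f := fun n => z ^ n)).comp (measurable_visits hf hU L)

theorem one_sub_pow_le {z : ℝ} (h0 : 0 ≤ z) (n : ℕ) : 1 - z ^ n ≤ n := by
  rcases Nat.eq_zero_or_pos n with rfl | hn
  · simp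
  · have : (1 : ℝ) ≤ n := by exact_mod_cast hn
    have := pow_nonneg h0 n
    linarith

/-- Dropping a block altogether costs at most its expected number of visits, because 1 - z^n ≤ n. -/
theorem blockDev_short (hf : MeasurePreserving f μ μ) (hU : MeasurableSet U) {z : ℝ}
    (h0 : 0 ≤ z) (h1 : z ≤ 1) (L : ℕ) :
    BlockDev μ f (fun x => z ^ visits f U L x) L 1 (L * μ.real U) := by
  intro G hG hG1
  have hGL : Measurable fun x => G (f^[L] x) := hG.comp (hf.measurable.iterate L)
  have hp := measurable_pow_visits hf.measurable hU z L
  have i1 : Integrable (fun x => z ^ visits f U L x * G (f^[L] x)) μ :=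
    integrable_of_mem_Icc (hp.mul hGL) fun x => ⟨mul_nonneg (pow_visits_mem h0 h1 L x).1 (hG1 _).1,
      mul_le_one₀ (pow_visits_mem h0 h1 L x).2 (hG1 _).1 (hG1 _).2⟩
  have i2 : Integrable (fun x => G (f^[L] x)) μ := integrable_of_mem_Icc hGL fun x => hG1 _
  rw [one_mul, ← integral_comp_iterate hf hG L, ← integral_sub i1 i2, ← integral_visits hf hU L]
  refine (abs_integral_le_integral_abs).trans (integral_mono (i1.sub i2).abs
    (integrable_visits hf.measurable hU L) fun x => ?_)
  change |z ^ visits f U L x * G (f^[L] x) - G (f^[L] x)| ≤ visits f U L x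
  rw [abs_sub_comm]
  have hz := pow_visits_mem (f := f) (U := U) h0 h1 L x
  have hz2 := one_sub_pow_le h0 (visits f U L x)
  have hg := hG1 (f^[L] x)
  rw [abs_of_nonneg (by nlinarith)]
  nlinarith

/-- The gap of length T between the weights and the future makes every lag exceed T, so the L
correlation errors add up to at most the tail σ. -/
theorem blockDev_weight (hf : MeasurePreserving f μ μ) (hU : MeasurableSet U) {ρ : ℕ → ℝ}
    (hρ : ∀ t, 0 ≤ ρ t) (hD : DecayBound μ f q U ρ) {T : ℕ} {σ : ℝ}
    (hσ : ∀ n, ∑ d ∈ Finset.Ico (T + 1) n, ρ d ≤ σ) {z : ℝ} (h0 : 0 ≤ z) (h1 : z < 1) (L : ℕ) :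
    BlockDev μ f (fun x => 1 - ∑ j ∈ Finset.range L, weight f q U z (f^[j] x)) (L + T)
      (1 - L * ∫ x, weight f q U z x ∂μ) σ := by
  intro G hG hG1
  set w := weight f q U z with hw
  have hwm : Measurable w := measurable_weight hf.measurable hU h0 h1
  have hw1 : ∀ x, 0 ≤ w x ∧ w x ≤ 1 := weight_mem h0 h1
  have hGL : Measurable fun x => G (f^[L + T] x) := hG.comp (hf.measurable.iterate _)
  have i2 : Integrable (fun x => G (f^[L + T] x)) μ := integrable_of_mem_Icc hGL fun x => hG1 _
  have i3 : ∀ j, Integrable (fun x => w (f^[j] x) * G (f^[L + T] x)) μ := fun j =>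
    integrable_of_mem_Icc ((hwm.comp (hf.measurable.iterate j)).mul hGL) fun x =>
      ⟨mul_nonneg (hw1 _).1 (hG1 _).1, mul_le_one₀ (hw1 _).2 (hG1 _).1 (hG1 _).2⟩
  have hexp : (∫ x, (1 - ∑ j ∈ Finset.range L, w (f^[j] x)) * G (f^[L + T] x) ∂μ) =
      (∫ x, G x ∂μ) - ∑ j ∈ Finset.range L, ∫ x, w x * G (f^[L + T - j] x) ∂μ := by
    have e1 : (fun x => (1 - ∑ j ∈ Finset.range L, w (f^[j] x)) * G (f^[L + T] x)) =
        fun x => G (f^[L + T] x) - ∑ j ∈ Finset.range L, w (f^[j] x) * G (f^[L + T] x) := by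
      ext x; rw [sub_mul, one_mul, Finset.sum_mul]
    rw [e1, integral_sub i2 (integrable_finsetSum _ fun j _ => i3 j),
      integral_comp_iterate hf hG, integral_finsetSum _ fun j _ => i3 j]
    congr 1
    refine Finset.sum_congr rfl fun j hj => ?_
    rw [← integral_comp_iterate hf (g := fun x => w x * G (f^[L + T - j] x))
      (hwm.mul (hG.comp (hf.measurable.iterate _))) j]
    rw [Finset.mem_range] at hj
    simp only [← Function.iterate_add_apply]
    rw [Nat.sub_add_cancel (by omega)]
  rw [hexp]
  have hsum : |∑ j ∈ Finset.range L, ((∫ x, w x * G (f^[L + T - j] x) ∂μ) -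
      (∫ x, w x ∂μ) * ∫ x, G x ∂μ)| ≤ σ :=
    (Finset.abs_sum_le_sum_abs _ _).trans ((Finset.sum_le_sum fun j _ =>
      weight_decay hf.measurable hU hρ hD h0 h1 hG hG1 (L + T - j)).trans (sum_reflect_le hσ L))
  rw [Finset.sum_sub_distrib, Finset.sum_const, Finset.card_range, nsmul_eq_mul] at hsum
  rw [abs_sub_comm] at hsum
  convert hsum using 2
  ring

/-- The four error terms come from visits during the gap, visits in the last q times before it,
pairs of visits to A^(0), and correlations across the gap. -/
theorem blockDev_pow_visits (hf : MeasurePreserving f μ μ) (hU : MeasurableSet U) {ρ : ℕ → ℝ}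
    (hρ : ∀ t, 0 ≤ ρ t) (hD : DecayBound μ f q U ρ) {T : ℕ} {σ : ℝ}
    (hσ : ∀ n, ∑ d ∈ Finset.Ico (T + 1) n, ρ d ≤ σ)
    (hret : ∀ x ∈ setA f q U 0, ∀ r, 1 ≤ r → r ≤ T → f^[r] x ∉ U)
    {z : ℝ} (h0 : 0 ≤ z) (h1 : z < 1) (L : ℕ) :
    BlockDev μ f (fun x => z ^ visits f U (L + T) x) (L + T) (1 - L * ∫ x, weight f q U z x ∂μ)
      (T * μ.real U + 2 * (q * μ.real U) +
        3 * (L * (L * μ.real (setA f q U 0) ^ 2 + μ.real (setA f q U 0) * σ)) + σ) := by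
  intro G hG hG1
  have hw := blockDev_weight hf hU hρ hD hσ h0 h1 L G hG hG1
  have hGL : Measurable fun x => G (f^[L + T] x) := hG.comp (hf.measurable.iterate _)
  set w := weight f q U z with hw_def
  have hwm : Measurable w := measurable_weight hf.measurable hU h0 h1
  have hw1 : ∀ x, 0 ≤ w x ∧ w x ≤ 1 := weight_mem h0 h1
  have i1 : Integrable (fun x => z ^ visits f U (L + T) x * G (f^[L + T] x)) μ :=
    integrable_of_mem_Icc ((measurable_pow_visits hf.measurable hU z _).mul hGL) fun x =>
      ⟨mul_nonneg (pow_visits_mem h0 h1.le _ x).1 (hG1 _).1,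
        mul_le_one₀ (pow_visits_mem h0 h1.le _ x).2 (hG1 _).1 (hG1 _).2⟩
  have hsm : Measurable fun x => 1 - ∑ j ∈ Finset.range L, w (f^[j] x) :=
    measurable_const.sub (Finset.measurable_sum _ fun j _ => hwm.comp (hf.measurable.iterate j))
  have i2 : Integrable (fun x => (1 - ∑ j ∈ Finset.range L, w (f^[j] x)) * G (f^[L + T] x)) μ := by
    refine Integrable.of_bound (hsm.mul hGL).aestronglyMeasurable (1 + L)
      (Eventually.of_forall fun x => ?_)
    have s0 : 0 ≤ ∑ j ∈ Finset.range L, w (f^[j] x) := Finset.sum_nonneg fun j _ => (hw1 _).1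
    have s1 : ∑ j ∈ Finset.range L, w (f^[j] x) ≤ L := by
      simpa using Finset.sum_le_sum (s := Finset.range L) fun j _ => (hw1 (f^[j] x)).2
    rw [Real.norm_eq_abs, abs_mul, abs_of_nonneg (hG1 _).1]
    have : |1 - ∑ j ∈ Finset.range L, w (f^[j] x)| ≤ 1 + L := by
      rw [abs_le]; constructor <;> linarith
    exact (mul_le_of_le_one_right (abs_nonneg _) (hG1 _).2).trans this
  have j1 := integrable_visits (μ := μ) hf.measurable hU T
  have j1' : Integrable (fun x => (visits f U T (f^[L] x) : ℝ)) μ :=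
    (hf.iterate L).integrable_comp_of_integrable j1
  have j2 := integrable_visits (μ := μ) hf.measurable hU q
  have j2' : Integrable (fun x => (visits f U q (f^[L - q] x) : ℝ)) μ :=
    (hf.iterate (L - q)).integrable_comp_of_integrable j2
  have j3 := integrable_pairs (μ := μ) hf.measurable (measurableSet_setA (q := q) hf.measurable hU 0) L
  have hpt : ∀ x, |z ^ visits f U (L + T) x * G (f^[L + T] x) -
      (1 - ∑ j ∈ Finset.range L, w (f^[j] x)) * G (f^[L + T] x)| ≤
      visits f U T (f^[L] x) + 2 * visits f U q (f^[L - q] x) +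
        3 * pairs f (setA f q U 0) L x := by
    intro x
    rw [← sub_mul, abs_mul, abs_of_nonneg (hG1 _).1]
    refine (mul_le_of_le_one_right (abs_nonneg _) (hG1 _).2).trans ?_
    have k1 := abs_pow_visits_sub_le (f := f) (q := q) (U := U) h0 h1 L x
    have k2 : |z ^ visits f U (L + T) x - z ^ visits f U L x| ≤ visits f U T (f^[L] x) := by
      rw [visits_add, pow_add, abs_sub_comm]
      have a1 := pow_visits_mem (f := f) (U := U) h0 h1.le L x
      have a2 := pow_visits_mem (f := f) (U := U) h0 h1.le T (f^[L] x)
      have a3 := one_sub_pow_le h0 (visits f U T (f^[L] x))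
      rw [abs_of_nonneg (by nlinarith)]
      nlinarith
    calc _ ≤ _ := abs_sub_le _ (z ^ visits f U L x) _
      _ ≤ _ := by linarith
  have hdiff : |(∫ x, z ^ visits f U (L + T) x * G (f^[L + T] x) ∂μ) -
      ∫ x, (1 - ∑ j ∈ Finset.range L, w (f^[j] x)) * G (f^[L + T] x) ∂μ| ≤
      T * μ.real U + 2 * (q * μ.real U) +
        3 * (L * (L * μ.real (setA f q U 0) ^ 2 + μ.real (setA f q U 0) * σ)) := by
    rw [← integral_sub i1 i2]
    refine abs_integral_le_integral_abs.trans ((integral_mono (i1.sub i2).abs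
      ((j1'.add (j2'.const_mul 2)).add (j3.const_mul 3)) hpt).trans ?_)
    have e1 : (∫ x, (visits f U T (f^[L] x) : ℝ) ∂μ) = T * μ.real U := by
      rw [← integral_visits hf hU T]
      exact integral_comp_iterate hf (g := fun x => (visits f U T x : ℝ))
        (measurable_from_nat.comp (measurable_visits hf.measurable hU T)) L
    have e2 : (∫ x, (visits f U q (f^[L - q] x) : ℝ) ∂μ) = q * μ.real U := by
      rw [← integral_visits hf hU q]
      exact integral_comp_iterate hf (g := fun x => (visits f U q x : ℝ))
        (measurable_from_nat.comp (measurable_visits hf.measurable hU q)) (L - q)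
    have e3 := integral_pairs_le hf hU hρ hD hσ hret L
    have e4 : ∫ x, ((visits f U T (f^[L] x) : ℝ) + 2 * visits f U q (f^[L - q] x) +
        3 * pairs f (setA f q U 0) L x) ∂μ = T * μ.real U + 2 * (q * μ.real U) +
          3 * ∫ x, pairs f (setA f q U 0) L x ∂μ := by
      rw [integral_add (f := fun x => (visits f U T (f^[L] x) : ℝ) + 2 * visits f U q (f^[L - q] x))
        (j1'.add (j2'.const_mul 2)) (j3.const_mul 3), integral_add j1' (j2'.const_mul 2),
        integral_const_mul, integral_const_mul, e1, e2]
    refine e4.le.trans ?_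
    linarith
  exact (abs_sub_le _ _ _).trans (add_le_add hdiff hw)

end Blocks

/-! ### The multiplicity distribution -/

section Multiplicity

variable {X : Type*} [MeasurableSpace X] {μ : Measure X} [IsProbabilityMeasure μ] {f : X → X}
  {q : ℕ} {U : Set X}

/-- Integrating the comparison of visit counts over L steps gives L times the difference at most 1,
for every L. -/
theorem measureReal_setA_succ_le (hf : MeasurePreserving f μ μ) (hU : MeasurableSet U) (κ : ℕ) :
    μ.real (setA f q U (κ + 1)) ≤ μ.real (setA f q U κ) := by
  have hm := fun κ => measurableSet_setA (q := q) hf.measurable hU κ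
  have key : ∀ L : ℕ, (L : ℝ) * (μ.real (setA f q U (κ + 1)) - μ.real (setA f q U κ)) ≤ 1 := by
    intro L
    have h1 := integral_mono (μ := μ) (integrable_visits hf.measurable (hm (κ + 1)) L)
      ((integrable_visits hf.measurable (hm κ) L).add (integrable_const (1 : ℝ)))
      (fun x => by
        have := visits_setA_succ_le (f := f) (q := q) (U := U) κ L x
        simp only [Pi.add_apply]
        exact_mod_cast this)
    simp only [Pi.add_apply] at h1
    rw [integral_add (integrable_visits hf.measurable (hm κ) L) (integrable_const (1 : ℝ)),
      integral_visits hf (hm _), integral_visits hf (hm _)] at h1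
    simp at h1
    linarith
  by_contra! hlt
  obtain ⟨L, hL⟩ := exists_nat_gt (1 / (μ.real (setA f q U (κ + 1)) - μ.real (setA f q U κ)))
  rw [div_lt_iff₀ (by linarith)] at hL
  linarith [key L]

/-- The first κ + 1 sets are disjoint parts of U, and the last has the smallest measure. -/
theorem succ_mul_measureReal_setA_le (hf : MeasurePreserving f μ μ) (hU : MeasurableSet U)
    (κ : ℕ) : ((κ : ℝ) + 1) * μ.real (setA f q U κ) ≤ μ.real U := by
  have hanti : Antitone fun κ => μ.real (setA f q U κ) :=
    antitone_nat_of_succ_le (measureReal_setA_succ_le hf hU)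
  have h1 : ∑ j ∈ Finset.range (κ + 1), μ.real (setA f q U j) ≤ μ.real U := by
    rw [← measureReal_biUnion_finset (fun i _ j _ hij => setA_disjoint hij)
      (fun j _ => measurableSet_setA hf.measurable hU j)]
    exact measureReal_mono (iUnion₂_subset fun j _ => setA_subset j)
  have h2 : ∑ _j ∈ Finset.range (κ + 1), μ.real (setA f q U κ) ≤
      ∑ j ∈ Finset.range (κ + 1), μ.real (setA f q U j) :=
    Finset.sum_le_sum fun j hj => hanti (Nat.lt_succ_iff.1 (Finset.mem_range.1 hj))
  simp only [Finset.sum_const, Finset.card_range, nsmul_eq_mul] at h2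
  push_cast at h2
  linarith

end Multiplicity

/-- Here α k plays the role of the tail probability of values larger than k; the limit zero makes
the differences sum to one. -/
theorem exists_pmf_of_antitone {α : ℕ → ℝ} (h0 : α 0 = 1) (hanti : Antitone α)
    (hlim : Tendsto α atTop (𝓝 0)) :
    ∃ P : PMF ℕ, P 0 = 0 ∧ ∀ k, (P (k + 1)).toReal = α k - α (k + 1) := by
  have hsum : HasSum (fun k => α k - α (k + 1)) 1 := by
    rw [hasSum_iff_tendsto_nat_of_nonneg (fun k => sub_nonneg.2 (hanti (Nat.le_succ k)))]
    simp only [Finset.sum_range_sub', h0]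
    simpa using hlim.const_sub 1
  let g : ℕ → ℝ≥0∞ := fun k => if k = 0 then 0 else ENNReal.ofReal (α (k - 1) - α k)
  have hg : HasSum g 1 := by
    rw [ENNReal.summable.hasSum_iff, tsum_eq_zero_add' ENNReal.summable]
    simp only [g, if_true, Nat.succ_ne_zero, if_false, Nat.add_sub_cancel, zero_add]
    rw [← ENNReal.ofReal_tsum_of_nonneg (fun k => sub_nonneg.2 (hanti (Nat.le_succ k)))
      hsum.summable, hsum.tsum_eq, ENNReal.ofReal_one]
  refine ⟨⟨g, hg⟩, rfl, fun k => ?_⟩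
  change (g (k + 1)).toReal = _
  simp only [g, Nat.succ_ne_zero, if_false, Nat.add_sub_cancel]
  exact ENNReal.toReal_ofReal (sub_nonneg.2 (hanti (Nat.le_succ k)))

/-- Summation by parts converts the tail probabilities α into the generating function of P. -/
theorem hasSum_weights_of_pmf {α : ℕ → ℝ} (h0 : α 0 = 1) (hα : ∀ κ, 0 ≤ α κ ∧ α κ ≤ 1)
    {P : PMF ℕ} (hP0 : P 0 = 0) (hP : ∀ k, (P (k + 1)).toReal = α k - α (k + 1))
    {z : ℝ} (hz0 : 0 ≤ z) (hz1 : z < 1) :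
    HasSum (fun κ : ℕ => (1 - z) * z ^ κ * α κ) (1 - ∑' k : ℕ, (P k).toReal * z ^ k) := by
  have hs : Summable fun κ : ℕ => z ^ κ * α κ :=
    Summable.of_nonneg_of_le (fun κ => mul_nonneg (pow_nonneg hz0 κ) (hα κ).1)
      (fun κ => mul_le_of_le_one_right (pow_nonneg hz0 κ) (hα κ).2)
      (summable_geometric_of_lt_one hz0 hz1)
  obtain ⟨S, hS⟩ := hs
  have h1 : HasSum (fun κ : ℕ => z ^ (κ + 1) * α (κ + 1)) (S - 1) := by
    have := (hasSum_nat_add_iff' 1).2 hS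
    simpa [h0] using this
  have h2 := (hS.mul_left z).sub h1
  have h3 : HasSum (fun k : ℕ => (P k).toReal * z ^ k) (z * S - (S - 1)) := by
    rw [← hasSum_nat_add_iff' 1]
    simp only [Finset.range_one, Finset.sum_singleton, hP0, ENNReal.toReal_zero, zero_mul, sub_zero]
    convert h2 using 2 with κ
    rw [hP]; ring
  rw [h3.tsum_eq]
  have e : 1 - (z * S - (S - 1)) = (1 - z) * S := by ring
  rw [e]
  simpa only [mul_assoc] using hS.mul_left (1 - z)

/-! ### The generating function of the numbers of exceedances in successive blocks -/

section Asymptotics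

variable {X : Type*} [MeasurableSpace X] {μ : Measure X} [IsProbabilityMeasure μ] {f : X → X}
  {q : ℕ} {U : ℕ → Set X}

/-- The hypotheses on the exceedance sets `U n` under which blocks of time decouple: they become
rare, correlations decay summably, and the return times of `A_q^(0)` tend to infinity. -/
structure RareSets (μ : Measure X) (f : X → X) (q : ℕ) (U : ℕ → Set X) (β : ℕ → ℝ) : Prop where
  preserving : MeasurePreserving f μ μ
  measurableSet : ∀ n, MeasurableSet (U n)
  rare : Tendsto (fun n => μ.real (U n)) atTop (𝓝 0)
  pos : ∀ᶠ n in atTop, 0 < μ.real (U n)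
  decay : ∃ ρ : ℕ → ℝ, (∀ t, 0 ≤ ρ t) ∧ Summable ρ ∧ ∀ᶠ n in atTop, DecayBound μ f q (U n) ρ
  no_return : ∀ T, ∀ᶠ n in atTop, ∀ x ∈ setA f q (U n) 0, ∀ r, 1 ≤ r → r ≤ T → f^[r] x ∉ U n
  limit : ∀ κ, Tendsto (fun n => μ.real (setA f q (U n) κ) / μ.real (U n)) atTop (𝓝 (β κ))

/-- The exponent `(1 - z) ∑ z^κ β_κ`. -/
def exponent (β : ℕ → ℝ) (z : ℝ) : ℝ := ∑' κ : ℕ, (1 - z) * z ^ κ * β κ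

namespace RareSets

variable {β : ℕ → ℝ}

theorem beta_mem (h : RareSets μ f q U β) (κ : ℕ) : 0 ≤ β κ ∧ β κ ≤ 1 := by
  refine ⟨ge_of_tendsto' (h.limit κ) fun n => by positivity, le_of_tendsto' (h.limit κ) fun n => ?_⟩
  exact div_le_one_of_le₀ (measureReal_mono (setA_subset κ)) measureReal_nonneg

theorem exponent_mem (h : RareSets μ f q U β) {z : ℝ} (h0 : 0 ≤ z) (h1 : z < 1) :
    0 ≤ exponent β z ∧ exponent β z ≤ 1 := by
  have hg := hasSum_geometric_weights h0 h1
  have hc : ∀ κ : ℕ, 0 ≤ (1 - z) * z ^ κ := fun κ => mul_nonneg (by linarith) (pow_nonneg h0 κ)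
  have hle : ∀ κ : ℕ, (1 - z) * z ^ κ * β κ ≤ (1 - z) * z ^ κ := fun κ =>
    mul_le_of_le_one_right (hc κ) (h.beta_mem κ).2
  have hnn : ∀ κ : ℕ, 0 ≤ (1 - z) * z ^ κ * β κ := fun κ => mul_nonneg (hc κ) (h.beta_mem κ).1
  refine ⟨tsum_nonneg hnn, ?_⟩
  rw [← hg.tsum_eq]
  exact (Summable.of_nonneg_of_le hnn hle hg.summable).tsum_le_tsum hle hg.summable

theorem tendsto_integral_weight (h : RareSets μ f q U β) {z : ℝ} (h0 : 0 ≤ z) (h1 : z < 1) :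
    Tendsto (fun n => (∫ x, weight f q (U n) z x ∂μ) / μ.real (U n)) atTop
      (𝓝 (exponent β z)) := by
  have hc : ∀ κ : ℕ, 0 ≤ (1 - z) * z ^ κ := fun κ => mul_nonneg (by linarith) (pow_nonneg h0 κ)
  have e : ∀ n, (∫ x, weight f q (U n) z x ∂μ) / μ.real (U n) =
      ∑' κ : ℕ, (1 - z) * z ^ κ * (μ.real (setA f q (U n) κ) / μ.real (U n)) := by
    intro n
    rw [← (hasSum_integral_weight h.preserving.measurable (h.measurableSet n) h0 h1).tsum_eq,
      ← tsum_div_const]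
    exact tsum_congr fun κ => by ring
  simp only [e]
  refine tendsto_tsum_of_dominated_convergence (hasSum_geometric_weights h0 h1).summable
    (fun κ => (h.limit κ).const_mul _) (Eventually.of_forall fun n κ => ?_)
  rw [norm_mul, Real.norm_of_nonneg (hc κ), Real.norm_of_nonneg (by positivity)]
  exact mul_le_of_le_one_right (hc κ)
    (div_le_one_of_le₀ (measureReal_mono (setA_subset κ)) measureReal_nonneg)

omit [IsProbabilityMeasure μ] in
theorem tendsto_length (h : RareSets μ f q U β) {s : ℝ} (hs : 0 < s) {L : ℕ → ℕ}
    (hL : Tendsto (fun n => (L n : ℝ) * μ.real (U n)) atTop (𝓝 s)) : Tendsto L atTop atTop := by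
  rw [← tendsto_natCast_atTop_iff (R := ℝ)]
  have hinv : Tendsto (fun n => (μ.real (U n))⁻¹) atTop atTop :=
    tendsto_inv_nhdsGT_zero.comp (tendsto_nhdsWithin_iff.2 ⟨h.rare, h.pos⟩)
  refine (hL.pos_mul_atTop hs hinv).congr' ?_
  filter_upwards [h.pos] with n hn
  rw [mul_assoc, mul_inv_cancel₀ hn.ne', mul_one]

/-- Of the 4 s², one comes from replacing 1 - sℓ by e^{-sℓ} and three from the pairs of visits to
A^(0). The gap and end terms vanish because T and q are fixed while μ(U) tends to zero. -/
theorem eventually_blockDev_small (h : RareSets μ f q U β) {z : ℝ} (h0 : 0 ≤ z) (h1 : z < 1)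
    {s : ℝ} (hs : 0 < s) (hs1 : s ≤ 1) {L : ℕ → ℕ}
    (hL : Tendsto (fun n => (L n : ℝ) * μ.real (U n)) atTop (𝓝 s)) {ε : ℝ} (hε : 0 < ε) :
    ∀ᶠ n in atTop, BlockDev μ f (fun x => z ^ visits f (U n) (L n) x) (L n)
      (Real.exp (-(s * exponent β z))) (4 * s ^ 2 + ε) := by
  obtain ⟨ρ, hρ0, hρ, hD⟩ := h.decay
  have htail := tendsto_sum_nat_add ρ
  -- The tail σ enters as 3sσ + σ ≤ 4σ, so σ < ε / 8 leaves room.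
  obtain ⟨T, hT⟩ : ∃ T, ∑' k, ρ (k + (T + 1)) < ε / 8 :=
    ((htail.comp (tendsto_add_atTop_nat 1)).eventually (gt_mem_nhds (by positivity))).exists
  set σ := ∑' k, ρ (k + (T + 1)) with hσ_def
  have hσ0 : 0 ≤ σ := tsum_nonneg fun k => hρ0 _
  have hσ : ∀ n, ∑ d ∈ Finset.Ico (T + 1) n, ρ d ≤ σ := by
    intro n
    rw [Finset.sum_Ico_eq_sum_range]
    simp only [add_comm (T + 1)]
    exact ((summable_nat_add_iff (T + 1)).2 hρ).sum_le_tsum _ fun k _ => hρ0 _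
  have hℓ := h.exponent_mem h0 h1
  set ℓ := exponent β z
  have hLT : Tendsto (fun n => ((L n - T : ℕ) : ℝ) * μ.real (U n)) atTop (𝓝 s) := by
    have h2 : Tendsto (fun n => (L n : ℝ) * μ.real (U n) - T * μ.real (U n)) atTop (𝓝 s) := by
      simpa using hL.sub (h.rare.const_mul (T : ℝ))
    refine h2.congr' ?_
    filter_upwards [(h.tendsto_length hs hL).eventually_ge_atTop T] with n hn
    rw [Nat.cast_sub hn]; ring
  have hlam : Tendsto (fun n => 1 - ((L n - T : ℕ) : ℝ) * ∫ x, weight f q (U n) z x ∂μ) atTop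
      (𝓝 (1 - s * ℓ)) := by
    refine Tendsto.const_sub 1 ((hLT.mul (h.tendsto_integral_weight h0 h1)).congr' ?_)
    filter_upwards [h.pos] with n hn
    field_simp
  have hexp : |1 - s * ℓ - Real.exp (-(s * ℓ))| ≤ s ^ 2 := by
    have hsl : s * ℓ ≤ 1 := mul_le_one₀ hs1 hℓ.1 hℓ.2
    have hsl0 : 0 ≤ s * ℓ := mul_nonneg hs.le hℓ.1
    have := Real.abs_exp_sub_one_sub_id_le (x := -(s * ℓ)) (by rw [abs_neg, abs_of_nonneg hsl0]; exact hsl)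
    rw [abs_sub_comm]
    have e : Real.exp (-(s * ℓ)) - (1 - s * ℓ) = Real.exp (-(s * ℓ)) - 1 - -(s * ℓ) := by ring
    rw [e]
    refine this.trans ?_
    rw [neg_sq]
    exact pow_le_pow_left₀ hsl0 (mul_le_of_le_one_right hs.le hℓ.2) 2
  have herr : Tendsto (fun n => (T * μ.real (U n) + 2 * (q * μ.real (U n)) +
      3 * (((L n - T : ℕ) * μ.real (U n)) * ((L n - T : ℕ) * μ.real (U n) + σ)) + σ) +
      |1 - ((L n - T : ℕ) : ℝ) * (∫ x, weight f q (U n) z x ∂μ) - Real.exp (-(s * ℓ))|) atTop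
      (𝓝 ((T * 0 + 2 * (q * 0) + 3 * (s * (s + σ)) + σ) + |1 - s * ℓ - Real.exp (-(s * ℓ))|)) :=
    ((((h.rare.const_mul _).add ((h.rare.const_mul _).const_mul 2)).add
      ((hLT.mul (hLT.add_const σ)).const_mul 3)).add_const σ).add (hlam.sub_const _).abs
  have hlt : (T * 0 + 2 * (q * 0) + 3 * (s * (s + σ)) + σ) + |1 - s * ℓ - Real.exp (-(s * ℓ))| <
      4 * s ^ 2 + ε := by
    have : s * σ ≤ σ := mul_le_of_le_one_left hσ0 hs1
    nlinarith
  filter_upwards [herr.eventually (gt_mem_nhds hlt), hD, h.no_return T,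
    (h.tendsto_length hs hL).eventually_ge_atTop T] with n hn hDn hret hLn
  have key := (blockDev_pow_visits h.preserving (h.measurableSet n) hρ0 hDn hσ hret h0 h1
    (L n - T)).change (lam' := Real.exp (-(s * ℓ)))
  rw [Nat.sub_add_cancel hLn] at key
  refine key.mono (le_trans ?_ hn.le)
  have ha : μ.real (setA f q (U n) 0) ≤ μ.real (U n) := measureReal_mono (setA_subset 0)
  have ha0 : 0 ≤ μ.real (setA f q (U n) 0) := measureReal_nonneg
  have hLn0 : (0 : ℝ) ≤ (L n - T : ℕ) := Nat.cast_nonneg _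
  have e1 : ((L n - T : ℕ) : ℝ) * ((L n - T : ℕ) * μ.real (setA f q (U n) 0) ^ 2 +
      μ.real (setA f q (U n) 0) * σ) = ((L n - T : ℕ) * μ.real (setA f q (U n) 0)) *
      ((L n - T : ℕ) * μ.real (setA f q (U n) 0) + σ) := by ring
  rw [e1]
  gcongr

omit [IsProbabilityMeasure μ] in
theorem blockDev_pow (hf : Measurable f) {V : Set X} (hV : MeasurableSet V) {z : ℝ} (h0 : 0 ≤ z)
    (h1 : z ≤ 1) {l : ℕ} {lam e : ℝ} (hlam0 : 0 ≤ lam) (hlam : lam ≤ 1)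
    (hB : BlockDev μ f (fun x => z ^ visits f V l x) l lam e) (K : ℕ) :
    BlockDev μ f (fun x => z ^ visits f V (K * l) x) (K * l) (lam ^ K) (K * e) := by
  induction K with
  | zero => intro G hG hG1; simp
  | succ K ih =>
    have := ih.comp hf hB (by rw [abs_of_nonneg (by positivity)]; exact pow_le_one₀ hlam0 hlam)
      (measurable_pow_visits hf hV z l) (pow_visits_mem h0 h1 l)
    rw [Nat.succ_mul, pow_succ]
    push_cast
    rw [add_mul, one_mul]
    simpa only [visits_add, pow_add] using this

/-- K sub-blocks of length s / K produce a total quadratic error K · 4 (s / K)² = 4 s² / K. The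
fewer than K steps left over by the integer division cost at most K μ(U). -/
theorem eventually_blockDev (h : RareSets μ f q U β) {z : ℝ} (h0 : 0 ≤ z) (h1 : z < 1)
    {s : ℝ} (hs : 0 < s) {L : ℕ → ℕ}
    (hL : Tendsto (fun n => (L n : ℝ) * μ.real (U n)) atTop (𝓝 s)) {ε : ℝ} (hε : 0 < ε) :
    ∀ᶠ n in atTop, BlockDev μ f (fun x => z ^ visits f (U n) (L n) x) (L n)
      (Real.exp (-(s * exponent β z))) ε := by
  have hℓ := h.exponent_mem h0 h1
  -- K > s makes the sub-blocks shorter than one, and K > 12 s² / ε makes 4 s² / K smaller than ε /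
  -- 3.
  obtain ⟨K, hK⟩ := exists_nat_gt (max s (12 * s ^ 2 / ε))
  have hKs : s < K := (le_max_left _ _).trans_lt hK
  have hKε : 12 * s ^ 2 / ε < K := (le_max_right _ _).trans_lt hK
  have hK0 : (0 : ℝ) < K := hs.trans hKs
  have hl : Tendsto (fun n => ((L n / K : ℕ) : ℝ) * μ.real (U n)) atTop (𝓝 (s / K)) := by
    have hup : Tendsto (fun n => (L n : ℝ) * μ.real (U n) / K) atTop (𝓝 (s / K)) :=
      hL.div_const _
    have hlo : Tendsto (fun n => (L n : ℝ) * μ.real (U n) / K - μ.real (U n)) atTop (𝓝 (s / K)) := by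
      simpa using hup.sub h.rare
    refine tendsto_of_tendsto_of_tendsto_of_le_of_le hlo hup (fun n => ?_) (fun n => ?_)
    · have h3 : (L n : ℝ) / K ≤ (L n / K : ℕ) + 1 := by
        rw [div_le_iff₀ hK0]
        have := (Nat.lt_div_mul_add (a := L n) (b := K) (by exact_mod_cast hK0)).le
        have : (L n : ℝ) ≤ ((L n / K * K + K : ℕ) : ℝ) := by exact_mod_cast this
        push_cast at this
        linarith
      have := mul_le_mul_of_nonneg_right h3 (measureReal_nonneg (μ := μ) (s := U n))
      have e : (L n : ℝ) * μ.real (U n) / K = L n / K * μ.real (U n) := by ring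
      change _ - _ ≤ _
      rw [e]
      linarith
    · have h3 : ((L n / K : ℕ) : ℝ) ≤ L n / K := Nat.cast_div_le
      have := mul_le_mul_of_nonneg_right h3 (measureReal_nonneg (μ := μ) (s := U n))
      have e : (L n : ℝ) * μ.real (U n) / K = L n / K * μ.real (U n) := by ring
      change _ ≤ _
      rw [e]
      exact this
  have hsK : 0 < s / K := div_pos hs hK0
  have hsmall := h.eventually_blockDev_small h0 h1 hsK ((div_le_one hK0).2 hKs.le) hl
    (ε := ε / (3 * K)) (by positivity)
  have hrare : ∀ᶠ n in atTop, K * μ.real (U n) < ε / 3 := by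
    have := h.rare.const_mul (K : ℝ)
    rw [mul_zero] at this
    exact this.eventually (gt_mem_nhds (by positivity))
  filter_upwards [hsmall, hrare] with n hn hrn
  have hexp1 : Real.exp (-(s / K * exponent β z)) ≤ 1 :=
    Real.exp_le_one_iff.2 (neg_nonpos.2 (mul_nonneg hsK.le hℓ.1))
  have hb := blockDev_pow h.preserving.measurable (h.measurableSet n) h0 h1.le
    (Real.exp_nonneg _) hexp1 hn K
  have hc := hb.comp h.preserving.measurable
    (blockDev_short h.preserving (h.measurableSet n) h0 h1.le (L n % K))
    (by rw [abs_of_nonneg (by positivity)]; exact pow_le_one₀ (Real.exp_nonneg _) hexp1)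
    (measurable_pow_visits h.preserving.measurable (h.measurableSet n) z _)
    (pow_visits_mem h0 h1.le _)
  simp only [← pow_add, ← visits_add, Nat.div_add_mod, mul_one] at hc
  rw [← Real.exp_nat_mul] at hc
  have e1 : (K : ℝ) * -(s / K * exponent β z) = -(s * exponent β z) := by field_simp
  rw [e1] at hc
  refine hc.mono ?_
  have h4 : ((L n % K : ℕ) : ℝ) ≤ K := by
    exact_mod_cast (Nat.mod_lt _ (by exact_mod_cast hK0)).le
  have h5 : ((L n % K : ℕ) : ℝ) * μ.real (U n) ≤ K * μ.real (U n) := by gcongr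
  have h6 : (K : ℝ) * (4 * (s / K) ^ 2 + ε / (3 * K)) = 4 * s ^ 2 / K + ε / 3 := by field_simp
  have h7 : 4 * s ^ 2 / K ≤ ε / 3 := by
    rw [div_lt_iff₀ hε] at hKε
    rw [div_le_iff₀ hK0]
    linarith
  rw [h6]
  linarith

/-- The generating function of the numbers of visits in successive blocks of time. -/
theorem tendsto_generating (h : RareSets μ f q U β) {z : ℕ → ℝ}
    (hz : ∀ b, 0 ≤ z b ∧ z b < 1) {s : ℝ} (hs : 0 < s) {a : ℕ → ℕ → ℕ} (ha0 : ∀ n, a n 0 = 0)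
    (hmono : ∀ n, Monotone (a n))
    (hL : ∀ b, Tendsto (fun n => ((a n (b + 1) - a n b : ℕ) : ℝ) * μ.real (U n)) atTop (𝓝 s))
    (M : ℕ) :
    Tendsto (fun n => ∫ x, ∏ b ∈ Finset.range M,
        z b ^ visits f (U n) (a n (b + 1) - a n b) (f^[a n b] x) ∂μ) atTop
      (𝓝 (Real.exp (-(s * ∑ b ∈ Finset.range M, exponent β (z b))))) := by
  have key : ∀ M : ℕ, ∀ ε > 0, ∀ᶠ n in atTop, BlockDev μ f (fun x => ∏ b ∈ Finset.range M,
      z b ^ visits f (U n) (a n (b + 1) - a n b) (f^[a n b] x)) (a n M)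
      (Real.exp (-(s * ∑ b ∈ Finset.range M, exponent β (z b)))) ε := by
    intro M
    induction M with
    | zero =>
      intro ε hε
      refine Eventually.of_forall fun n G hG hG1 => ?_
      simpa [ha0] using hε.le
    | succ M ih =>
      intro ε hε
      filter_upwards [ih (ε / 2) (half_pos hε),
        h.eventually_blockDev (hz M).1 (hz M).2 hs (hL M) (half_pos hε)] with n h1 h2
      have hnn : 0 ≤ s * ∑ b ∈ Finset.range M, exponent β (z b) :=
        mul_nonneg hs.le (Finset.sum_nonneg fun b _ => (h.exponent_mem (hz b).1 (hz b).2).1)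
      have h3 := h1.comp h.preserving.measurable h2
        (by rw [abs_of_nonneg (Real.exp_nonneg _)]; exact Real.exp_le_one_iff.2 (neg_nonpos.2 hnn))
        (measurable_pow_visits h.preserving.measurable (h.measurableSet n) _ _)
        (pow_visits_mem (hz M).1 (hz M).2.le _)
      rw [← Real.exp_add, add_halves, Nat.add_sub_cancel' (hmono n (Nat.le_succ M))] at h3
      simp only [Finset.prod_range_succ, Finset.sum_range_succ]
      convert h3 using 2
      ring
  rw [Metric.tendsto_nhds]
  intro ε hε
  filter_upwards [key M (ε / 2) (half_pos hε)] with n hn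
  have := hn (fun _ => 1) measurable_const fun _ => ⟨zero_le_one, le_rfl⟩
  rw [Real.dist_eq]
  simp only [mul_one, integral_const, probReal_univ, smul_eq_mul] at this
  linarith

end RareSets

end Asymptotics

/-! ### From generating functions to the law of a vector of counts -/

section Generating

variable {Ω Ω' : Type*} [MeasurableSpace Ω] {P : Measure Ω} [IsProbabilityMeasure P]
  [MeasurableSpace Ω'] {P' : Measure Ω'} [IsProbabilityMeasure P']

theorem abs_integral_mul_pow_sub_le {Y : Ω → ℝ} {N : Ω → ℕ} (hY : Measurable Y)
    (hY1 : ∀ w, 0 ≤ Y w ∧ Y w ≤ 1) (hN : Measurable N) {z : ℝ} (h0 : 0 ≤ z) (h1 : z ≤ 1) (c : ℕ) :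
    |(∫ w, Y w * z ^ N w ∂P) - ∑ j ∈ Finset.range (c + 1),
      z ^ j * ∫ w, Y w * (if N w = j then 1 else 0) ∂P| ≤ z ^ (c + 1) := by
  have hind : ∀ j, Measurable fun w => Y w * (if N w = j then (1 : ℝ) else 0) := fun j =>
    hY.mul (Measurable.ite (hN (measurableSet_singleton j)) measurable_const measurable_const)
  have hind1 : ∀ j w, 0 ≤ Y w * (if N w = j then (1 : ℝ) else 0) ∧
      Y w * (if N w = j then (1 : ℝ) else 0) ≤ 1 := fun j w => by
    split_ifs <;> simp [hY1 w]
  have i1 : Integrable (fun w => Y w * z ^ N w) P := integrable_of_mem_Icc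
    (hY.mul ((measurable_from_nat (f := fun n => z ^ n)).comp hN)) fun w =>
      ⟨mul_nonneg (hY1 w).1 (pow_nonneg h0 _),
        mul_le_one₀ (hY1 w).2 (pow_nonneg h0 _) (pow_le_one₀ h0 h1)⟩
  have i2 : ∀ j, Integrable (fun w => z ^ j * (Y w * (if N w = j then (1 : ℝ) else 0))) P := fun j =>
    (integrable_of_mem_Icc (hind j) (hind1 j)).const_mul _
  have i3 : Integrable (fun w => ∑ j ∈ Finset.range (c + 1),
      z ^ j * (Y w * (if N w = j then (1 : ℝ) else 0))) P :=
    integrable_finsetSum _ fun j _ => i2 j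
  have e : ∑ j ∈ Finset.range (c + 1), z ^ j * ∫ w, Y w * (if N w = j then 1 else 0) ∂P =
      ∫ w, ∑ j ∈ Finset.range (c + 1), z ^ j * (Y w * (if N w = j then (1 : ℝ) else 0)) ∂P := by
    rw [integral_finsetSum _ fun j _ => i2 j]
    simp only [integral_const_mul]
  have hpt : ∀ w, |Y w * z ^ N w - ∑ j ∈ Finset.range (c + 1),
      z ^ j * (Y w * (if N w = j then (1 : ℝ) else 0))| ≤ z ^ (c + 1) := by
    intro w
    by_cases hc : N w < c + 1
    · rw [Finset.sum_eq_single (N w)]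
      · simp only [if_true, mul_one, mul_comm, sub_self, abs_zero]
        exact pow_nonneg h0 _
      · intro j _ hj; rw [if_neg (Ne.symm hj), mul_zero, mul_zero]
      · intro h; exact absurd (Finset.mem_range.2 hc) h
    · rw [Finset.sum_eq_zero]
      · rw [sub_zero, abs_mul, abs_of_nonneg (hY1 w).1, abs_of_nonneg (pow_nonneg h0 _)]
        exact (mul_le_of_le_one_left (pow_nonneg h0 _) (hY1 w).2).trans
          (pow_le_pow_of_le_one h0 h1 (by omega))
      · intro j hj
        rw [Finset.mem_range] at hj
        rw [if_neg (by omega), mul_zero, mul_zero]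
  rw [e, ← integral_sub i1 i3]
  refine abs_integral_le_integral_abs.trans ((integral_mono (i1.sub i3).abs
    (integrable_const _) hpt).trans ?_)
  simp

/-- The coefficients are recovered in order: after subtracting those below c and dividing by z^c,
the remainder of the generating function is at most z, which can be fixed as small as desired. -/
theorem tendsto_integral_of_generating {Y : ℕ → Ω → ℝ} {N : ℕ → Ω → ℕ} {Y' : Ω' → ℝ} {N' : Ω' → ℕ}
    (hY : ∀ n, Measurable (Y n)) (hY1 : ∀ n w, 0 ≤ Y n w ∧ Y n w ≤ 1) (hN : ∀ n, Measurable (N n))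
    (hY' : Measurable Y') (hY1' : ∀ w, 0 ≤ Y' w ∧ Y' w ≤ 1) (hN' : Measurable N')
    (h : ∀ z : ℝ, 0 < z → z < 1 → Tendsto (fun n => ∫ w, Y n w * z ^ N n w ∂P) atTop
      (𝓝 (∫ w, Y' w * z ^ N' w ∂P'))) (c : ℕ) :
    Tendsto (fun n => ∫ w, Y n w * (if N n w = c then 1 else 0) ∂P) atTop
      (𝓝 (∫ w, Y' w * (if N' w = c then 1 else 0) ∂P')) := by
  induction c using Nat.strong_induction_on with
  | _ c ih =>
    rw [Metric.tendsto_nhds]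
    intro ε hε
    -- Both truncation errors and the error of the limit are then at most ε / 4 each.
    set z : ℝ := min (1 / 2) (ε / 4)
    have hz0 : 0 < z := lt_min (by norm_num) (by positivity)
    have hz1 : z < 1 := (min_le_left _ _).trans_lt (by norm_num)
    have hzε : z ≤ ε / 4 := min_le_right _ _
    have hzc : 0 < z ^ c := pow_pos hz0 c
    have hlim : Tendsto (fun n => ((∫ w, Y n w * z ^ N n w ∂P) - ∑ j ∈ Finset.range c,
        z ^ j * ∫ w, Y n w * (if N n w = j then 1 else 0) ∂P) / z ^ c) atTop
        (𝓝 (((∫ w, Y' w * z ^ N' w ∂P') - ∑ j ∈ Finset.range c,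
        z ^ j * ∫ w, Y' w * (if N' w = j then 1 else 0) ∂P') / z ^ c)) :=
      ((h z hz0 hz1).sub (tendsto_finsetSum _ fun j hj =>
        (ih j (Finset.mem_range.1 hj)).const_mul _)).div_const _
    have aux : ∀ {A S a : ℝ}, |A - (S + z ^ c * a)| ≤ z ^ (c + 1) → |(A - S) / z ^ c - a| ≤ z := by
      intro A S a h
      have e : (A - S) / z ^ c - a = (A - (S + z ^ c * a)) / z ^ c := by field_simp; ring
      rw [e, abs_div, abs_of_pos hzc, div_le_iff₀ hzc]
      rw [mul_comm z, ← pow_succ]; exact h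
    have hb' := abs_integral_mul_pow_sub_le (P := P') hY' hY1' hN' hz0.le hz1.le c
    rw [Finset.sum_range_succ] at hb'
    filter_upwards [(Metric.tendsto_nhds.1 hlim) (ε / 4) (by positivity)] with n hn
    have hb := abs_integral_mul_pow_sub_le (P := P) (hY n) (hY1 n) (hN n) hz0.le hz1.le c
    rw [Finset.sum_range_succ] at hb
    have k1 := aux hb
    have k2 := aux hb'
    rw [Real.dist_eq] at hn ⊢
    rw [abs_le] at k1 k2
    rw [abs_lt] at hn ⊢
    constructor <;> linarith

omit [IsProbabilityMeasure P] in
theorem integral_prod_ite {M : ℕ} {N : Ω → ℕ → ℕ} (hN : ∀ b, Measurable fun w => N w b)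
    (c : ℕ → ℕ) : ∫ w, ∏ b ∈ Finset.range M, (if N w b = c b then (1 : ℝ) else 0) ∂P =
      P.real {w | ∀ b < M, N w b = c b} := by
  have hm : MeasurableSet {w | ∀ b < M, N w b = c b} := by
    have : {w | ∀ b < M, N w b = c b} =
        ⋂ b ∈ Finset.range M, (fun w => N w b) ⁻¹' {c b} := by ext; simp
    rw [this]
    exact Finset.measurableSet_biInter _ fun b _ => hN b (measurableSet_singleton _)
  rw [← integral_ind hm]
  congr 1
  ext w
  rw [Finset.prod_ite_zero]
  simp [Set.indicator_apply]

/-- The factors z_b^N_b are replaced by the events N_b = c_b one coordinate at a time, the remaining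
product serving as a bounded weight. -/
theorem tendsto_measure_counts {M : ℕ} {N : ℕ → Ω → ℕ → ℕ} {N' : Ω' → ℕ → ℕ}
    (hN : ∀ n b, Measurable fun w => N n w b) (hN' : ∀ b, Measurable fun w => N' w b)
    (h : ∀ z : ℕ → ℝ, (∀ b, 0 < z b ∧ z b < 1) →
      Tendsto (fun n => ∫ w, ∏ b ∈ Finset.range M, z b ^ N n w b ∂P) atTop
        (𝓝 (∫ w, ∏ b ∈ Finset.range M, z b ^ N' w b ∂P'))) (c : ℕ → ℕ) :
    Tendsto (fun n => P.real {w | ∀ b < M, N n w b = c b}) atTop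
      (𝓝 (P'.real {w | ∀ b < M, N' w b = c b})) := by
  let g : (ℕ → ℝ) → ℕ → (ℕ → ℕ) → ℕ → ℝ := fun z m v b =>
    if b < m then (if v b = c b then 1 else 0) else z b ^ v b
  have hg1 : ∀ z : ℕ → ℝ, (∀ b, 0 < z b ∧ z b < 1) → ∀ m v b, 0 ≤ g z m v b ∧ g z m v b ≤ 1 := by
    intro z hz m v b
    simp only [g]
    split_ifs
    · simp
    · simp
    · exact ⟨pow_nonneg (hz b).1.le _, pow_le_one₀ (hz b).1.le (hz b).2.le⟩
  have hgm : ∀ (z : ℕ → ℝ) (m b : ℕ), Measurable fun k : ℕ =>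
      (if b < m then (if k = c b then (1 : ℝ) else 0) else z b ^ k) := fun z m b =>
    measurable_from_nat
  have key : ∀ m ≤ M, ∀ z : ℕ → ℝ, (∀ b, 0 < z b ∧ z b < 1) →
      Tendsto (fun n => ∫ w, ∏ b ∈ Finset.range M, g z m (N n w) b ∂P) atTop
        (𝓝 (∫ w, ∏ b ∈ Finset.range M, g z m (N' w) b ∂P')) := by
    intro m
    induction m with
    | zero => intro _ z hz; simpa [g] using h z hz
    | succ m ih =>
      intro hm z hz
      have hmM : m ∈ Finset.range M := Finset.mem_range.2 hm
      let R : (ℕ → ℕ) → ℝ := fun v => ∏ b ∈ (Finset.range M).erase m, g z m v b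
      have hR1 : ∀ v, 0 ≤ R v ∧ R v ≤ 1 := fun v =>
        ⟨Finset.prod_nonneg fun b _ => (hg1 z hz m v b).1,
          Finset.prod_le_one (fun b _ => (hg1 z hz m v b).1) fun b _ => (hg1 z hz m v b).2⟩
      have hgoal : ∀ v, ∏ b ∈ Finset.range M, g z (m + 1) v b =
          R v * (if v m = c m then 1 else 0) := by
        intro v
        rw [← Finset.mul_prod_erase _ _ hmM, mul_comm]
        congr 1
        · refine Finset.prod_congr rfl fun b hb => ?_
          have hbm := Finset.ne_of_mem_erase hb
          have : b < m + 1 ↔ b < m := by omega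
          simp only [g, this]
        · simp [g]
      have hprev : ∀ t : ℝ, ∀ v, ∏ b ∈ Finset.range M, g (Function.update z m t) m v b =
          R v * t ^ v m := by
        intro t v
        rw [← Finset.mul_prod_erase _ _ hmM, mul_comm]
        congr 1
        · refine Finset.prod_congr rfl fun b hb => ?_
          simp only [g, Function.update_of_ne (Finset.ne_of_mem_erase hb)]
        · simp [g]
      have hRm : ∀ n, Measurable fun w => R (N n w) := fun n =>
        Finset.measurable_fun_prod _ fun b _ => (hgm z m b).comp (hN n b)
      have hRm' : Measurable fun w => R (N' w) :=
        Finset.measurable_fun_prod _ fun b _ => (hgm z m b).comp (hN' b)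
      simp only [hgoal]
      refine tendsto_integral_of_generating hRm (fun n w => hR1 _) (fun n => hN n m) hRm'
        (fun w => hR1 _) (hN' m) (fun t ht0 ht1 => ?_) (c m)
      have := ih (by omega) (Function.update z m t) (fun b => by
        by_cases hb : b = m
        · subst hb; simp [ht0, ht1]
        · rw [Function.update_of_ne hb]; exact hz b)
      simpa only [hprev] using this
  have hfin := key M le_rfl (fun _ => 1 / 2) (fun _ => by norm_num)
  have hprod : ∀ v : ℕ → ℕ, ∏ b ∈ Finset.range M, g (fun _ => 1 / 2) M v b =
      ∏ b ∈ Finset.range M, if v b = c b then (1 : ℝ) else 0 := fun v =>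
    Finset.prod_congr rfl fun b hb => by simp only [g, Finset.mem_range.1 hb, if_true]
  simp only [hprod] at hfin
  rw [integral_prod_ite hN' c] at hfin
  exact hfin.congr fun n => integral_prod_ite (hN n) c

end Generating

/-! ### Convergence in distribution of point processes on `[0, ∞)` -/

section Cells

/-- The number of the cell of mesh `1 / (k + 1)` that contains `x`: the cells are `[0, h]` and
`(b h, (b + 1) h]` for `b ≥ 1`. -/
def cellIdx (k : ℕ) (x : ℝ≥0) : ℕ := ⌈x * (k + 1)⌉₊ - 1

/-- The cell number `b` of mesh `1 / (k + 1)`. -/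
def cell (k b : ℕ) : Set ℝ≥0 := cellIdx k ⁻¹' {b}

theorem measurable_cellIdx (k : ℕ) : Measurable (cellIdx k) :=
  (measurable_from_nat (f := fun n => n - 1)).comp
    (Nat.measurable_ceil.comp (measurable_id.mul_const _))

theorem measurableSet_cell (k b : ℕ) : MeasurableSet (cell k b) :=
  measurable_cellIdx k (measurableSet_singleton b)

theorem cellIdx_lt_iff {k M : ℕ} (hM : 0 < M) (x : ℝ≥0) :
    cellIdx k x < M ↔ x * (k + 1) ≤ M := by
  rw [cellIdx, ← Nat.ceil_le]; omega

theorem iUnion_cell (k : ℕ) {M : ℕ} (hM : 0 < M) :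
    ⋃ b ∈ Finset.range (M * (k + 1)), cell k b = Iic (M : ℝ≥0) := by
  ext x
  have : (0 : ℝ≥0) < (k : ℝ≥0) + 1 := by positivity
  simp only [cell, mem_iUnion, Finset.mem_range, mem_preimage, mem_singleton_iff, exists_prop,
    exists_eq_right', mem_Iic]
  rw [cellIdx_lt_iff (by positivity)]
  push_cast
  exact mul_le_mul_iff_left₀ this

theorem pairwiseDisjoint_cell (k : ℕ) (s : Set ℕ) : s.PairwiseDisjoint (cell k) :=
  fun _ _ _ _ h => Disjoint.preimage _ (by simpa using h)

theorem dist_le_of_mem_cell {k b : ℕ} {x : ℝ≥0} (hx : x ∈ cell k b) :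
    dist x (((b : ℝ≥0) + 1) / (k + 1)) ≤ 1 / (k + 1) := by
  have hk : (0 : ℝ) < (k : ℝ) + 1 := by positivity
  have h1 : x * (k + 1) ≤ ((b + 1 : ℕ) : ℝ≥0) :=
    (cellIdx_lt_iff (Nat.succ_pos b) x).1 (Nat.lt_succ_iff.2 (le_of_eq hx))
  have h1' : (x : ℝ) * (k + 1) ≤ b + 1 := by exact_mod_cast h1
  have h2 : (b : ℝ) ≤ x * (k + 1) := by
    rcases Nat.eq_zero_or_pos b with rfl | hb
    · simp only [Nat.cast_zero]; positivity
    · have := (cellIdx_lt_iff hb x).not.1 (not_lt.2 (ge_of_eq hx))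
      exact_mod_cast (not_le.1 this).le
  rw [NNReal.dist_eq]
  push_cast
  have e : (x : ℝ) - ((b : ℝ) + 1) / (k + 1) = (x * (k + 1) - (b + 1)) / (k + 1) := by
    field_simp
  rw [e, abs_div, abs_of_pos hk]
  refine div_le_div_of_nonneg_right ?_ hk.le
  rw [abs_le]; constructor <;> linarith

theorem IsCounting.measure_Iic_lt_top {ν : Measure ℝ≥0} (hν : IsCounting ν) (M : ℝ≥0) :
    ν (Iic M) < ⊤ := by
  rw [← Icc_bot]; exact hν.1 _ isCompact_Icc

theorem cell_subset_Iic (k b : ℕ) : cell k b ⊆ Iic ((b + 1 : ℕ) : ℝ≥0) := by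
  rw [← iUnion_cell k (Nat.succ_pos b)]
  refine subset_biUnion_of_mem (u := cell k) (Finset.mem_range.2 ?_)
  nlinarith

theorem IsCounting.measure_cell_lt_top {ν : Measure ℝ≥0} (hν : IsCounting ν) (k b : ℕ) :
    ν (cell k b) < ⊤ :=
  (measure_mono (cell_subset_Iic k b)).trans_lt (hν.measure_Iic_lt_top _)

/-- The number of points in a cell. -/
def cellCount (k b : ℕ) (ν : CountingMeasure) : ℕ := ⌊(ν.1 (cell k b)).toReal⌋₊

theorem cellCount_eq {k b c : ℕ} {ν : CountingMeasure} (h : ν.1 (cell k b) = c) :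
    cellCount k b ν = c := by
  simp [cellCount, h]

theorem measure_cell (k b : ℕ) (ν : CountingMeasure) : ν.1 (cell k b) = cellCount k b ν := by
  obtain ⟨c, hc⟩ := (ν.2.2 _ (measurableSet_cell k b)).resolve_left
    (ν.2.measure_cell_lt_top k b).ne
  rw [cellCount_eq hc, hc]

theorem abs_integral_sub_sum_le {ν : Measure ℝ≥0} (hν : IsCounting ν) {ψ : ℝ≥0 → ℝ}
    (hψ : Continuous ψ) {M : ℕ} (hM : 0 < M) (hsupp : ∀ x, x ∉ Iic (M : ℝ≥0) → ψ x = 0) (k : ℕ)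
    {e : ℝ} (he : ∀ b, ∀ x ∈ cell k b, |ψ x - ψ (((b : ℝ≥0) + 1) / (k + 1))| ≤ e) :
    |(∫ x, ψ x ∂ν) - ∑ b ∈ Finset.range (M * (k + 1)),
      ψ (((b : ℝ≥0) + 1) / (k + 1)) * ν.real (cell k b)| ≤ e * ν.real (Iic (M : ℝ≥0)) := by
  have hint : IntegrableOn ψ (Iic (M : ℝ≥0)) ν := by
    have : Fact (ν (Iic (M : ℝ≥0)) < ⊤) := ⟨hν.measure_Iic_lt_top _⟩
    obtain ⟨C, hC⟩ := (isCompact_Icc (a := (⊥ : ℝ≥0)) (b := M)).exists_bound_of_continuousOn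
      hψ.continuousOn
    rw [Icc_bot] at hC
    exact Measure.integrableOn_of_bounded (hν.measure_Iic_lt_top _).ne hψ.aestronglyMeasurable
      (M := C) ((ae_restrict_iff' measurableSet_Iic).2 (Eventually.of_forall hC))
  have hsub : ∀ b ∈ Finset.range (M * (k + 1)), cell k b ⊆ Iic (M : ℝ≥0) := fun b hb => by
    rw [← iUnion_cell k hM]
    exact subset_biUnion_of_mem (u := cell k) hb
  have hreal : ν.real (Iic (M : ℝ≥0)) = ∑ b ∈ Finset.range (M * (k + 1)), ν.real (cell k b) := by
    rw [← iUnion_cell k hM, measureReal_biUnion_finset (pairwiseDisjoint_cell k _)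
      (fun b _ => measurableSet_cell k b) (fun b _ => (hν.measure_cell_lt_top k b).ne)]
  rw [← setIntegral_eq_integral_of_forall_compl_eq_zero hsupp, hreal, ← iUnion_cell k hM,
    integral_biUnion_finset _ (fun b _ => measurableSet_cell k b) (pairwiseDisjoint_cell k _)
      (fun b hb => hint.mono_set (hsub b hb)), ← Finset.sum_sub_distrib, Finset.mul_sum]
  refine (Finset.abs_sum_le_sum_abs _ _).trans (Finset.sum_le_sum fun b hb => ?_)
  have hfin := hν.measure_cell_lt_top k b
  have hc : IntegrableOn (fun _ => ψ (((b : ℝ≥0) + 1) / (k + 1))) (cell k b) ν :=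
    integrableOn_const hfin.ne
  have e1 : (∫ x in cell k b, ψ x ∂ν) - ψ (((b : ℝ≥0) + 1) / (k + 1)) * ν.real (cell k b) =
      ∫ x in cell k b, (ψ x - ψ (((b : ℝ≥0) + 1) / (k + 1))) ∂ν := by
    rw [integral_sub (hint.mono_set (hsub b hb)) hc, setIntegral_const, smul_eq_mul, mul_comm]
  rw [e1, ← Real.norm_eq_abs]
  exact norm_setIntegral_le_of_norm_le_const hfin fun x hx => he b x hx

/-- Counting measures with the same numbers of points as `ν` in finer and finer cells converge
vaguely to `ν`. -/
theorem tendsto_of_cellCount_eq {ν : CountingMeasure} {ν' : ℕ → CountingMeasure}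
    (h : ∀ k, ∀ b < (k + 1) * (k + 1), cellCount k b (ν' k) = cellCount k b ν) :
    Tendsto ν' atTop (𝓝 ν) := by
  rw [Topology.IsInducing.tendsto_nhds_iff (Topology.IsInducing.mk rfl), tendsto_pi_nhds]
  intro ψ
  change Tendsto (fun k => ∫ t, ψ t ∂(ν' k).1) atTop (𝓝 (∫ t, ψ t ∂ν.1))
  have hcs : HasCompactSupport ψ := ψ.hasCompactSupport
  obtain ⟨B, hB⟩ := hcs.isCompact.bddAbove
  obtain ⟨M, hM⟩ := exists_nat_gt B
  have hM0 : 0 < M := by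
    rcases Nat.eq_zero_or_pos M with rfl | h0
    · simp at hM
    · exact h0
  have hsupp : ∀ x, x ∉ Iic (M : ℝ≥0) → ψ x = 0 := by
    intro x hx
    by_contra hne
    exact hx ((hB (subset_tsupport _ hne)).trans hM.le)
  have huc : UniformContinuous ψ := hcs.uniformContinuous_of_continuous ψ.continuous
  rw [Metric.tendsto_atTop]
  intro ε hε
  set V := ν.1.real (Iic (M : ℝ≥0)) with hV
  have hV0 : 0 ≤ V := measureReal_nonneg
  set e := ε / (2 * (V + 1))
  have he0 : 0 < e := by positivity
  obtain ⟨δ, hδ, hδe⟩ := Metric.uniformContinuous_iff.1 huc e he0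
  obtain ⟨K, hK⟩ := exists_nat_one_div_lt hδ
  refine ⟨max K M, fun k hk => ?_⟩
  have hkK : K ≤ k := (le_max_left _ _).trans hk
  have hkM : M ≤ k := (le_max_right _ _).trans hk
  have hosc : ∀ b, ∀ x ∈ cell k b, |ψ x - ψ (((b : ℝ≥0) + 1) / (k + 1))| ≤ e := by
    intro b x hx
    have h1 : (1 : ℝ) / (k + 1) ≤ 1 / (K + 1) := by
      refine one_div_le_one_div_of_le (by positivity) ?_
      exact_mod_cast Nat.succ_le_succ hkK
    exact (hδe ((dist_le_of_mem_cell hx).trans_lt (h1.trans_lt hK))).le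
  have hreal : ∀ b ∈ Finset.range (M * (k + 1)), (ν' k).1.real (cell k b) = ν.1.real (cell k b) := by
    intro b hb
    have hb' : b < (k + 1) * (k + 1) :=
      (Finset.mem_range.1 hb).trans_le (Nat.mul_le_mul_right _ (by omega))
    rw [measureReal_def, measureReal_def, measure_cell, measure_cell, h k b hb']
  have hIic : (ν' k).1.real (Iic (M : ℝ≥0)) = V := by
    have : ∀ ν : CountingMeasure, ν.1.real (Iic (M : ℝ≥0)) =
        ∑ b ∈ Finset.range (M * (k + 1)), ν.1.real (cell k b) := fun ν => by
      rw [← iUnion_cell k hM0, measureReal_biUnion_finset (pairwiseDisjoint_cell k _)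
        (fun b _ => measurableSet_cell k b) (fun b _ => (ν.2.measure_cell_lt_top k b).ne)]
    rw [hV, this, this]
    exact Finset.sum_congr rfl hreal
  have k1 := abs_integral_sub_sum_le (ν' k).2 ψ.continuous hM0 hsupp k hosc
  have k2 := abs_integral_sub_sum_le ν.2 ψ.continuous hM0 hsupp k hosc
  rw [hIic, Finset.sum_congr rfl fun b hb => by rw [hreal b hb]] at k1
  rw [← hV] at k2
  rw [Real.dist_eq]
  have hsmall : e * V + e * V < ε := by
    have : e * (2 * (V + 1)) = ε := by simp only [e]; field_simp
    nlinarith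
  rw [abs_sub_comm] at k2
  exact (abs_sub_le _ _ _).trans_lt ((add_le_add k1 k2).trans_lt hsmall)

/-- The counting measures all of whose neighbours at scale `k` belong to `G`. -/
def cellInterior (G : Set CountingMeasure) (k : ℕ) : Set CountingMeasure :=
  {ν | ∀ ν', (∀ b < (k + 1) * (k + 1), cellCount k b ν' = cellCount k b ν) → ν' ∈ G}

theorem cellInterior_subset (G : Set CountingMeasure) (k : ℕ) : cellInterior G k ⊆ G :=
  fun ν hν => hν ν fun _ _ => rfl

/-- Otherwise, at infinitely many scales, there would be a measure outside G with the same cell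
counts as ν; such measures converge vaguely to ν, against openness. -/
theorem eventually_mem_cellInterior {G : Set CountingMeasure} (hG : IsOpen G) {ν : CountingMeasure}
    (hν : ν ∈ G) : ∀ᶠ k in atTop, ν ∈ cellInterior G k := by
  classical
  by_contra hfreq
  have hex : ∀ k, ∃ ν' : CountingMeasure,
      (∀ b < (k + 1) * (k + 1), cellCount k b ν' = cellCount k b ν) ∧
        (ν ∉ cellInterior G k → ν' ∉ G) := by
    intro k
    by_cases hk : ν ∈ cellInterior G k
    · exact ⟨ν, fun _ _ => rfl, fun h => absurd hk h⟩
    · have hk' := hk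
      simp only [cellInterior, mem_ofPred_eq, not_forall] at hk'
      obtain ⟨ν', h1, h2⟩ := hk'
      exact ⟨ν', h1, fun _ => h2⟩
  choose ν' h1 h2 using hex
  have := (tendsto_of_cellCount_eq h1).eventually (hG.mem_nhds hν)
  exact hfreq (this.mono fun k hk => by_contra fun h => h2 k h hk)

/-! ### Open sets of counting measures approximated by events on finitely many cell counts. -/

section Portmanteau

variable {Ω Ω' : Type*} [MeasurableSpace Ω] {P : Measure Ω} [IsProbabilityMeasure P]
  [MeasurableSpace Ω'] {P' : Measure Ω'} [IsProbabilityMeasure P']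

/-- The vector of the numbers of points in the cells of scale `k`. -/
def cellVector (k : ℕ) (ν : CountingMeasure) : Fin ((k + 1) * (k + 1)) → ℕ :=
  fun b => cellCount k b ν

/-- Membership depends only on the finite vector of counts, which has countably many values. This
yields measurability without knowing anything about G. -/
theorem preimage_cellInterior (G : Set CountingMeasure) (k : ℕ) :
    cellInterior G k = cellVector k ⁻¹' (cellVector k '' cellInterior G k) := by
  refine subset_antisymm (subset_preimage_image _ _) ?_
  rintro ν ⟨ν₁, h1, h2⟩ ν' hν'
  refine h1 ν' fun b hb => ?_
  rw [hν' b hb]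
  exact (congr_fun h2 ⟨b, hb⟩).symm

theorem measurable_cellVector {Y : Ω → CountingMeasure}
    (hY : ∀ k b, Measurable fun w => cellCount k b (Y w)) (k : ℕ) :
    Measurable fun w => cellVector k (Y w) :=
  measurable_pi_iff.2 fun b => hY k b

theorem measurableSet_preimage_cellInterior {Y : Ω → CountingMeasure}
    (hY : ∀ k b, Measurable fun w => cellCount k b (Y w)) (G : Set CountingMeasure) (k : ℕ) :
    MeasurableSet (Y ⁻¹' cellInterior G k) := by
  rw [preimage_cellInterior]
  exact measurable_cellVector hY k (Set.to_countable _).measurableSet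

theorem measurable_of_cellCount {Y : Ω → CountingMeasure}
    (hY : ∀ k b, Measurable fun w => cellCount k b (Y w)) : Measurable Y := by
  refine measurable_of_isOpen fun G hG => ?_
  have : Y ⁻¹' G = ⋃ k, Y ⁻¹' cellInterior G k := by
    rw [← preimage_iUnion]
    congr 1
    refine subset_antisymm (fun ν hν => ?_) (iUnion_subset fun k => cellInterior_subset G k)
    exact mem_iUnion.2 (eventually_mem_cellInterior hG hν).exists
  rw [this]
  exact MeasurableSet.iUnion fun k => measurableSet_preimage_cellInterior hY G k

/-- Point processes on `[0, ∞)` converge in distribution when the joint laws of the numbers of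
points in the cells of all meshes `1 / (k + 1)` converge. -/
theorem tendstoInDistribution_of_cellCount {Y : ℕ → Ω → CountingMeasure} {Z : Ω' → CountingMeasure}
    (hY : ∀ n k b, Measurable fun w => cellCount k b (Y n w))
    (hZ : ∀ k b, Measurable fun w => cellCount k b (Z w))
    (hlim : ∀ k, ∀ c : ℕ → ℕ, Tendsto
      (fun n => P.real {w | ∀ b < (k + 1) * (k + 1), cellCount k b (Y n w) = c b}) atTop
      (𝓝 (P'.real {w | ∀ b < (k + 1) * (k + 1), cellCount k b (Z w) = c b}))) :
    TendstoInDistribution Y atTop Z (fun _ => P) P' := by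
  have hYm := fun n => measurable_of_cellCount (hY n)
  have hZm := measurable_of_cellCount hZ
  refine ⟨fun n => (hYm n).aemeasurable, hZm.aemeasurable, ?_⟩
  refine tendsto_of_forall_isOpen_le_liminf' fun G hG => ?_
  simp only [ProbabilityMeasure.coe_mk]
  have hmap : (fun n => (Measure.map (Y n) P) G) = fun n => P (Y n ⁻¹' G) :=
    funext fun n => Measure.map_apply (hYm n) hG.measurableSet
  rw [Measure.map_apply hZm hG.measurableSet]
  change _ ≤ liminf (fun n => (Measure.map (Y n) P) G) atTop
  rw [hmap]
  have hvec : ∀ k (v : Fin ((k + 1) * (k + 1)) → ℕ), Tendsto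
      (fun n => P ((fun w => cellVector k (Y n w)) ⁻¹' {v})) atTop
      (𝓝 (P' ((fun w => cellVector k (Z w)) ⁻¹' {v}))) := by
    intro k v
    have := hlim k fun b => if hb : b < (k + 1) * (k + 1) then v ⟨b, hb⟩ else 0
    have e : ∀ ν : CountingMeasure, (∀ b < (k + 1) * (k + 1), cellCount k b ν =
        if hb : b < (k + 1) * (k + 1) then v ⟨b, hb⟩ else 0) ↔ cellVector k ν = v := by
      intro ν
      constructor
      · intro h; ext b; have := h b b.2; rw [dif_pos b.2] at this; exact this
      · rintro rfl b hb; rw [dif_pos hb]; rfl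
    simp only [e] at this
    have h2 := ENNReal.tendsto_ofReal this
    simp only [measureReal_def, ENNReal.ofReal_toReal (measure_ne_top _ _)] at h2
    exact h2
  -- The event is a countable disjoint union over count vectors. Finite partial sums pass to the
  -- limit and lie below the liminf.
  have hlevel : ∀ k, P' (Z ⁻¹' cellInterior G k) ≤ liminf (fun n => P (Y n ⁻¹' G)) atTop := by
    intro k
    set C := cellVector k '' cellInterior G k with hC
    have hmeas : P' (Z ⁻¹' cellInterior G k) =
        ∑' v : C, P' ((fun w => cellVector k (Z w)) ⁻¹' {v.1}) := by
      have : Z ⁻¹' cellInterior G k = (fun w => cellVector k (Z w)) ⁻¹' C := by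
        conv_lhs => rw [preimage_cellInterior]
        rfl
      rw [this, ← Measure.map_apply (measurable_cellVector hZ k) (Set.to_countable C).measurableSet]
      conv_lhs => rw [← biUnion_of_singleton C]
      rw [measure_biUnion (Set.to_countable C) (fun a _ b _ hab => by simpa using hab)
        (fun v _ => measurableSet_singleton v)]
      exact tsum_congr fun v =>
        Measure.map_apply (measurable_cellVector hZ k) (measurableSet_singleton _)
    rw [hmeas, ENNReal.tsum_eq_iSup_sum]
    refine iSup_le fun F => ?_
    have hF := tendsto_finsetSum F fun v _ => hvec k v.1
    rw [← hF.liminf_eq]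
    refine liminf_le_liminf (Eventually.of_forall fun n => ?_)
    have hdisj : (F : Set C).PairwiseDisjoint
        fun v => (fun w => cellVector k (Y n w)) ⁻¹' {v.1} := fun a _ b _ hab =>
      Disjoint.preimage _ (by simpa using fun h => hab (Subtype.ext h))
    change ∑ v ∈ F, P ((fun w => cellVector k (Y n w)) ⁻¹' {v.1}) ≤ P (Y n ⁻¹' G)
    rw [← measure_biUnion_finset hdisj fun v _ =>
      measurable_cellVector (hY n) k (measurableSet_singleton _)]
    refine measure_mono (iUnion₂_subset fun v _ w hw => ?_)
    refine cellInterior_subset G k ?_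
    rw [preimage_cellInterior]
    rw [mem_preimage, show cellVector k (Y n w) = v.1 from hw]
    exact v.2
  -- Monotonicity of the cell interiors in k is not used; the intersections over k ≥ K do increase
  -- with K.
  have hcover : Z ⁻¹' G ⊆ ⋃ K, ⋂ k ≥ K, Z ⁻¹' cellInterior G k := by
    intro w hw
    obtain ⟨K, hK⟩ := eventually_atTop.1 (eventually_mem_cellInterior hG hw)
    exact mem_iUnion.2 ⟨K, mem_iInter₂.2 hK⟩
  refine (measure_mono hcover).trans ?_
  have hmono : Monotone fun K => ⋂ k ≥ K, Z ⁻¹' cellInterior G k := fun K K' hKK =>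
    biInter_subset_biInter_left fun k hk => le_trans hKK hk
  rw [hmono.measure_iUnion]
  exact iSup_le fun K => (measure_mono (iInter₂_subset K le_rfl)).trans (hlevel K)

end Portmanteau

end Cells

/-! ### Sequences of independent variables -/

section Sequences

variable {α : Type*}

/-- The sequence `c, w 0, w 1, …`. -/
def consSeq (c : α) (w : ℕ → α) : ℕ → α
  | 0 => c
  | i + 1 => w i

variable [MeasurableSpace α]

theorem measurable_consSeq : Measurable fun v : α × (ℕ → α) => consSeq v.1 v.2 := by
  refine measurable_pi_iff.2 fun i => ?_
  cases i with
  | zero => exact measurable_fst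
  | succ i => exact (measurable_pi_apply i).comp measurable_snd

theorem measurePreserving_consSeq (ν : Measure α) [IsProbabilityMeasure ν] :
    MeasurePreserving (fun v : α × (ℕ → α) => consSeq v.1 v.2)
      (ν.prod (Measure.infinitePi fun _ => ν)) (Measure.infinitePi fun _ => ν) := by
  classical
  refine ⟨measurable_consSeq, Measure.eq_infinitePi _ fun s t ht => ?_⟩
  obtain ⟨n, hn⟩ := s.exists_nat_subset_range
  have hn' : s ⊆ Finset.range (n + 1) := hn.trans (Finset.range_mono n.le_succ)
  -- Padding the finite index set to an initial segment by whole factors makes the shift by one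
  -- coordinate act on ranges.
  set t' : ℕ → Set α := fun i => if i ∈ s then t i else univ with ht'
  have ht'm : ∀ i, MeasurableSet (t' i) := fun i => by
    simp only [t']; split_ifs; exacts [ht i, .univ]
  have e1 : Set.pi (s : Set ℕ) t = Set.pi (Finset.range (n + 1) : Set ℕ) t' := by
    ext w
    simp only [Set.mem_pi, Finset.mem_coe, t']
    constructor
    · intro h i _
      split_ifs with hi
      exacts [h i hi, mem_univ _]
    · intro h i hi
      simpa [hi] using h i (hn' hi)
  have e2 : ∏ i ∈ s, ν (t i) = ∏ i ∈ Finset.range (n + 1), ν (t' i) := by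
    rw [← Finset.prod_subset hn' fun i _ hi => by simp [t', hi]]
    exact Finset.prod_congr rfl fun i hi => by simp [t', hi]
  have e3 : (fun v : α × (ℕ → α) => consSeq v.1 v.2) ⁻¹' Set.pi (Finset.range (n + 1) : Set ℕ) t' =
      t' 0 ×ˢ Set.pi (Finset.range n : Set ℕ) fun i => t' (i + 1) := by
    ext v
    simp only [mem_preimage, Set.mem_pi, Finset.mem_coe, Finset.mem_range, mem_prod]
    constructor
    · intro h
      exact ⟨h 0 n.succ_pos, fun i hi => h (i + 1) (Nat.succ_lt_succ hi)⟩
    · rintro ⟨h0, h1⟩ i hi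
      cases i with
      | zero => exact h0
      | succ i => exact h1 i (Nat.lt_of_succ_lt_succ hi)
  rw [e1, e2, Measure.map_apply measurable_consSeq
    (MeasurableSet.pi (Set.to_countable _) fun i _ => ht'm i), e3, Measure.prod_prod,
    Measure.infinitePi_pi _ fun i _ => ht'm _, Finset.prod_range_succ', mul_comm]

theorem lintegral_infinitePi_consSeq (ν : Measure α) [IsProbabilityMeasure ν]
    {F : (ℕ → α) → ℝ≥0∞} (hF : Measurable F) :
    ∫⁻ w, F w ∂(Measure.infinitePi fun _ => ν) =
      ∫⁻ c, ∫⁻ w, F (consSeq c w) ∂(Measure.infinitePi fun _ => ν) ∂ν := by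
  rw [← (measurePreserving_consSeq ν).lintegral_comp hF]
  exact lintegral_prod _ (hF.comp measurable_consSeq).aemeasurable

theorem integral_infinitePi_consSeq (ν : Measure α) [IsProbabilityMeasure ν]
    {F : (ℕ → α) → ℝ} (hF : Measurable F) (hF1 : ∀ w, F w ∈ Icc (0 : ℝ) 1) :
    ∫ w, F w ∂(Measure.infinitePi fun _ => ν) =
      ∫ c, ∫ w, F (consSeq c w) ∂(Measure.infinitePi fun _ => ν) ∂ν := by
  have hm := measurePreserving_consSeq ν
  have e : ∫ w, F w ∂(Measure.infinitePi fun _ => ν) =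
      ∫ v, F (consSeq v.1 v.2) ∂(ν.prod (Measure.infinitePi fun _ => ν)) := by
    have := integral_map (μ := ν.prod (Measure.infinitePi fun _ => ν)) hm.measurable.aemeasurable
      (f := F) hF.aestronglyMeasurable
    rwa [hm.map_eq] at this
  rw [e, integral_prod]
  exact integrable_of_mem_Icc (hF.comp measurable_consSeq) fun v => hF1 _

end Sequences

/-! ### The exponential distribution -/

section Exponential

theorem ae_nonneg_expMeasure (θ : ℝ) : ∀ᵐ t ∂expMeasure θ, 0 ≤ t := by
  rw [expMeasure, gammaMeasure, ae_withDensity_iff (by exact (measurable_exponentialPDFReal θ).ennreal_ofReal)]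
  refine Eventually.of_forall fun t ht => ?_
  by_contra h
  exact ht (exponentialPDF_of_neg (not_le.1 h))

theorem integral_expMeasure {θ : ℝ} (hθ : 0 < θ) (h : ℝ → ℝ) :
    ∫ t, h t ∂expMeasure θ = ∫ t in Ioi (0 : ℝ), θ * Real.exp (-(θ * t)) * h t := by
  have hm : Measurable (exponentialPDF θ) := (measurable_exponentialPDFReal θ).ennreal_ofReal
  have e : expMeasure θ = volume.withDensity (exponentialPDF θ) := rfl
  rw [e, integral_withDensity_eq_integral_toReal_smul hm
    (Eventually.of_forall fun _ => ENNReal.ofReal_lt_top), ← integral_Ici_eq_integral_Ioi,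
    ← integral_indicator measurableSet_Ici]
  refine integral_congr_ae (Eventually.of_forall fun t => ?_)
  simp only [indicator, mem_Ici, smul_eq_mul]
  split_ifs with ht
  · rw [exponentialPDF_of_nonneg ht, ENNReal.toReal_ofReal (by positivity)]
  · rw [exponentialPDF_of_neg (not_le.1 ht)]; simp

/-- This Laplace transform value is the ratio of the geometric series that forces the arrival times
to infinity. -/
theorem lintegral_exp_neg_expMeasure_lt_one {θ : ℝ} (hθ : 0 < θ) :
    ∫⁻ t, ENNReal.ofReal (Real.exp (-t)) ∂expMeasure θ < 1 := by
  have := isProbabilityMeasure_expMeasure hθ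
  have hint : Integrable (fun t => Real.exp (-t)) (expMeasure θ) := by
    refine Integrable.of_bound (by fun_prop) 1 ?_
    filter_upwards [ae_nonneg_expMeasure θ] with t ht
    rw [Real.norm_eq_abs, Real.abs_exp]
    exact Real.exp_le_one_iff.2 (by linarith)
  rw [← ofReal_integral_eq_lintegral_ofReal hint (Eventually.of_forall fun t => (Real.exp_pos _).le),
    integral_expMeasure hθ]
  have e : ∀ t : ℝ, θ * Real.exp (-(θ * t)) * Real.exp (-t) = θ * Real.exp (-(θ + 1) * t) := by
    intro t
    rw [mul_assoc, ← Real.exp_add]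
    congr 2; ring
  simp only [e]
  rw [integral_const_mul, integral_exp_mul_Ioi (by linarith)]
  rw [← ENNReal.ofReal_one, ENNReal.ofReal_lt_ofReal_iff one_pos]
  have : θ * (-Real.exp (-(θ + 1) * 0) / -(θ + 1)) = θ / (θ + 1) := by
    simp only [mul_zero, Real.exp_zero]
    rw [neg_div_neg_eq]; ring
  rw [this, div_lt_one (by linarith)]
  linarith

/-- A function with `Λ' = κ` satisfies `∫_a^∞ (θ - κ) e^{Λ - θ x} dx = e^{Λ(a) - θ a}`. -/
theorem integral_exp_primitive {θ T : ℝ} (hθ : 0 < θ) {κ : ℝ → ℝ} (hκ : Measurable κ)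
    (hκ0 : ∀ x, κ x ∈ Icc 0 θ) (hκT : ∀ x, T < x → κ x = 0) (a : ℝ) :
    ∫ x in Ioi a, (θ - κ x) * Real.exp (∫ y in (0 : ℝ)..x, (κ y - θ)) =
      Real.exp (∫ y in (0 : ℝ)..a, (κ y - θ)) := by
  set Φ : ℝ → ℝ := fun x => ∫ y in (0 : ℝ)..x, (κ y - θ) with hΦ
  have hb : ∀ x, ‖κ x - θ‖ ≤ θ := fun x => by
    rw [Real.norm_eq_abs, abs_le]; constructor <;> linarith [(hκ0 x).1, (hκ0 x).2]
  have hint : ∀ a b, IntervalIntegrable (fun y => κ y - θ) volume a b := fun a b =>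
    (intervalIntegrable_const (c := θ)).mono_fun (hκ.sub_const θ).aestronglyMeasurable
      (Eventually.of_forall fun x => by simpa [abs_of_pos hθ] using hb x)
  have hloc : LocallyIntegrable (fun y => κ y - θ) volume := by
    refine (locallyIntegrable_const θ).mono (hκ.sub_const θ).aestronglyMeasurable
      (Eventually.of_forall fun x => by simpa [abs_of_pos hθ] using hb x)
  have hsub : ∀ x y, Φ y - Φ x = ∫ y in x..y, (κ y - θ) := fun x y =>
    intervalIntegral.integral_interval_sub_left (hint _ _) (hint _ _)
  have hlip : ∀ x y, |Φ y - Φ x| ≤ θ * |y - x| := fun x y => by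
    rw [hsub, ← Real.norm_eq_abs]
    exact intervalIntegral.norm_integral_le_of_norm_le_const fun t _ => hb t
  have hanti : Antitone Φ := fun x y hxy => by
    have : Φ y - Φ x ≤ 0 := by
      rw [hsub]
      rw [← neg_nonneg, ← intervalIntegral.integral_neg]
      exact intervalIntegral.integral_nonneg hxy fun t _ => by linarith [(hκ0 t).2]
    linarith
  have hΦc : Continuous Φ := intervalIntegral.continuous_primitive hint 0
  have hder := _root_.LocallyIntegrable.ae_hasDerivAt_integral hloc
  have hfin : ∀ b, a ≤ b → ∫ x in a..b, (θ - κ x) * Real.exp (Φ x) =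
      Real.exp (Φ a) - Real.exp (Φ b) := by
    intro b hab
    -- Since κ is merely measurable, the exponential of its primitive is differentiated only almost
    -- everywhere; Lipschitz continuity justifies integrating the derivative back.
    have hL : LipschitzOnWith (Real.exp (Φ a) * θ).toNNReal (fun x => Real.exp (Φ x)) (uIcc a b) := by
      refine LipschitzOnWith.of_dist_le_mul fun x hx y hy => ?_
      rw [uIcc_of_le hab] at hx hy
      rw [Real.coe_toNNReal _ (by positivity), Real.dist_eq, Real.dist_eq]
      have h1 := (convex_Iic (Φ a)).norm_image_sub_le_of_norm_deriv_le (f := Real.exp)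
        (C := Real.exp (Φ a)) (x := Φ y) (y := Φ x) (fun _ _ => Real.differentiableAt_exp)
        (fun v hv => by
          rw [Real.deriv_exp, Real.norm_eq_abs, Real.abs_exp]
          exact Real.exp_le_exp.2 hv) (hanti hy.1) (hanti hx.1)
      rw [Real.norm_eq_abs, Real.norm_eq_abs] at h1
      refine h1.trans ?_
      rw [mul_assoc]
      exact mul_le_mul_of_nonneg_left (hlip y x) (Real.exp_pos _).le
    have hac := hL.absolutelyContinuousOnInterval.integral_deriv_eq_sub
    have e : ∫ x in a..b, (θ - κ x) * Real.exp (Φ x) =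
        ∫ x in a..b, -deriv (fun x => Real.exp (Φ x)) x := by
      refine intervalIntegral.integral_congr_ae ?_
      filter_upwards [hder] with x hx _
      rw [((hx 0).exp).deriv]
      ring
    rw [e, intervalIntegral.integral_neg, hac]; ring
  -- Beyond T the exponent decreases linearly with slope -θ, because κ vanishes there.
  have hdecay : Tendsto (fun b => Real.exp (Φ b)) atTop (𝓝 0) := by
    refine Real.tendsto_exp_atBot.comp ?_
    have : ∀ᶠ b in atTop, Φ T + -(θ * (b - T)) = Φ b := by
      filter_upwards [eventually_ge_atTop T] with b hTb
      have : Φ b - Φ T = ∫ y in T..b, (-θ) := by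
        rw [hsub]
        refine intervalIntegral.integral_congr_ae (Eventually.of_forall fun x hx => ?_)
        rw [uIoc_of_le hTb] at hx
        rw [hκT x hx.1, zero_sub]
      rw [intervalIntegral.integral_const, smul_eq_mul] at this
      linarith
    refine Tendsto.congr' this ?_
    refine tendsto_atBot_add_const_left _ _ (tendsto_neg_atTop_atBot.comp ?_)
    exact (tendsto_atTop_add_const_right _ (-T) tendsto_id).const_mul_atTop hθ
  have hlim : Tendsto (fun b => ∫ x in a..b, (θ - κ x) * Real.exp (Φ x)) atTop
      (𝓝 (Real.exp (Φ a))) := by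
    have := (tendsto_const_nhds (x := Real.exp (Φ a))).sub hdecay
    rw [sub_zero] at this
    refine this.congr' ?_
    filter_upwards [eventually_ge_atTop a] with b hb
    exact (hfin b hb).symm
  have hmeas : Measurable fun x => (θ - κ x) * Real.exp (Φ x) :=
    (measurable_const.sub hκ).mul (Real.measurable_exp.comp hΦc.measurable)
  have hnn : ∀ x, 0 ≤ (θ - κ x) * Real.exp (Φ x) := fun x =>
    mul_nonneg (by linarith [(hκ0 x).2]) (Real.exp_pos _).le
  have hIoi : IntegrableOn (fun x => (θ - κ x) * Real.exp (Φ x)) (Ioi a) := by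
    refine integrableOn_Ioi_of_intervalIntegral_norm_tendsto (Real.exp (Φ a)) a (fun b => ?_)
      tendsto_id (hlim.congr fun b => ?_)
    · rcases le_total a b with hab | hab
      · refine Measure.integrableOn_of_bounded (M := θ * Real.exp (Φ a)) (by simp)
          hmeas.aestronglyMeasurable ?_
        refine (ae_restrict_iff' measurableSet_Ioc).2 (Eventually.of_forall fun x hx => ?_)
        rw [Real.norm_eq_abs, abs_of_nonneg (hnn x)]
        exact mul_le_mul (by linarith [(hκ0 x).1]) (Real.exp_le_exp.2 (hanti hx.1.le))
          (Real.exp_pos _).le hθ.le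
      · rw [id, Ioc_eq_empty (not_lt.2 hab)]; exact integrableOn_empty
    · exact intervalIntegral.integral_congr fun x _ => by
        rw [Real.norm_eq_abs, abs_of_nonneg (hnn x)]
  exact tendsto_nhds_unique (intervalIntegral_tendsto_integral_Ioi a hIoi tendsto_id) hlim

/-- The renewal equation for `e^Λ`, where `Λ' = κ = θ (1 - g)`. -/
theorem integral_expMeasure_renewal {θ T : ℝ} (hθ : 0 < θ) {κ : ℝ → ℝ} (hκ : Measurable κ)
    (hκ0 : ∀ x, κ x ∈ Icc 0 θ) (hκT : ∀ x, T < x → κ x = 0) (a : ℝ) :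
    ∫ t, (1 - κ (a + t) / θ) * Real.exp (∫ y in (0 : ℝ)..(a + t), κ y) ∂expMeasure θ =
      Real.exp (∫ y in (0 : ℝ)..a, κ y) := by
  have hint : ∀ x, IntervalIntegrable κ volume 0 x := fun x =>
    (intervalIntegrable_const (c := θ)).mono_fun hκ.aestronglyMeasurable
      (Eventually.of_forall fun x => by
        simpa [abs_of_pos hθ, abs_of_nonneg (hκ0 x).1] using (hκ0 x).2)
  have hΦ : ∀ x, ∫ y in (0 : ℝ)..x, (κ y - θ) = (∫ y in (0 : ℝ)..x, κ y) - θ * x := fun x => by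
    rw [intervalIntegral.integral_sub (hint x) intervalIntegrable_const,
      intervalIntegral.integral_const, smul_eq_mul, sub_zero, mul_comm x]
  have h := integral_exp_primitive hθ hκ hκ0 hκT a
  simp only [hΦ] at h
  rw [integral_expMeasure hθ]
  have e : ∀ t : ℝ, θ * Real.exp (-(θ * t)) *
      ((1 - κ (a + t) / θ) * Real.exp (∫ y in (0 : ℝ)..(a + t), κ y)) =
      Real.exp (θ * a) *
        ((θ - κ (a + t)) * Real.exp ((∫ y in (0 : ℝ)..(a + t), κ y) - θ * (a + t))) := by
    intro t
    rw [Real.exp_sub, mul_add, Real.exp_add, Real.exp_neg]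
    have := Real.exp_pos (θ * a)
    have := Real.exp_pos (θ * t)
    field_simp
  simp only [e]
  rw [integral_const_mul]
  have hshift : ∫ t in Ioi (0 : ℝ),
      (θ - κ (a + t)) * Real.exp ((∫ y in (0 : ℝ)..(a + t), κ y) - θ * (a + t)) =
      ∫ x in Ioi a, (θ - κ x) * Real.exp ((∫ y in (0 : ℝ)..x, κ y) - θ * x) := by
    have := (measurePreserving_add_left volume a).setIntegral_preimage_emb
      (measurableEmbedding_addLeft a)
      (fun x => (θ - κ x) * Real.exp ((∫ y in (0 : ℝ)..x, κ y) - θ * x)) (Ioi a)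
    rw [← this]
    congr 2
    ext t; simp
  rw [hshift, h, ← Real.exp_add]
  congr 1; ring

end Exponential

/-! ### Sums of point masses -/

section Atoms

/-- The measure with mass `c i` at `x i`. -/
def atoms (c : ℕ → ℕ) (x : ℕ → ℝ≥0) : Measure ℝ≥0 :=
  Measure.sum fun i => (c i : ℝ≥0∞) • Measure.dirac (x i)

open Classical in
theorem atoms_apply (c : ℕ → ℕ) (x : ℕ → ℝ≥0) {s : Set ℝ≥0} (hs : MeasurableSet s) :
    atoms c x s = ∑' i, ((if x i ∈ s then c i else 0 : ℕ) : ℝ≥0∞) := by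
  rw [atoms, Measure.sum_apply _ hs]
  refine tsum_congr fun i => ?_
  rw [Measure.smul_apply, Measure.dirac_apply' _ hs, indicator]
  split_ifs <;> simp

theorem tsum_natCast_eq_top_or (a : ℕ → ℕ) :
    ∑' i, (a i : ℝ≥0∞) = ⊤ ∨ ∃ c : ℕ, ∑' i, (a i : ℝ≥0∞) = c := by
  by_cases h : ∑' i, (a i : ℝ≥0∞) = ⊤
  · exact Or.inl h
  · right
    have hfin := ENNReal.finite_const_le_of_tsum_ne_top h one_ne_zero
    refine ⟨∑ i ∈ hfin.toFinset, a i, ?_⟩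
    rw [tsum_eq_sum (s := hfin.toFinset), Nat.cast_sum]
    intro i hi
    rw [Set.Finite.mem_toFinset, mem_ofPred_eq] at hi
    have : ¬ (1 ≤ a i) := fun h => hi (by exact_mod_cast h)
    have h0 : a i = 0 := by omega
    rw [h0, Nat.cast_zero]

open Classical in
theorem atoms_eq_sum (c : ℕ → ℕ) {x : ℕ → ℝ≥0} {s : Set ℝ≥0} (hs : MeasurableSet s) {n : ℕ}
    (hn : ∀ i, n ≤ i → x i ∉ s) :
    atoms c x s = ((∑ i ∈ Finset.range n, if x i ∈ s then c i else 0 : ℕ) : ℝ≥0∞) := by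
  rw [atoms_apply c x hs, tsum_eq_sum (s := Finset.range n), Nat.cast_sum]
  intro i hi
  rw [if_neg (hn i (by simpa using hi)), Nat.cast_zero]

theorem isCounting_atoms (c : ℕ → ℕ) {x : ℕ → ℝ≥0} (hx : Tendsto x atTop atTop) :
    IsCounting (atoms c x) := by
  classical
  refine ⟨fun K hK => ?_, fun s hs => ?_⟩
  · obtain ⟨R, hR⟩ := hK.bddAbove
    obtain ⟨n, hn⟩ := eventually_atTop.1 (hx.eventually_gt_atTop R)
    rw [atoms_eq_sum c hK.measurableSet (n := n) fun i hi hK' => (hn i hi).not_ge (hR hK')]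
    exact ENNReal.natCast_lt_top _
  · rw [atoms_apply c x hs]
    exact tsum_natCast_eq_top_or _

theorem toCounting_val {ν : Measure ℝ≥0} (h : IsCounting ν) : (toCounting ν).1 = ν := by
  have : toCounting ν = ⟨ν, h⟩ := dif_pos h
  rw [this]

theorem eventually_le_cellIdx {x : ℕ → ℝ≥0} (hx : Tendsto x atTop atTop) (k : ℕ) {M : ℕ}
    (hM : 0 < M) : ∃ n, ∀ i, n ≤ i → M ≤ cellIdx k (x i) := by
  obtain ⟨n, hn⟩ := eventually_atTop.1 (hx.eventually_gt_atTop (M : ℝ≥0))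
  refine ⟨n, fun i hi => not_lt.1 fun h => ?_⟩
  rw [cellIdx_lt_iff hM] at h
  refine absurd (h.trans_lt (hn i hi)) (not_lt.2 ?_)
  exact le_mul_of_one_le_right zero_le (by simp)

theorem cellCount_toCounting_atoms (c : ℕ → ℕ) {x : ℕ → ℝ≥0} (hx : Tendsto x atTop atTop)
    {k b n : ℕ} (hn : ∀ i, n ≤ i → cellIdx k (x i) ≠ b) :
    cellCount k b (toCounting (atoms c x)) =
      ∑ i ∈ Finset.range n, if cellIdx k (x i) = b then c i else 0 := by
  classical
  refine cellCount_eq ?_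
  rw [toCounting_val (isCounting_atoms c hx), atoms_eq_sum c (measurableSet_cell k b) hn]
  simp only [cell, mem_preimage, mem_singleton_iff]

theorem cellCount_toCounting_atoms_eq_floor (c : ℕ → ℕ) {x : ℕ → ℝ≥0} (hx : Tendsto x atTop atTop)
    (k b : ℕ) : cellCount k b (toCounting (atoms c x)) =
      ⌊(∑' i, ((if cellIdx k (x i) = b then c i else 0 : ℕ) : ℝ≥0∞)).toReal⌋₊ := by
  classical
  rw [cellCount, toCounting_val (isCounting_atoms c hx), atoms_apply c x (measurableSet_cell k b)]
  simp only [cell, mem_preimage, mem_singleton_iff]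

end Atoms

/-! ### The compound Poisson process -/

section CompoundPoisson

/-- The sums `T_0 + ⋯ + T_{n-1}`. -/
def partialTime (n : ℕ) (w : ℕ → ℝ × ℕ) : ℝ := ∑ l ∈ Finset.range n, (w l).1

theorem measurable_partialTime (n : ℕ) : Measurable (partialTime n) :=
  Finset.measurable_sum _ fun l _ => measurable_fst.comp (measurable_pi_apply l)

theorem partialTime_consSeq (n : ℕ) (c : ℝ × ℕ) (w : ℕ → ℝ × ℕ) :
    partialTime (n + 1) (consSeq c w) = c.1 + partialTime n w := by
  rw [partialTime, Finset.sum_range_succ', add_comm]; rfl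

theorem compoundPoisson_eq (w : ℕ → ℝ × ℕ) : compoundPoisson w =
    toCounting (atoms (fun i => (w i).2) fun i => (partialTime (i + 1) w).toNNReal) := rfl

theorem lintegral_exp_neg_partialTime (ν : Measure (ℝ × ℕ)) [IsProbabilityMeasure ν] (n : ℕ) :
    ∫⁻ w, ENNReal.ofReal (Real.exp (-partialTime n w)) ∂(Measure.infinitePi fun _ => ν) =
      (∫⁻ c, ENNReal.ofReal (Real.exp (-c.1)) ∂ν) ^ n := by
  induction n with
  | zero => simp [partialTime]
  | succ n ih =>
    rw [lintegral_infinitePi_consSeq ν (by have := measurable_partialTime (n + 1); fun_prop)]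
    have e : ∀ (c : ℝ × ℕ) w, ENNReal.ofReal (Real.exp (-partialTime (n + 1) (consSeq c w))) =
        ENNReal.ofReal (Real.exp (-c.1)) * ENNReal.ofReal (Real.exp (-partialTime n w)) := by
      intro c w
      rw [partialTime_consSeq, neg_add, Real.exp_add, ENNReal.ofReal_mul (Real.exp_pos _).le]
    have hm : Measurable fun w => ENNReal.ofReal (Real.exp (-partialTime n w)) := by
      have := measurable_partialTime n; fun_prop
    simp only [e]
    simp only [lintegral_const_mul _ hm, ih]
    rw [lintegral_mul_const _ (by fun_prop), pow_succ']

/-- The expectation of the sum of e^{-S_n} is a convergent geometric series, so almost surely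
e^{-S_n} tends to zero. -/
theorem ae_tendsto_partialTime {ν : Measure (ℝ × ℕ)} [IsProbabilityMeasure ν]
    (h : ∫⁻ c, ENNReal.ofReal (Real.exp (-c.1)) ∂ν < 1) :
    ∀ᵐ w ∂(Measure.infinitePi fun _ : ℕ => ν), Tendsto (fun n => partialTime n w) atTop atTop := by
  have hm : ∀ n, Measurable fun w => ENNReal.ofReal (Real.exp (-partialTime n w)) := fun n => by
    have := measurable_partialTime n; fun_prop
  have hsum : ∫⁻ w, ∑' n, ENNReal.ofReal (Real.exp (-partialTime n w))
      ∂(Measure.infinitePi fun _ => ν) ≠ ⊤ := by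
    rw [lintegral_tsum fun n => (hm n).aemeasurable]
    simp only [lintegral_exp_neg_partialTime]
    rw [ENNReal.tsum_geometric]
    exact ENNReal.inv_ne_top.2 (tsub_pos_of_lt h).ne'
  filter_upwards [ae_lt_top (Measurable.tsum hm) hsum] with w hw
  have h0 := ENNReal.tendsto_atTop_zero_of_tsum_ne_top hw.ne
  have h1 := (ENNReal.tendsto_toReal ENNReal.zero_ne_top).comp h0
  simp only [Function.comp_def, ENNReal.toReal_ofReal (Real.exp_pos _).le,
    ENNReal.toReal_zero] at h1
  have h2 := tendsto_neg_atBot_atTop.comp (Real.tendsto_exp_comp_nhds_zero.1 h1)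
  simpa [Function.comp_def] using h2

theorem ae_tendsto_partialTime_cpSpace (θ : ℝ) (hθ : 0 < θ) (P : PMF ℕ) :
    ∀ᵐ w ∂cpSpace θ hθ P, Tendsto (fun n => partialTime n w) atTop atTop := by
  have := isProbabilityMeasure_expMeasure hθ
  refine ae_tendsto_partialTime ?_
  have := (measurePreserving_fst (μ := expMeasure θ) (ν := P.toMeasure)).lintegral_comp
    (f := fun t => ENNReal.ofReal (Real.exp (-t))) (by fun_prop)
  rw [this]
  exact lintegral_exp_neg_expMeasure_lt_one hθ

/-- `∏ y(a + S_i)^{D_i}` over the first `n` arrivals. -/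
def arrivalProd (y : ℝ → ℝ) (n : ℕ) (a : ℝ) (w : ℕ → ℝ × ℕ) : ℝ :=
  ∏ i ∈ Finset.range n, y (a + partialTime (i + 1) w) ^ (w i).2

theorem measurable_arrivalProd {y : ℝ → ℝ} (hy : Measurable y) (n : ℕ) (a : ℝ) :
    Measurable (arrivalProd y n a) :=
  Finset.measurable_prod _ fun i _ =>
    (hy.comp ((measurable_partialTime _).const_add a)).pow
      (measurable_snd.comp (measurable_pi_apply i))

theorem arrivalProd_mem {y : ℝ → ℝ} (hy : ∀ x, y x ∈ Icc (0 : ℝ) 1) (n : ℕ) (a : ℝ)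
    (w : ℕ → ℝ × ℕ) : arrivalProd y n a w ∈ Icc (0 : ℝ) 1 :=
  ⟨Finset.prod_nonneg fun _ _ => pow_nonneg (hy _).1 _,
    Finset.prod_le_one (fun _ _ => pow_nonneg (hy _).1 _)
      fun _ _ => pow_le_one₀ (hy _).1 (hy _).2⟩

theorem arrivalProd_consSeq (y : ℝ → ℝ) (n : ℕ) (a : ℝ) (c : ℝ × ℕ) (w : ℕ → ℝ × ℕ) :
    arrivalProd y (n + 1) a (consSeq c w) =
      y (a + c.1) ^ c.2 * arrivalProd y n (a + c.1) w := by
  rw [arrivalProd, Finset.prod_range_succ', mul_comm]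
  congr 1
  · simp [partialTime, consSeq]
  · refine Finset.prod_congr rfl fun i _ => ?_
    rw [partialTime_consSeq, add_assoc]; rfl

/-- This is a martingale identity: `h` is fixed by the one-arrival operator, so peeling off the
first arrival reduces n + 1 arrivals to n, started at a shifted time. -/
theorem integral_arrivalProd_mul {ν : Measure (ℝ × ℕ)} [IsProbabilityMeasure ν] {y h : ℝ → ℝ}
    (hy : Measurable y) (hy1 : ∀ x, y x ∈ Icc (0 : ℝ) 1)
    (hh : Measurable h) (hh1 : ∀ x, h x ∈ Icc (0 : ℝ) 1)
    (hfix : ∀ a, ∫ c, y (a + c.1) ^ c.2 * h (a + c.1) ∂ν = h a) (n : ℕ) (a : ℝ) :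
    ∫ w, arrivalProd y n a w * h (a + partialTime n w) ∂(Measure.infinitePi fun _ => ν) =
      h a := by
  induction n generalizing a with
  | zero => simp [arrivalProd, partialTime]
  | succ n ih =>
    rw [integral_infinitePi_consSeq ν
      (F := fun w => arrivalProd y (n + 1) a w * h (a + partialTime (n + 1) w))
      ((measurable_arrivalProd hy _ _).mul (hh.comp ((measurable_partialTime _).const_add a)))
      fun w => ⟨mul_nonneg (arrivalProd_mem hy1 _ _ _).1 (hh1 _).1,
        mul_le_one₀ (arrivalProd_mem hy1 _ _ _).2 (hh1 _).1 (hh1 _).2⟩]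
    simp only [arrivalProd_consSeq, partialTime_consSeq, ← add_assoc, mul_assoc,
      integral_const_mul, ih]
    exact hfix a

/-- The generating function of a probability on `ℕ`. -/
def pgf (P : PMF ℕ) (v : ℝ) : ℝ := ∫ d, v ^ d ∂P.toMeasure

theorem pgf_eq_tsum (P : PMF ℕ) {v : ℝ} (hv : v ∈ Icc (0 : ℝ) 1) :
    pgf P v = ∑' d, (P d).toReal * v ^ d := by
  rw [pgf, PMF.integral_eq_tsum]
  · rfl
  · exact integrable_of_mem_Icc (measurable_of_countable _) fun d =>
      ⟨pow_nonneg hv.1 _, pow_le_one₀ hv.1 hv.2⟩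

theorem pgf_one (P : PMF ℕ) : pgf P 1 = 1 := by simp [pgf]

theorem pgf_mem (P : PMF ℕ) {v : ℝ} (hv : v ∈ Icc (0 : ℝ) 1) : pgf P v ∈ Icc (0 : ℝ) 1 := by
  refine ⟨integral_nonneg fun d => pow_nonneg hv.1 _, ?_⟩
  have : pgf P v ≤ ∫ _, (1 : ℝ) ∂P.toMeasure :=
    integral_mono (integrable_of_mem_Icc (measurable_of_countable _) fun d =>
      ⟨pow_nonneg hv.1 _, pow_le_one₀ hv.1 hv.2⟩) (integrable_const _)
      fun d => pow_le_one₀ hv.1 hv.2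
  simpa using this

theorem measurable_pgf (P : PMF ℕ) : Measurable (pgf P) := by
  have : StronglyMeasurable (Function.uncurry fun (v : ℝ) (d : ℕ) => v ^ d) :=
    (measurable_fst.pow measurable_snd).stronglyMeasurable
  exact this.integral_prod_right.measurable

/-- The value of `z` at the cell of `x`, and `1` beyond the first `M` cells. -/
def cellValue (k M : ℕ) (z : ℕ → ℝ) (x : ℝ) : ℝ :=
  if cellIdx k x.toNNReal < M then z (cellIdx k x.toNNReal) else 1

theorem measurable_cellValue (k M : ℕ) (z : ℕ → ℝ) : Measurable (cellValue k M z) := by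
  have : Measurable fun i : ℕ => if i < M then z i else (1 : ℝ) := measurable_of_countable _
  exact this.comp ((measurable_cellIdx k).comp measurable_real_toNNReal)

theorem cellValue_mem {k M : ℕ} {z : ℕ → ℝ} (hz : ∀ b, z b ∈ Icc (0 : ℝ) 1) (x : ℝ) :
    cellValue k M z x ∈ Icc (0 : ℝ) 1 := by
  rw [cellValue]; split_ifs
  exacts [hz _, ⟨zero_le_one, le_rfl⟩]

theorem cellValue_of_lt {k M : ℕ} (hM : 0 < M) (z : ℕ → ℝ) {x : ℝ}
    (hx : (M : ℝ) / (k + 1) < x) : cellValue k M z x = 1 := by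
  rw [cellValue, if_neg]
  have hk : (0 : ℝ) < k + 1 := by positivity
  have hx0 : 0 < x := (by positivity : (0 : ℝ) ≤ (M : ℝ) / (k + 1)).trans_lt hx
  rw [cellIdx_lt_iff hM, not_le, ← NNReal.coe_lt_coe]
  push_cast
  rw [Real.coe_toNNReal _ hx0.le]
  rwa [div_lt_iff₀ hk] at hx

theorem cellIdx_toNNReal_eq {k b : ℕ} {x : ℝ} (h1 : (b : ℝ) / (k + 1) < x)
    (h2 : x ≤ ((b + 1 : ℕ) : ℝ) / (k + 1)) : cellIdx k x.toNNReal = b := by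
  have hk : (0 : ℝ) < k + 1 := by positivity
  have hx0 : 0 < x := (by positivity : (0 : ℝ) ≤ (b : ℝ) / (k + 1)).trans_lt h1
  rw [div_lt_iff₀ hk] at h1
  rw [le_div_iff₀ hk] at h2
  have l1 : cellIdx k x.toNNReal < b + 1 := by
    rw [cellIdx_lt_iff b.succ_pos, ← NNReal.coe_le_coe]
    push_cast
    rw [Real.coe_toNNReal _ hx0.le]
    exact_mod_cast h2
  rcases Nat.eq_zero_or_pos b with rfl | hb
  · omega
  · have l2 : ¬ cellIdx k x.toNNReal < b := by
      rw [cellIdx_lt_iff hb, not_le, ← NNReal.coe_lt_coe]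
      push_cast
      rwa [Real.coe_toNNReal _ hx0.le]
    omega

theorem integral_cellValue {k M : ℕ} {z : ℕ → ℝ} {κ : ℝ → ℝ} {F : ℝ → ℝ}
    (hκ : ∀ x, κ x = F (cellValue k M z x)) (hint : ∀ a b, IntervalIntegrable κ volume a b) :
    ∫ x in (0 : ℝ)..((M : ℝ) / (k + 1)), κ x = ∑ b ∈ Finset.range M, F (z b) / (k + 1) := by
  have hk : (0 : ℝ) < k + 1 := by positivity
  have := intervalIntegral.sum_integral_adjacent_intervals (f := κ) (μ := volume)
    (a := fun b : ℕ => (b : ℝ) / (k + 1)) (n := M) fun _ _ => hint _ _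
  simp only [Nat.cast_zero, zero_div] at this
  rw [← this]
  refine Finset.sum_congr rfl fun b hb => ?_
  have hle : (b : ℝ) / (k + 1) ≤ ((b + 1 : ℕ) : ℝ) / (k + 1) :=
    div_le_div_of_nonneg_right (by push_cast; linarith) hk.le
  have e : ∫ x in ((b : ℝ) / (k + 1))..(((b + 1 : ℕ) : ℝ) / (k + 1)), κ x =
      ∫ x in ((b : ℝ) / (k + 1))..(((b + 1 : ℕ) : ℝ) / (k + 1)), F (z b) := by
    refine intervalIntegral.integral_congr_ae (Eventually.of_forall fun x hx => ?_)
    rw [uIoc_of_le hle] at hx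
    rw [hκ, cellValue, cellIdx_toNNReal_eq hx.1 hx.2, if_pos (Finset.mem_range.1 hb)]
  rw [e, intervalIntegral.integral_const, smul_eq_mul]
  push_cast
  field_simp
  ring

theorem prod_cellValue {k M n : ℕ} {z : ℕ → ℝ} {w : ℕ → ℝ × ℕ}
    (hw : Tendsto (fun n => partialTime n w) atTop atTop)
    (hn : ∀ i, n ≤ i → M ≤ cellIdx k (partialTime (i + 1) w).toNNReal) :
    ∏ b ∈ Finset.range M, z b ^ cellCount k b (compoundPoisson w) =
      arrivalProd (cellValue k M z) n 0 w := by
  have hx : Tendsto (fun i => (partialTime (i + 1) w).toNNReal) atTop atTop :=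
    tendsto_real_toNNReal_atTop.comp (hw.comp (tendsto_add_atTop_nat 1))
  have e1 : ∀ b ∈ Finset.range M, z b ^ cellCount k b (compoundPoisson w) =
      ∏ i ∈ Finset.range n,
        if cellIdx k (partialTime (i + 1) w).toNNReal = b then z b ^ (w i).2 else 1 := by
    intro b hb
    rw [compoundPoisson_eq, cellCount_toCounting_atoms _ hx (n := n) fun i hi h =>
      (Finset.mem_range.1 hb).not_ge ((hn i hi).trans_eq h), ← Finset.prod_pow_eq_pow_sum]
    refine Finset.prod_congr rfl fun i _ => ?_
    split_ifs <;> simp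
  rw [Finset.prod_congr rfl e1, Finset.prod_comm, arrivalProd]
  refine Finset.prod_congr rfl fun i _ => ?_
  rw [zero_add, cellValue, Finset.prod_ite_eq]
  simp only [Finset.mem_range]
  split_ifs <;> simp

/-- The generating function of the numbers of points of a compound Poisson process in cells. -/
theorem integral_prod_cellCount_compoundPoisson {θ : ℝ} (hθ : 0 < θ) (P : PMF ℕ) (k : ℕ) {M : ℕ}
    (hM : 0 < M) {z : ℕ → ℝ} (hz : ∀ b, z b ∈ Icc (0 : ℝ) 1) :
    ∫ w, ∏ b ∈ Finset.range M, z b ^ cellCount k b (compoundPoisson w) ∂cpSpace θ hθ P =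
      Real.exp (-∑ b ∈ Finset.range M, θ * (1 - pgf P (z b)) / (k + 1)) := by
  have := isProbabilityMeasure_expMeasure hθ
  set y := cellValue k M z with hy
  have hym : Measurable y := measurable_cellValue k M z
  have hy1 : ∀ x, y x ∈ Icc (0 : ℝ) 1 := cellValue_mem hz
  set T : ℝ := (M : ℝ) / (k + 1) with hT
  set κ : ℝ → ℝ := fun x => θ * (1 - pgf P (y x)) with hκ
  have hκm : Measurable κ := (measurable_const.sub ((measurable_pgf P).comp hym)).const_mul θ
  have hκ0 : ∀ x, κ x ∈ Icc 0 θ := fun x => by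
    have := pgf_mem P (hy1 x)
    exact ⟨mul_nonneg hθ.le (by linarith [this.2]),
      mul_le_of_le_one_right hθ.le (by linarith [this.1])⟩
  have hκT : ∀ x, T < x → κ x = 0 := fun x hx => by
    simp only [hκ, hy, cellValue_of_lt hM z hx, pgf_one, sub_self, mul_zero]
  have hint : ∀ a b, IntervalIntegrable κ volume a b := fun a b =>
    (intervalIntegrable_const (c := θ)).mono_fun hκm.aestronglyMeasurable
      (Eventually.of_forall fun x => by
        simpa [abs_of_pos hθ, abs_of_nonneg (hκ0 x).1] using (hκ0 x).2)
  set Λ : ℝ → ℝ := fun x => ∫ t in (0 : ℝ)..x, κ t with hΛ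
  have hΛsub : ∀ a b, Λ b - Λ a = ∫ t in a..b, κ t := fun a b =>
    intervalIntegral.integral_interval_sub_left (hint _ _) (hint _ _)
  have hΛT : ∀ x, T ≤ x → Λ x = Λ T := fun x hx => by
    have : Λ x - Λ T = ∫ t in T..x, (0 : ℝ) := by
      rw [hΛsub]
      refine intervalIntegral.integral_congr_ae (Eventually.of_forall fun t ht => ?_)
      rw [uIoc_of_le hx] at ht
      exact hκT t ht.1
    rw [intervalIntegral.integral_zero] at this
    linarith
  have hΛle : ∀ x, Λ x ≤ Λ T := fun x => by
    rcases le_total x T with hx | hx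
    · have : 0 ≤ Λ T - Λ x := by
        rw [hΛsub]
        exact intervalIntegral.integral_nonneg hx fun t _ => (hκ0 t).1
      linarith
    · exact (hΛT x hx).le
  -- This is the generating function of the points remaining after time x: by the renewal equation
  -- it is fixed by the one-arrival operator, and it equals 1 from T on.
  set h : ℝ → ℝ := fun x => Real.exp (Λ x) * Real.exp (-Λ T) with hh
  have hhm : Measurable h := by
    have : Continuous Λ := intervalIntegral.continuous_primitive hint 0
    exact (Real.measurable_exp.comp this.measurable).mul_const _
  have hh1 : ∀ x, h x ∈ Icc (0 : ℝ) 1 := fun x => by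
    refine ⟨by positivity, ?_⟩
    simp only [hh]
    rw [← Real.exp_add, Real.exp_le_one_iff]
    linarith [hΛle x]
  have hhT : ∀ x, T ≤ x → h x = 1 := fun x hx => by
    simp only [hh, hΛT x hx]
    rw [← Real.exp_add, add_neg_cancel, Real.exp_zero]
  have hfix : ∀ a, ∫ c, y (a + c.1) ^ c.2 * h (a + c.1) ∂((expMeasure θ).prod P.toMeasure) =
      h a := by
    intro a
    rw [integral_prod _ (integrable_of_mem_Icc (by fun_prop) fun c =>
      ⟨mul_nonneg (pow_nonneg (hy1 _).1 _) (hh1 _).1,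
        mul_le_one₀ (pow_le_one₀ (hy1 _).1 (hy1 _).2) (hh1 _).1 (hh1 _).2⟩)]
    have e : ∀ t, ∫ d, y (a + t) ^ d * h (a + t) ∂P.toMeasure =
        (1 - κ (a + t) / θ) * Real.exp (Λ (a + t)) * Real.exp (-Λ T) := by
      intro t
      rw [integral_mul_const]
      change pgf P (y (a + t)) * h (a + t) = _
      have : 1 - κ (a + t) / θ = pgf P (y (a + t)) := by
        simp only [hκ]; field_simp; ring
      rw [this, mul_assoc]
    simp only [e]
    rw [integral_mul_const, integral_expMeasure_renewal hθ hκm hκ0 hκT a]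
  -- Starting at time 0, the expectation stays h 0 = e^{-Λ(T)}. As n grows the arrivals pass T and
  -- the integrand becomes the product over cells.
  have hconst := fun n => integral_arrivalProd_mul hym hy1 hhm hh1 hfix n 0
  simp only [zero_add] at hconst
  have hlim : Tendsto (fun n => ∫ w, arrivalProd y n 0 w * h (partialTime n w) ∂cpSpace θ hθ P)
      atTop (𝓝 (∫ w, ∏ b ∈ Finset.range M, z b ^ cellCount k b (compoundPoisson w)
        ∂cpSpace θ hθ P)) := by
    refine tendsto_integral_of_dominated_convergence (fun _ => 1) (fun n => ?_)
      (integrable_const _) (fun n => Eventually.of_forall fun w => ?_) ?_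
    · exact ((measurable_arrivalProd hym _ _).mul
        (hhm.comp (measurable_partialTime n))).aestronglyMeasurable
    · have h0 := arrivalProd_mem hy1 n 0 w
      rw [Real.norm_eq_abs, abs_of_nonneg (mul_nonneg h0.1 (hh1 _).1)]
      exact mul_le_one₀ h0.2 (hh1 _).1 (hh1 _).2
    · filter_upwards [ae_tendsto_partialTime_cpSpace θ hθ P] with w hw
      have hx : Tendsto (fun i => (partialTime (i + 1) w).toNNReal) atTop atTop :=
        tendsto_real_toNNReal_atTop.comp (hw.comp (tendsto_add_atTop_nat 1))
      obtain ⟨n₀, hn₀⟩ := eventually_le_cellIdx hx k hM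
      refine tendsto_const_nhds.congr' ?_
      filter_upwards [eventually_ge_atTop n₀, hw.eventually_ge_atTop T] with n hn hnT
      rw [hhT _ hnT, mul_one]
      exact prod_cellValue hw fun i hi => hn₀ i (hn.trans hi)
  have heq := tendsto_nhds_unique hlim (tendsto_const_nhds.congr fun n => (hconst n).symm)
  rw [heq]
  simp only [hh, hΛ, intervalIntegral.integral_same, Real.exp_zero, one_mul]
  rw [integral_cellValue (F := fun v => θ * (1 - pgf P v)) (fun x => rfl) hint]

open Classical in
/-- The compound Poisson process, modified on a null set. -/
def compoundPoissonReg (w : ℕ → ℝ × ℕ) : CountingMeasure :=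
  if Tendsto (fun n => partialTime n w) atTop atTop then compoundPoisson w else toCounting 0

theorem compoundPoissonReg_ae_eq (θ : ℝ) (hθ : 0 < θ) (P : PMF ℕ) :
    compoundPoissonReg =ᵐ[cpSpace θ hθ P] compoundPoisson := by
  filter_upwards [ae_tendsto_partialTime_cpSpace θ hθ P] with w hw
  rw [compoundPoissonReg, if_pos hw]

theorem measurable_cellCount_compoundPoissonReg (k b : ℕ) :
    Measurable fun w => cellCount k b (compoundPoissonReg w) := by
  have hgood : MeasurableSet {w : ℕ → ℝ × ℕ | Tendsto (fun n => partialTime n w) atTop atTop} :=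
    measurableSet_tendsto atTop measurable_partialTime
  have hidx : ∀ i, Measurable fun w : ℕ → ℝ × ℕ => cellIdx k (partialTime (i + 1) w).toNNReal :=
    fun i => (measurable_cellIdx k).comp
      (measurable_real_toNNReal.comp (measurable_partialTime (i + 1)))
  have hterm : ∀ i, Measurable fun w : ℕ → ℝ × ℕ =>
      ((if cellIdx k (partialTime (i + 1) w).toNNReal = b then (w i).2 else 0 : ℕ) : ℝ≥0∞) :=
    fun i => (measurable_of_countable (fun c : ℕ => (c : ℝ≥0∞))).comp
      (Measurable.ite ((hidx i) (measurableSet_singleton b))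
        (measurable_snd.comp (measurable_pi_apply i)) measurable_const)
  have hfl : Measurable fun w : ℕ → ℝ × ℕ => ⌊(∑' i, ((if cellIdx k
      (partialTime (i + 1) w).toNNReal = b then (w i).2 else 0 : ℕ) : ℝ≥0∞)).toReal⌋₊ :=
    Nat.measurable_floor.comp (Measurable.tsum hterm).ennreal_toReal
  classical
  have e : (fun w => cellCount k b (compoundPoissonReg w)) = fun w : ℕ → ℝ × ℕ =>
      if Tendsto (fun n => partialTime n w) atTop atTop then ⌊(∑' i, ((if cellIdx k
        (partialTime (i + 1) w).toNNReal = b then (w i).2 else 0 : ℕ) : ℝ≥0∞)).toReal⌋₊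
      else cellCount k b (toCounting 0) := by
    funext w
    by_cases hw : Tendsto (fun n => partialTime n w) atTop atTop
    · rw [compoundPoissonReg, if_pos hw, if_pos hw, compoundPoisson_eq]
      exact cellCount_toCounting_atoms_eq_floor _
        (tendsto_real_toNNReal_atTop.comp (hw.comp (tendsto_add_atTop_nat 1))) k b
    · rw [compoundPoissonReg, if_neg hw, if_neg hw]
  rw [e]
  exact Measurable.ite hgood hfl measurable_const

end CompoundPoisson

/-! ### Rare event point processes -/

section Repp

/-- The number of times `j` with `j r ≤ b / (k + 1)` (none for `b = 0`). -/
def slot (r : ℝ) (k b : ℕ) : ℕ := if b = 0 then 0 else ⌊(b : ℝ) / ((k + 1) * r)⌋₊ + 1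

theorem slot_zero (r : ℝ) (k : ℕ) : slot r k 0 = 0 := if_pos rfl

theorem monotone_slot {r : ℝ} (hr : 0 ≤ r) (k : ℕ) : Monotone (slot r k) := by
  intro b b' hbb
  rcases Nat.eq_zero_or_pos b with rfl | hb
  · rw [slot_zero]; exact Nat.zero_le _
  · rw [slot, slot, if_neg hb.ne', if_neg (hb.trans_le hbb).ne']
    refine Nat.succ_le_succ (Nat.floor_le_floor ?_)
    exact div_le_div_of_nonneg_right (by exact_mod_cast hbb) (by positivity)

theorem lt_slot_iff {r : ℝ} (hr : 0 < r) (k : ℕ) {b : ℕ} (hb : 0 < b) (j : ℕ) :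
    j < slot r k b ↔ (j : ℝ) * r * (k + 1) ≤ b := by
  have : (0 : ℝ) < (k + 1) * r := by positivity
  rw [slot, if_neg hb.ne', Nat.lt_succ_iff, Nat.le_floor_iff (by positivity), le_div_iff₀ this]
  rw [show (j : ℝ) * ((k + 1) * r) = j * r * (k + 1) by ring]

theorem abs_slot_mul_sub_le {r : ℝ} (hr : 0 < r) (k b : ℕ) :
    |(slot r k b : ℝ) * r - b / (k + 1)| ≤ r := by
  rcases Nat.eq_zero_or_pos b with rfl | hb
  · simp [slot_zero, hr.le]
  · have hc : (0 : ℝ) < (k + 1) * r := by positivity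
    have e : (b : ℝ) / ((k + 1) * r) * r = b / (k + 1) := by field_simp
    have h1 := Nat.floor_le (a := (b : ℝ) / ((k + 1) * r)) (by positivity)
    have h2 := Nat.lt_floor_add_one ((b : ℝ) / ((k + 1) * r))
    rw [slot, if_neg hb.ne', ← e]
    push_cast
    rw [← sub_mul, abs_mul, abs_of_pos hr]
    refine mul_le_of_le_one_left hr.le ?_
    rw [abs_le]; constructor <;> linarith

theorem tendsto_slot_sub_mul {r : ℕ → ℝ} (hr0 : ∀ n, 0 ≤ r n) (hr : Tendsto r atTop (𝓝 0))
    (hpos : ∀ᶠ n in atTop, 0 < r n) (k b : ℕ) :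
    Tendsto (fun n => ((slot (r n) k (b + 1) - slot (r n) k b : ℕ) : ℝ) * r n) atTop
      (𝓝 (1 / (k + 1))) := by
  have h : ∀ b : ℕ, Tendsto (fun n => (slot (r n) k b : ℝ) * r n) atTop (𝓝 ((b : ℝ) / (k + 1))) := by
    intro b
    rw [tendsto_iff_norm_sub_tendsto_zero]
    refine squeeze_zero' (Eventually.of_forall fun n => norm_nonneg _) ?_ hr
    filter_upwards [hpos] with n hn
    exact abs_slot_mul_sub_le hn k b
  have h1 := (h (b + 1)).sub (h b)
  have e : ((b + 1 : ℕ) : ℝ) / (k + 1) - (b : ℝ) / (k + 1) = 1 / (k + 1) := by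
    push_cast; ring
  rw [e] at h1
  refine h1.congr fun n => ?_
  rw [Nat.cast_sub (monotone_slot (hr0 n) k b.le_succ), sub_mul]

theorem visits_eq_sum_visits_one {X : Type*} {f : X → X} {U : Set X} (L : ℕ) (x : X) :
    visits f U L x = ∑ j ∈ Finset.range L, visits f U 1 (f^[j] x) := by
  induction L with
  | zero => simp
  | succ L ih => rw [visits_add, Finset.sum_range_succ, ih]

variable {X : Type*} [MeasurableSpace X] {μ : Measure X} {f : X → X} {U : Set X}

theorem repp_eq (x : X) : repp μ f U x = toCounting (atoms (fun j => visits f U 1 (f^[j] x))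
    fun j => (j : ℝ≥0) / ((μ U).toNNReal)⁻¹) := by
  classical
  rw [repp, atoms]
  congr 2
  funext j
  rw [visits_one]
  split_ifs <;> simp

theorem cellIdx_eq_iff (hU : 0 < μ.real U) (k b j : ℕ) :
    cellIdx k ((j : ℝ≥0) / ((μ U).toNNReal)⁻¹) = b ↔
      slot (μ.real U) k b ≤ j ∧ j < slot (μ.real U) k (b + 1) := by
  have key : ∀ b : ℕ, cellIdx k ((j : ℝ≥0) / ((μ U).toNNReal)⁻¹) < b ↔
      j < slot (μ.real U) k b := by
    intro b
    rcases Nat.eq_zero_or_pos b with rfl | hb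
    · simp [slot_zero]
    · rw [cellIdx_lt_iff hb, lt_slot_iff hU k hb, ← NNReal.coe_le_coe, div_inv_eq_mul]
      push_cast
      rfl
  have k1 := key b
  have k2 := key (b + 1)
  omega

theorem tendsto_atom_position (hU : 0 < μ.real U) :
    Tendsto (fun j : ℕ => (j : ℝ≥0) / ((μ U).toNNReal)⁻¹) atTop atTop := by
  have h0 : 0 < (μ U).toNNReal := hU
  simp only [div_inv_eq_mul]
  exact tendsto_natCast_atTop_atTop.atTop_mul_const h0

theorem cellCount_repp (hU : 0 < μ.real U) (k b : ℕ) (x : X) :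
    cellCount k b (repp μ f U x) =
      visits f U (slot (μ.real U) k (b + 1) - slot (μ.real U) k b)
        (f^[slot (μ.real U) k b] x) := by
  set s := slot (μ.real U) k
  rw [repp_eq, cellCount_toCounting_atoms _ (tendsto_atom_position hU) (n := s (b + 1))]
  · simp only [cellIdx_eq_iff hU]
    rw [← Finset.sum_filter, visits_eq_sum_visits_one]
    have : (Finset.range (s (b + 1))).filter (fun j => s b ≤ j ∧ j < s (b + 1)) =
        Finset.Ico (s b) (s (b + 1)) := by
      ext j; simp only [Finset.mem_filter, Finset.mem_range, Finset.mem_Ico]; tauto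
    rw [this, Finset.sum_Ico_eq_sum_range]
    refine Finset.sum_congr rfl fun j _ => ?_
    rw [← Function.iterate_add_apply, add_comm j]
  · intro j hj h
    exact absurd ((cellIdx_eq_iff hU k b j).1 h).2 (not_lt.2 hj)

open Classical in
/-- The rare event point process, replaced by `0` for a null set `U`. -/
def reppReg (μ : Measure X) (f : X → X) (U : Set X) (x : X) : CountingMeasure :=
  if 0 < μ.real U then repp μ f U x else toCounting 0

theorem reppReg_of_pos (hU : 0 < μ.real U) : reppReg μ f U = repp μ f U := by
  funext x; rw [reppReg, if_pos hU]

/-- For a null set U almost every orbit never visits U, so both processes are zero and the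
degenerate normalisation is harmless. -/
theorem reppReg_ae_eq [IsFiniteMeasure μ] (hf : MeasurePreserving f μ μ) :
    reppReg μ f U =ᵐ[μ] repp μ f U := by
  rcases (measureReal_nonneg (μ := μ) (s := U)).eq_or_lt' with h0 | hU
  · have hnull : μ U = 0 := by rwa [measureReal_eq_zero_iff] at h0
    have hvis : ∀ᵐ x ∂μ, ∀ j : ℕ, f^[j] x ∉ U := by
      rw [ae_all_iff]
      intro j
      exact (hf.iterate j).quasiMeasurePreserving.ae (measure_eq_zero_iff_ae_notMem.1 hnull)
    filter_upwards [hvis] with x hx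
    rw [reppReg, if_neg h0.not_gt, repp]
    congr 1
    simp only [hx, if_false]
    exact Measure.sum_zero.symm
  · rw [reppReg_of_pos hU]

theorem measurable_cellCount_reppReg (hf : Measurable f) (hU : MeasurableSet U) (k b : ℕ) :
    Measurable fun x => cellCount k b (reppReg μ f U x) := by
  by_cases h : 0 < μ.real U
  · rw [reppReg_of_pos h]
    simp only [cellCount_repp h]
    exact (measurable_visits hf hU _).comp (hf.iterate _)
  · simp only [reppReg, if_neg h]
    exact measurable_const

variable [IsProbabilityMeasure μ]

/-- Convergence to a compound Poisson process for sets without short returns. -/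
theorem RareSets.tendstoInDistribution {q : ℕ} {U : ℕ → Set X} {β : ℕ → ℝ}
    (h : RareSets μ f q U β) {θ : ℝ} (hθ : 0 < θ) (P : PMF ℕ)
    (hβ : ∀ z ∈ Ioo (0 : ℝ) 1, exponent β z = θ * (1 - ∑' d, (P d).toReal * z ^ d)) :
    TendstoInDistribution (fun n => repp μ f (U n)) atTop compoundPoisson (fun _ => μ)
      (cpSpace θ hθ P) := by
  have hreg : TendstoInDistribution (fun n => reppReg μ f (U n)) atTop compoundPoissonReg
      (fun _ => μ) (cpSpace θ hθ P) := by
    refine tendstoInDistribution_of_cellCount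
      (fun n k b => measurable_cellCount_reppReg h.preserving.measurable (h.measurableSet n) k b)
      measurable_cellCount_compoundPoissonReg fun k c => ?_
    refine tendsto_measure_counts
      (N := fun n x b => cellCount k b (reppReg μ f (U n) x))
      (N' := fun w b => cellCount k b (compoundPoissonReg w))
      (fun n b => measurable_cellCount_reppReg h.preserving.measurable (h.measurableSet n) k b)
      (measurable_cellCount_compoundPoissonReg k) (fun z hz => ?_) c
    have hz' : ∀ b, z b ∈ Icc (0 : ℝ) 1 := fun b => ⟨(hz b).1.le, (hz b).2.le⟩
    -- Cells of mesh 1/(k + 1) correspond to blocks of time of that rescaled length, hence the value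
    -- of s.
    have hgen := h.tendsto_generating (z := z) (s := 1 / ((k : ℝ) + 1))
      (a := fun n => slot (μ.real (U n)) k) (fun b => ⟨(hz b).1.le, (hz b).2⟩) (by positivity)
      (fun n => slot_zero _ _) (fun n => monotone_slot measureReal_nonneg k)
      (fun b => tendsto_slot_sub_mul (fun n => measureReal_nonneg) h.rare h.pos k b)
      ((k + 1) * (k + 1))
    have e : ∫ w, ∏ b ∈ Finset.range ((k + 1) * (k + 1)),
        z b ^ cellCount k b (compoundPoissonReg w) ∂cpSpace θ hθ P =
        Real.exp (-(1 / ((k : ℝ) + 1) *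
          ∑ b ∈ Finset.range ((k + 1) * (k + 1)), exponent β (z b))) := by
      have hae : (fun w => ∏ b ∈ Finset.range ((k + 1) * (k + 1)),
          z b ^ cellCount k b (compoundPoissonReg w)) =ᵐ[cpSpace θ hθ P]
          fun w => ∏ b ∈ Finset.range ((k + 1) * (k + 1)),
            z b ^ cellCount k b (compoundPoisson w) := by
        filter_upwards [compoundPoissonReg_ae_eq θ hθ P] with w hw
        rw [hw]
      rw [integral_congr_ae hae,
        integral_prod_cellCount_compoundPoisson hθ P k (by positivity) hz', Finset.mul_sum]
      congr 2
      refine Finset.sum_congr rfl fun b _ => ?_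
      rw [hβ _ (hz b), pgf_eq_tsum P (hz' b)]
      ring
    rw [e]
    refine hgen.congr' ?_
    filter_upwards [h.pos] with n hn
    rw [reppReg_of_pos hn]
    simp only [cellCount_repp hn]
  exact hreg.congr (fun n => reppReg_ae_eq h.preserving) (compoundPoissonReg_ae_eq θ hθ P)

end Repp

/-! ### The multiplicity distribution -/

section Multiplicity

variable {X : Type*} [MeasurableSpace X] {μ : Measure X} [IsProbabilityMeasure μ] {f : X → X}
  {q : ℕ} {U : ℕ → Set X}

/-- The limits of the relative weights of the sets `A^(κ)` determine a multiplicity distribution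
on `{1, 2, …}`. -/
theorem exists_multiplicity (hf : MeasurePreserving f μ μ) (hU : ∀ n, MeasurableSet (U n))
    {θ : ℝ} (hθ : 0 < θ) {r : ℕ → ℝ}
    (h0 : Tendsto (fun n => μ.real (setA f q (U n) 0) / μ.real (U n)) atTop (𝓝 θ))
    (hr : ∀ k, 1 ≤ k → Tendsto (fun n => (μ.real (setA f q (U n) (k - 1)) -
      μ.real (setA f q (U n) k)) / μ.real (setA f q (U n) 0)) atTop (𝓝 (r k))) :
    ∃ (P : PMF ℕ) (β : ℕ → ℝ), P 0 = 0 ∧ (∀ k, 1 ≤ k → (P k).toReal = r k) ∧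
      (∀ κ, Tendsto (fun n => μ.real (setA f q (U n) κ) / μ.real (U n)) atTop (𝓝 (β κ))) ∧
      ∀ z ∈ Ioo (0 : ℝ) 1, exponent β z = θ * (1 - ∑' d, (P d).toReal * z ^ d) := by
  -- By telescoping this is the limit of μ(A^(κ)) / μ(A^(0)), as `hlim0` confirms.
  set α : ℕ → ℝ := fun κ => 1 - ∑ j ∈ Finset.range κ, r (j + 1) with hα
  have hα0 : α 0 = 1 := by simp [hα]
  have hαs : ∀ κ, α κ - α (κ + 1) = r (κ + 1) := fun κ => by
    simp only [hα, Finset.sum_range_succ]; ring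
  have hpos : ∀ᶠ n in atTop, 0 < μ.real (setA f q (U n) 0) := by
    filter_upwards [h0.eventually (lt_mem_nhds hθ)] with n hn
    refine measureReal_nonneg.lt_of_ne fun h => ?_
    rw [← h, zero_div] at hn
    exact hn.false
  have hlim0 : ∀ κ, Tendsto (fun n => μ.real (setA f q (U n) κ) / μ.real (setA f q (U n) 0)) atTop
      (𝓝 (α κ)) := by
    intro κ
    induction κ with
    | zero =>
      rw [hα0]
      refine tendsto_const_nhds.congr' ?_
      filter_upwards [hpos] with n hn
      rw [div_self hn.ne']
    | succ κ ih =>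
      have := ih.sub (hr (κ + 1) (Nat.le_add_left 1 κ))
      rw [← hαs, sub_sub_cancel] at this
      refine this.congr fun n => ?_
      rw [Nat.add_sub_cancel]; ring
  have hlim : ∀ κ, Tendsto (fun n => μ.real (setA f q (U n) κ) / μ.real (U n)) atTop
      (𝓝 (θ * α κ)) := by
    intro κ
    refine (h0.mul (hlim0 κ)).congr' ?_
    filter_upwards [hpos] with n hn
    field_simp
  have hanti : Antitone α := antitone_nat_of_succ_le fun κ =>
    le_of_tendsto_of_tendsto' (hlim0 (κ + 1)) (hlim0 κ) fun n =>
      div_le_div_of_nonneg_right (measureReal_setA_succ_le hf (hU n) κ) measureReal_nonneg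
  have hnn : ∀ κ, 0 ≤ α κ := fun κ => ge_of_tendsto' (hlim0 κ) fun n => by positivity
  have hle : ∀ κ : ℕ, α κ ≤ θ⁻¹ * (1 / ((κ : ℝ) + 1)) := by
    intro κ
    have h1 : ((κ : ℝ) + 1) * (θ * α κ) ≤ 1 := by
      refine le_of_tendsto' ((hlim κ).const_mul ((κ : ℝ) + 1)) fun n => ?_
      rw [← mul_div_assoc]
      exact div_le_one_of_le₀ (succ_mul_measureReal_setA_le hf (hU n) κ) measureReal_nonneg
    have hκ : (0 : ℝ) < (κ : ℝ) + 1 := by positivity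
    rw [one_div, ← mul_inv, ← one_div, le_div_iff₀ (by positivity)]
    linarith
  have hα_lim : Tendsto α atTop (𝓝 0) := by
    refine squeeze_zero hnn hle ?_
    simpa using tendsto_one_div_add_atTop_nhds_zero_nat.const_mul θ⁻¹
  obtain ⟨P, hP0, hP⟩ := exists_pmf_of_antitone hα0 hanti hα_lim
  refine ⟨P, fun κ => θ * α κ, hP0, fun k hk => ?_, hlim, fun z hz => ?_⟩
  · obtain ⟨k, rfl⟩ := Nat.exists_eq_add_of_le' hk
    rw [hP, hαs]
  · have hs := hasSum_weights_of_pmf hα0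
      (fun κ => ⟨hnn κ, by rw [← hα0]; exact hanti (Nat.zero_le κ)⟩) hP0 hP hz.1.le hz.2
    rw [exponent, ← hs.tsum_eq, ← tsum_mul_left]
    exact tsum_congr fun κ => by ring

/-- Neither the rate nor the constant C is assumed nonnegative, so absolute values are taken;
summability survives. -/
theorem AssumptionA.exists_decayBound (hf : MeasurePreserving f μ μ)
    (hU : ∀ n, MeasurableSet (U n)) {B : Type*} [NormedAddCommGroup B] [NormedSpace ℝ B]
    {ev : B →ₗ[ℝ] (X → ℝ)} (h : AssumptionA μ f q U ev) :
    ∃ ρ : ℕ → ℝ, (∀ t, 0 ≤ ρ t) ∧ Summable ρ ∧ ∀ᶠ n in atTop, DecayBound μ f q (U n) ρ := by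
  obtain ⟨-, ⟨ρ, hρ, hD⟩, C, hC⟩ := h
  refine ⟨fun t => |ρ t| * |C|, fun t => by positivity, hρ.abs.mul_right _, ?_⟩
  filter_upwards [hC] with n hn κ ψ hψ hψ1 t
  obtain ⟨b, hb, hbC⟩ := hn κ
  have hint := integrable_of_mem_Icc (μ := μ) hψ hψ1
  obtain ⟨-, h2⟩ := hD b ψ hψ hint t
  have habs : ∫ x, |ψ x| ∂μ = ∫ x, ψ x ∂μ :=
    integral_congr_ae (Eventually.of_forall fun x => abs_of_nonneg (hψ1 x).1)
  have hψ0 : 0 ≤ ∫ x, ψ x ∂μ := integral_nonneg fun x => (hψ1 x).1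
  have hA : ∫ x, (setA f q (U n) κ).indicator (fun _ => (1 : ℝ)) x ∂μ =
      μ.real (setA f q (U n) κ) := by
    rw [integral_indicator_const _ (measurableSet_setA hf.measurable (hU n) κ), smul_eq_mul,
      mul_one]
  rw [hb, habs, hA] at h2
  refine h2.trans ?_
  rw [mul_assoc]
  refine mul_le_mul (le_abs_self _) ?_ (by positivity) (abs_nonneg _)
  exact mul_le_mul_of_nonneg_right (hbC.trans (le_abs_self C)) hψ0

end Multiplicity

/-! ### Levels close to the maximum -/

section Levels

theorem tendsto_zero_of_natCast_mul {a : ℕ → ℝ} {τ : ℝ}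
    (h : Tendsto (fun n : ℕ => (n : ℝ) * a n) atTop (𝓝 τ)) : Tendsto a atTop (𝓝 0) := by
  have := h.mul tendsto_inv_atTop_nhds_zero_nat
  rw [mul_zero] at this
  refine this.congr' ?_
  filter_upwards [eventually_gt_atTop 0] with n hn
  have : (n : ℝ) ≠ 0 := by exact_mod_cast hn.ne'
  field_simp

theorem eventually_pos_of_natCast_mul {a : ℕ → ℝ} {τ : ℝ} (hτ : 0 < τ)
    (h : Tendsto (fun n : ℕ => (n : ℝ) * a n) atTop (𝓝 τ)) : ∀ᶠ n in atTop, 0 < a n := by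
  filter_upwards [h.eventually (lt_mem_nhds hτ)] with n hn
  exact pos_of_mul_pos_right hn (Nat.cast_nonneg n)

/-- A connected space which carries sets of small positive measure has no isolated points. -/
theorem not_isOpen_singleton {X : Type*} [TopologicalSpace X] [T1Space X] [PreconnectedSpace X]
    [MeasurableSpace X] {μ : Measure X} [IsProbabilityMeasure μ] {U : Set X}
    (h0 : 0 < μ.real U) (h1 : μ.real U < 1) (x : X) : ¬ IsOpen ({x} : Set X) := by
  intro hx
  have huniv : ({x} : Set X) = univ :=
    (isClopen_iff.1 ⟨isClosed_singleton, hx⟩).resolve_left (singleton_ne_empty x)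
  have hU : U = univ := by
    have hne : U.Nonempty := by
      rw [nonempty_iff_ne_empty]; rintro rfl; simp at h0
    obtain ⟨y, hy⟩ := hne
    refine eq_univ_of_forall fun w => ?_
    have e : ∀ v : X, v = x := fun v => by
      have : v ∈ ({x} : Set X) := huniv ▸ mem_univ v
      exact this
    rw [e w, ← e y]; exact hy
  rw [hU, probReal_univ] at h1
  exact h1.false

/-- Over a zero-dimensional model space a chart domain would be an open singleton. -/
theorem nontrivial_model {E X : Type*} [TopologicalSpace E] [TopologicalSpace X]
    [ChartedSpace E X] {x : X} (hx : ¬ IsOpen ({x} : Set X)) : Nontrivial E := by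
  by_contra hE
  rw [not_nontrivial_iff_subsingleton] at hE
  refine hx ?_
  have : (chartAt E x).source = {x} := by
    refine subset_antisymm (fun y hy => ?_) (singleton_subset_iff.2 (mem_chart_source E x))
    exact (chartAt E x).injOn hy (mem_chart_source E x) (Subsingleton.elim _ _)
  rw [← this]
  exact (chartAt E x).open_source

theorem biUnion_localBall {X : Type*} [MetricSpace X] (N : ℕ) (ξ : ℕ → X) (ε : ℝ → ℕ → ℝ)
    (u : ℝ) : ⋃ i ∈ Finset.range N, localBall N ξ ε u i =
      ⋃ i ∈ Finset.range N, Metric.ball (ξ i) (ε u i) := by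
  refine iUnion₂_congr fun i hi => ?_
  rw [localBall, Nat.mod_eq_of_lt (Finset.mem_range.1 hi)]

end Levels

end RareEvents

end

open RareEvents

theorem mainTheorem4
    {E : Type*} [NormedAddCommGroup E] [NormedSpace ℝ E] [FiniteDimensional ℝ E]
    {X : Type*} [MetricSpace X] [ChartedSpace E X] [IsManifold 𝓘(ℝ, E) ∞ X]
    [Bundle.RiemannianBundle (fun x : X => TangentSpace 𝓘(ℝ, E) x)]
    [IsContMDiffRiemannianBundle 𝓘(ℝ, E) ∞ E (fun x : X => TangentSpace 𝓘(ℝ, E) x)]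
    [IsRiemannianManifold 𝓘(ℝ, E) X]
    [MeasurableSpace X] [BorelSpace X]
    (μ : Measure X) [IsProbabilityMeasure μ]
    (f : X → X) (hf : MeasurePreserving f μ μ)
    -- the repelling periodic point and the cyclic numbering of the maxima on its orbit
    (p : ℕ) (ζ : X) (hζ : RareEvents.IsRepellingPeriodic E f p ζ)
    (N : ℕ) (hN : 0 < N) (m : ℕ → ℕ) (hm : StrictMono m) (hm0 : m 0 = 0)
    (hmN : ∀ a, m (a + N) = m a + p)
    -- the observable
    (φ : X → EReal) (hφ : Measurable φ) (hmax : ∀ x, φ x ≤ φ ζ)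
    (hargmax : ∀ x, φ x = φ ζ ↔ ∃ i < N, x = f^[m i] ζ)
    (ε : ℝ → ℕ → ℝ) (hR1 : RareEvents.CondR1 μ φ ζ N (fun i => f^[m i] ζ) ε)
    -- the levels
    (τ : ℝ) (hτ : 0 < τ) (u : ℕ → ℝ)
    (hu : Tendsto (fun n => (u n : EReal)) atTop (𝓝 (φ ζ)))
    (huτ : Tendsto (fun n : ℕ => (n : ℝ) * μ.real (RareEvents.exceed φ (u n))) atTop (𝓝 τ))
    (hR3 : RareEvents.CondR3 f m N
      (fun n a => RareEvents.localBall N (fun i => f^[m i] ζ) ε (u n) a))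
    -- the function space of the decay of correlations
    {B : Type*} [NormedAddCommGroup B] [NormedSpace ℝ B] [CompleteSpace B]
    (ev : B →ₗ[ℝ] (X → ℝ)) :
    (∀ k : ℕ, ∀ᶠ n in atTop,
      let S : ℕ → Set X := RareEvents.localBall N (fun i => f^[m i] ζ) ε (u n)
      (∃ (I : ℕ → Finset ℕ) (j : ℕ → ℕ → ℕ), RareEvents.IsIndexSystem f m N S (k + 1) I j) ∧
      ∀ (I : ℕ → Finset ℕ) (j : ℕ → ℕ → ℕ), RareEvents.IsIndexSystem f m N S (k + 1) I j →
        μ.real (RareEvents.setA f p (RareEvents.exceed φ (u n)) k) =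
          ∑ i ∈ I (k + 1),
            (μ.real (RareEvents.pull f m S i (j i k) ∩ S i) -
              μ.real (RareEvents.pull f m S i (j i (k + 1)) ∩ S i))) ∧
    (RareEvents.AssumptionA μ f p (fun n => RareEvents.exceed φ (u n)) ev →
      ∀ (θ : ℝ) (hθ : 0 < θ) (r : ℕ → ℝ),
        Tendsto (fun n => μ.real (RareEvents.setA f p (RareEvents.exceed φ (u n)) 0) /
          μ.real (RareEvents.exceed φ (u n))) atTop (𝓝 θ) →
        (∀ k, 1 ≤ k → Tendsto (fun n =>
          (μ.real (RareEvents.setA f p (RareEvents.exceed φ (u n)) (k - 1)) -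
            μ.real (RareEvents.setA f p (RareEvents.exceed φ (u n)) k)) /
          μ.real (RareEvents.setA f p (RareEvents.exceed φ (u n)) 0)) atTop (𝓝 (r k))) →
        ∃ P : PMF ℕ, P 0 = 0 ∧ (∀ k, 1 ≤ k → (P k).toReal = r k) ∧
          TendstoInDistribution
            (fun n => RareEvents.repp μ f (RareEvents.exceed φ (u n))) atTop
            RareEvents.compoundPoisson (fun _ => μ) (RareEvents.cpSpace θ hθ P)) := by
  set U : ℕ → Set X := fun n => exceed φ (u n) with hU
  set ξ : ℕ → X := fun i => f^[m i] ζ with hξ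
  have hUm : ∀ n, MeasurableSet (U n) := fun n => hφ measurableSet_Ioi
  have hrare : Tendsto (fun n => μ.real (U n)) atTop (𝓝 0) := tendsto_zero_of_natCast_mul huτ
  have hpos : ∀ᶠ n in atTop, 0 < μ.real (U n) := eventually_pos_of_natCast_mul hτ huτ
  have : PreconnectedSpace X := preconnectedSpace_of_riemannian E
  -- A one-point manifold is excluded by the existence of levels with 0 < μ(U_n) < 1; shrinking of
  -- the balls and positive dimension both depend on it.
  have hiso : ∀ x : X, ¬ IsOpen ({x} : Set X) := by
    obtain ⟨n, h0, h1⟩ := (hpos.and (hrare.eventually (gt_mem_nhds one_pos))).exists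
    exact not_isOpen_singleton h0 h1
  have : Nontrivial E := nontrivial_model (hiso ζ)
  have hG := hζ.orbitGeometry
  have hξN : ∀ a, ξ (a + N) = ξ a := fun a => by
    have hp : f^[p] ζ = ζ := by rw [← hG.minimalPeriod]; exact Function.iterate_minimalPeriod
    simp only [hξ, hmN, Function.iterate_add_apply, hp]
  obtain ⟨u₀, hu₀, hballs, -⟩ := hR1
  -- That the levels lie strictly below the maximum is not assumed; it follows because exceedance
  -- sets of positive measure are nonempty.
  have hlt : ∀ᶠ n in atTop, (u n : EReal) < φ ζ := by
    filter_upwards [hpos] with n hn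
    have hne : (U n).Nonempty := by
      rw [nonempty_iff_ne_empty]; intro h; simp [h] at hn
    obtain ⟨x, hx⟩ := hne
    exact lt_of_lt_of_le hx (hmax x)
  have hR : ∀ᶠ n in atTop, (∀ i < N, 0 < ε (u n) i) ∧
      U n = ⋃ i ∈ Finset.range N, Metric.ball (ξ i) (ε (u n) i) := by
    filter_upwards [hlt, hu.eventually (lt_mem_nhds hu₀)] with n h1 h2
    exact hballs (u n) h2 h1
  have hS : Shrinking (fun n a => localBall N ξ ε (u n) a) ξ N :=
    shrinking_localBall hN hξN hmax hargmax hu (hR.mono fun n h => h.1) (hR.mono fun n h => h.2)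
      (fun x r => isPreconnected_ball E x r) hiso
  have hUS : ∀ᶠ n in atTop, U n = ⋃ i ∈ Finset.range N, localBall N ξ ε (u n) i := by
    filter_upwards [hR] with n h
    rw [biUnion_localBall, ← h.2]
  refine ⟨fun k => ?_, fun hA θ hθ r h0 hr => ?_⟩
  -- After k + 1 steps the indices have advanced by at most (k + 1) N, which fixes the horizon.
  · filter_upwards [hUS, hG.eventually_localPicture hm hm0 hmN hS hR3 ((k + 1) * N)] with n h1 h2
    refine ⟨exists_isIndexSystem hm hN hmN (hS.shift n) h2 (k + 1) le_rfl, fun I j hIj => ?_⟩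
    change μ.real (setA f p (U n) k) = _
    rw [h1]
    exact measure_setA_eq_sum hf.measurable (fun a => (hS.isOpen n a).measurableSet) hm hN hmN
      (hS.shift n) h2 le_rfl hIj
  · obtain ⟨P, β, hP0, hP, hlim, hβ⟩ := exists_multiplicity hf hUm hθ h0 hr
    refine ⟨P, hP0, hP, ?_⟩
    have hrs : RareSets μ f p U β :=
      { preserving := hf
        measurableSet := hUm
        rare := hrare
        pos := hpos
        decay := hA.exists_decayBound hf hUm
        no_return := fun T => by
          filter_upwards [hUS, hG.eventually_no_return hm hm0 hN hmN hS hR3 T] with n h1 h2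
          rw [h1]
          exact h2
        limit := hlim }
    exact hrs.tendstoInDistribution hθ P hβ
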